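/- For a finite simple graph $G=(V,E)$ let $\mathrm{MaxCut}(G)$ be the maximum, over all two-colourings of $V$, of the number of edges with differently coloured ends (the colourings attaining it are the optimal cuts). With $X_u, Z_u$ the Pauli operators acting on qubit $u\in V$, let $H_m=\sum_{u\in V}X_u$ and $H_p=\sum_{(u,v)\in E}Z_uZ_v$; let $\mathfrak g_G$ be the real Lie algebra, under the commutator, generated by $\mathrm i H_m$ and $\mathrm i H_p$ (the dynamical Lie algebra, DLA, of $G$), and let $\mathfrak g_{G,\mathrm{ma}}$ be the real Lie algebra generated by all $\mathrm i X_u$ $(u\in V)$ and all $\mathrm i Z_uZ_v$ $((u,v)\in E)$. The DLA of $G$ is free if $\mathfrak g_G=\mathfrak g_{G,\mathrm{ma}}$. An odd graph is a connected graph with at least $3$ vertices, all of odd degree. An asymmetric subdivision of a graph $H$ is obtained by replacing all edges of $H$, or all but one, by paths with at least one new inner vertex each, the numbers of new vertices on different replaced edges being pairwise different. An asymmetrically subdivided odd graph is an asymmetric subdivision of an odd graph. Theorem. There are a constant $c$ and three polynomial-time algorithms (on random access machines with unit-cost addition and subtraction; graphs are given by adjacency matrices and cuts by bit vectors) with the following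 properties. For every finite connected graph $G=(V,E)$, the first algorithm computes from $G$ an asymmetrically subdivided odd graph $G'=(V',E')$ with $|V'|,|E'|\le c\cdot\max(1,|E|^2)$, so $|V'|,|E'|\in O(|E|^2)$, such that 1. $\mathrm{MaxCut}(G')-\mathrm{MaxCut}(G)=|V'|-|V|$; the second algorithm computes an optimal cut of $G'$ from $G$ and any optimal cut of $G$, and the third computes an optimal cut of $G$ from $G$ and any optimal cut of $G'$; 2. the DLA of $G'$ is free: $\mathfrak g_{G'}=\mathfrak g_{G',\mathrm{ma}}$. -/

import Mathlib

namespace DLAMaxCut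

/-! ### Cuts -/

section Cuts

variable {V : Type*} [Fintype V]

open Classical in
/-- The size of the cut given by a two-colouring `C`: the number of edges whose two ends have
different colours. -/
noncomputable def cutSize (G : SimpleGraph V) (C : V → Bool) : ℕ :=
  (G.edgeFinset.filter fun e => ¬ (e.map C).IsDiag).card

open Classical in
/-- The maximum size of a cut of `G`. -/
noncomputable def maxCut (G : SimpleGraph V) : ℕ :=
  Finset.univ.sup fun C : V → Bool => cutSize G C

/-- `C` is an optimal solution of the MaxCut problem on `G`. -/
def IsOptimalCut (G : SimpleGraph V) (C : V → Bool) : Prop :=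
  cutSize G C = maxCut G

end Cuts

/-! ### Asymmetrically subdivided odd graphs -/

section Subdivision

/-- A connected graph with at least three vertices, all of odd degree. -/
structure IsOddGraph {V : Type*} [Fintype V] (G : SimpleGraph V) : Prop where
  connected : G.Connected
  three_le_card : 3 ≤ Fintype.card V
  odd_degree : ∀ v, Odd (G.neighborSet v).ncard

variable {W : Type*}

/-- The vertices `u = 0, w¹ = 1, …, w^ℓ = ℓ, v = ℓ + 1` of the path that replaces the edge
`e = uv`, where `u = src e`, `v = tgt e`, `ℓ = len e`. The vertices of the subdivision are the old
vertices together with `len e` new ones for every edge `e`. -/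
def pathVertex {H : SimpleGraph W} (src tgt : H.edgeSet → W) (len : H.edgeSet → ℕ)
    (e : H.edgeSet) : ℕ → W ⊕ (Σ e : H.edgeSet, Fin (len e))
  | 0 => Sum.inl (src e)
  | j + 1 => if h : j < len e then Sum.inr ⟨e, ⟨j, h⟩⟩ else Sum.inl (tgt e)

/-- The subdivision of `H` in which every edge `e` is replaced by a path with `len e` new inner
vertices; `len e = 0` means that the edge `e` is kept. -/
def subdivide (H : SimpleGraph W) (src tgt : H.edgeSet → W) (len : H.edgeSet → ℕ) :
    SimpleGraph (W ⊕ (Σ e : H.edgeSet, Fin (len e))) :=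
  SimpleGraph.fromEdgeSet {a | ∃ e : H.edgeSet, ∃ i ≤ len e,
    a = s(pathVertex src tgt len e i, pathVertex src tgt len e (i + 1))}

/-- `G` is (up to isomorphism) an asymmetric subdivision of `H`: at most one edge of `H` is not
subdivided, and the other edges receive pairwise different numbers of new vertices. -/
def IsAsymmetricSubdivision {V : Type*} (H : SimpleGraph W) (G : SimpleGraph V) : Prop :=
  ∃ (src tgt : H.edgeSet → W) (len : H.edgeSet → ℕ),
    (∀ e, s(src e, tgt e) = e.1) ∧
    {e | len e = 0}.Subsingleton ∧
    Set.InjOn len {e | 1 ≤ len e} ∧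
    Nonempty (G ≃g subdivide H src tgt len)

/-- `G` is an asymmetric subdivision of an odd graph. -/
def IsAsymmetricallySubdividedOddGraph {V : Type*} (G : SimpleGraph V) : Prop :=
  ∃ (k : ℕ) (H : SimpleGraph (Fin k)), IsOddGraph H ∧ IsAsymmetricSubdivision H G

end Subdivision

/-! ### Dynamical Lie algebras of QAOA-MaxCut -/

section DLA

variable {V : Type*} [Fintype V] [DecidableEq V]

/-- Operators on the qubits labelled by `V`, as matrices in the computational basis. -/
abbrev Operator (V : Type*) := Matrix (V → Fin 2) (V → Fin 2) ℂ

/-- The tensor product over `u : V` of the one-qubit operators `P u`. -/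
def tensor (P : V → Matrix (Fin 2) (Fin 2) ℂ) : Operator V :=
  Matrix.of fun x y => ∏ u, P u (x u) (y u)

/-- The Pauli matrix `X`. -/
def pauliX : Matrix (Fin 2) (Fin 2) ℂ := !![0, 1; 1, 0]

/-- The Pauli matrix `Z`. -/
def pauliZ : Matrix (Fin 2) (Fin 2) ℂ := !![1, 0; 0, -1]

/-- `X` acting on the qubit `u`. -/
def opX (u : V) : Operator V := tensor fun w => if w = u then pauliX else 1

/-- `Z` acting on the qubit `u`. -/
def opZ (u : V) : Operator V := tensor fun w => if w = u then pauliZ else 1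

theorem opZ_eq_diagonal (u : V) :
    opZ u = Matrix.diagonal fun x : V → Fin 2 => pauliZ (x u) (x u) := by
  ext x y
  by_cases hxy : x = y
  · subst hxy
    rw [Matrix.diagonal_apply_eq]
    simp only [opZ, tensor, Matrix.of_apply]
    rw [Finset.prod_eq_single u]
    · simp
    · intro w _ hw
      simp [hw]
    · simp
  · rw [Matrix.diagonal_apply_ne _ hxy]
    obtain ⟨w, hw⟩ := Function.ne_iff.mp hxy
    simp only [opZ, tensor, Matrix.of_apply]
    refine Finset.prod_eq_zero (Finset.mem_univ w) ?_
    by_cases hwu : w = u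
    · simp only [hwu, if_true]
      rw [hwu] at hw
      generalize x u = a at hw ⊢
      generalize y u = b at hw ⊢
      fin_cases a <;> fin_cases b <;> simp_all [pauliZ]
    · simp [hwu, Matrix.one_apply_ne hw]

theorem opZ_mul_comm (u v : V) : opZ u * opZ v = opZ v * opZ u := by
  simp only [opZ_eq_diagonal, Matrix.diagonal_mul_diagonal, mul_comm]

/-- `Z_u Z_v` for the unordered pair `e = {u, v}`. -/
def opZZ (e : Sym2 V) : Operator V :=
  Sym2.lift ⟨fun u v => opZ u * opZ v, opZ_mul_comm⟩ e

open Classical in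
/-- The problem Hamiltonian `H_p`, the sum of `Z_u Z_v` over the edges `uv`. -/
noncomputable def problemHamiltonian (G : SimpleGraph V) : Operator V :=
  ∑ e ∈ G.edgeFinset, opZZ e

/-- The mixer Hamiltonian `H_m`, the sum of all `X_u`. -/
def mixerHamiltonian (V : Type*) [Fintype V] [DecidableEq V] : Operator V :=
  ∑ u : V, opX u

attribute [local instance] LieRing.ofAssociativeRing

/-- The standard dynamical Lie algebra: the real Lie algebra (under the commutator) generated by
`i H_p` and `i H_m`. -/
noncomputable def dla (G : SimpleGraph V) : LieSubalgebra ℝ (Operator V) :=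
  LieSubalgebra.lieSpan ℝ (Operator V)
    {Complex.I • problemHamiltonian G, Complex.I • mixerHamiltonian V}

/-- The multi-angle dynamical Lie algebra: the real Lie algebra generated by all `i X_u` and by
`i Z_u Z_v` for all edges `uv`. -/
noncomputable def dlaMultiAngle (G : SimpleGraph V) : LieSubalgebra ℝ (Operator V) :=
  LieSubalgebra.lieSpan ℝ (Operator V)
    (Set.range (fun u : V => Complex.I • opX u) ∪ (fun e => Complex.I • opZZ e) '' G.edgeSet)

/-- The dynamical Lie algebra of `G` is free. -/
def IsFreeDLA (G : SimpleGraph V) : Prop :=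
  dla G = dlaMultiAngle G

end DLA

/-! ### Random access machines and their running time

A structured random access machine with registers and arrays holding natural numbers. A program
mentions only finitely many registers and arrays by name; array cells are addressed indirectly.
Each instruction and each test costs one step. The only arithmetic is addition and truncated
subtraction, so after `t` steps all numbers have `O(t)` bits more than at the start, and polynomial
time on this machine is polynomial time on a Turing machine. -/

section Machine

/-- The state of a machine: registers, and arrays indexed by name and address. -/
structure RamState where
  reg : ℕ → ℕ
  arr : ℕ → ℕ → ℕ

/-- Elementary instructions. -/
inductive Instr where
  /-- `r := k` -/
  | const (r k : ℕ)
  /-- `r := s + t` -/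
  | add (r s t : ℕ)
  /-- `r := s - t` (truncated) -/
  | sub (r s t : ℕ)
  /-- `r := a[s]` -/
  | load (r a s : ℕ)
  /-- `a[s] := r` -/
  | store (a s r : ℕ)

/-- The effect of an elementary instruction. -/
def Instr.exec : Instr → RamState → RamState
  | .const r k, σ => { σ with reg := Function.update σ.reg r k }
  | .add r s t, σ => { σ with reg := Function.update σ.reg r (σ.reg s + σ.reg t) }
  | .sub r s t, σ => { σ with reg := Function.update σ.reg r (σ.reg s - σ.reg t) }
  | .load r a s, σ => { σ with reg := Function.update σ.reg r (σ.arr a (σ.reg s)) }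
  | .store a s r, σ =>
    { σ with arr := Function.update σ.arr a (Function.update (σ.arr a) (σ.reg s) (σ.reg r)) }

/-- Programs. -/
inductive Program where
  /-- an elementary instruction -/
  | instr (c : Instr)
  /-- do nothing -/
  | skip
  /-- first `p`, then `q` -/
  | seq (p q : Program)
  /-- if register `r` is nonzero then `p` else `q` -/
  | ite (r : ℕ) (p q : Program)
  /-- while register `r` is nonzero do `p` -/
  | loop (r : ℕ) (p : Program)

/-- `Run p σ τ t`: started in the state `σ`, the program `p` halts in the state `τ` after exactly
`t` steps. -/
inductive Run : Program → RamState → RamState → ℕ → Prop where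
  | instr (c : Instr) (σ : RamState) : Run (.instr c) σ (c.exec σ) 1
  | skip (σ : RamState) : Run .skip σ σ 1
  | seq {p q : Program} {σ τ υ : RamState} {t₁ t₂ : ℕ} :
      Run p σ τ t₁ → Run q τ υ t₂ → Run (.seq p q) σ υ (t₁ + t₂)
  | ite_true {r : ℕ} {p q : Program} {σ τ : RamState} {t : ℕ} :
      σ.reg r ≠ 0 → Run p σ τ t → Run (.ite r p q) σ τ (t + 1)
  | ite_false {r : ℕ} {p q : Program} {σ τ : RamState} {t : ℕ} :
      σ.reg r = 0 → Run q σ τ t → Run (.ite r p q) σ τ (t + 1)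
  | loop_done {r : ℕ} {p : Program} {σ : RamState} :
      σ.reg r = 0 → Run (.loop r p) σ σ 1
  | loop_step {r : ℕ} {p : Program} {σ τ υ : RamState} {t₁ t₂ : ℕ} :
      σ.reg r ≠ 0 → Run p σ τ t₁ → Run (.loop r p) τ υ t₂ →
      Run (.loop r p) σ υ (t₁ + t₂ + 1)

/-- The initial state on the input word `x`: register `0` holds the length of `x`, array `0` holds
the bits of `x`, and everything else is zero. -/
def inputState (x : List Bool) : RamState where
  reg r := if r = 0 then x.length else 0
  arr a i := if a = 0 then (x.getD i false).toNat else 0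

/-- The state `τ` shows the output word `y`: register `0` holds the length of `y`, and array `1`
holds the bits of `y`. -/
def ShowsOutput (τ : RamState) (y : List Bool) : Prop :=
  τ.reg 0 = y.length ∧ ∀ i < y.length, τ.arr 1 i = (y.getD i false).toNat

/-- On the input word `x`, the program `p` outputs the word `y` after at most `t` steps. -/
def OutputsWithin (p : Program) (x y : List Bool) (t : ℕ) : Prop :=
  ∃ (τ : RamState) (s : ℕ), s ≤ t ∧ Run p (inputState x) τ s ∧ ShowsOutput τ y

end Machine

/-! ### Encodings -/

section Encoding

open Classical in
/-- A graph on `{0, …, n - 1}` as a word: `n` in unary, a separator, and the adjacency matrix in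
row-major order. -/
noncomputable def encodeGraph {n : ℕ} (G : SimpleGraph (Fin n)) : List Bool :=
  List.replicate n true ++ false ::
    List.ofFn fun k : Fin (n * n) => decide (G.Adj k.divNat k.modNat)

/-- A two-colouring of `{0, …, n - 1}` as a word of length `n`. -/
def encodeCut {n : ℕ} (C : Fin n → Bool) : List Bool :=
  List.ofFn C

end Encoding

end DLAMaxCut

/-!
A leaf is attached to `G` for every end of an edge, and three leaves to every vertex. A vertex
of degree `a` gets the odd degree `2 * a + 3`, and the leaves have degree one. Then the edge number
`t` of this odd graph is replaced by a path with `2 * t + 2` inner vertices. A cut can gain at most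
one on each edge to a leaf and, the number of inner vertices of a path being even, at most that
number on each path over what its ends contribute; both gains are attained by alternating the
colours. Hence the maximum cut grows by exactly the number of new vertices.

For the freeness, interpolating the adjoint action of `∑ X` over a set of vertices, or of `∑ ZZ`
over a set of edges, gives two parity filters: with these sums the dynamical Lie algebra
contains the sum of `ZZ` over the edges with exactly one end in the set of vertices, and the sum
of `X` over the vertices on an odd number of edges of the set. The full sum of `ZZ` separates
the vertices of odd degree from the inner vertices of the paths. Alternating between vertices
and edges peels off the inner vertices layer by layer from the ends of the paths. As the paths
have different lengths, this isolates the middle of each path, and the way back outwards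
isolates all layers of a single path. Two edges of the odd graph that share only one end `x`
tell `x` from the other ends, which breaks the remaining symmetry between the two halves of a
path.
-/

namespace DLAMaxCut

/-! ### Enumerated edges -/

section EdgeEnumeration

variable {V ι : Type*} {G : SimpleGraph V} {p q : ι → V}

/-- The edges of `G` are the pairs `{p a, q a}`, each listed once. Indexing edges by an arbitrary
type gives them two distinguished ends, which `Sym2` does not. -/
structure EnumeratesEdges (G : SimpleGraph V) (p q : ι → V) : Prop where
  injective : Function.Injective fun a => s(p a, q a)
  range_eq : Set.range (fun a => s(p a, q a)) = G.edgeSet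

theorem enumeratesEdges_fromEdgeSet (hne : ∀ a, p a ≠ q a)
    (hinj : Function.Injective fun a => s(p a, q a)) :
    EnumeratesEdges (SimpleGraph.fromEdgeSet (Set.range fun a => s(p a, q a))) p q := by
  refine ⟨hinj, ?_⟩
  rw [SimpleGraph.edgeSet_fromEdgeSet, eq_comm, sdiff_eq_left, Set.disjoint_left]
  rintro _ ⟨a, rfl⟩ hdiag
  exact hne a (by simpa using hdiag)

namespace EnumeratesEdges

variable (h : EnumeratesEdges G p q)

include h

theorem adj_iff {x y : V} : G.Adj x y ↔ ∃ a, s(p a, q a) = s(x, y) := by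
  rw [← SimpleGraph.mem_edgeSet, ← h.range_eq, Set.mem_range]

theorem ne (a : ι) : p a ≠ q a :=
  G.ne_of_adj (h.adj_iff.mpr ⟨a, rfl⟩)

open Classical in
theorem sum_edgeFinset [Fintype V] [Fintype ι] {M : Type*} [AddCommMonoid M] (f : Sym2 V → M) :
    ∑ e ∈ G.edgeFinset, f e = ∑ a, f s(p a, q a) := by
  have himage : G.edgeFinset = Finset.univ.image fun a => s(p a, q a) := by
    ext e
    rw [SimpleGraph.mem_edgeFinset, ← h.range_eq]
    simp
  rw [himage, Finset.sum_image fun a _ b _ hab => h.injective hab]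

theorem ncard_edgeSet [Fintype ι] : G.edgeSet.ncard = Fintype.card ι := by
  rw [← h.range_eq, ← Set.image_univ, Set.ncard_image_of_injective _ h.injective, Set.ncard_univ,
    Nat.card_eq_fintype_card]

theorem ncard_neighborSet (x : V) :
    (G.neighborSet x).ncard = {a | p a = x ∨ q a = x}.ncard := by
  classical
  have hincidence : (G.neighborSet x).ncard = (G.incidenceSet x).ncard :=
    (Nat.card_congr (G.incidenceSetEquivNeighborSet x)).symm
  rw [hincidence, ← Set.ncard_image_of_injective _ h.injective]
  congr 1
  ext e
  simp only [SimpleGraph.incidenceSet, ← h.range_eq, Set.mem_ofPred_eq, Set.mem_image]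
  constructor
  · rintro ⟨⟨a, rfl⟩, hx⟩
    exact ⟨a, (Sym2.mem_iff.mp hx).imp Eq.symm Eq.symm, rfl⟩
  · rintro ⟨a, ha, rfl⟩
    exact ⟨⟨a, rfl⟩, Sym2.mem_iff.mpr (ha.imp Eq.symm Eq.symm)⟩

theorem cutSize_eq [Fintype V] [Fintype ι] (C : V → Bool) :
    cutSize G C = ∑ a, if C (p a) = C (q a) then 0 else 1 := by
  classical
  rw [cutSize, Finset.card_filter, h.sum_edgeFinset]
  simp only [Sym2.map_mk, Sym2.mk_isDiag_iff, ite_not]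

end EnumeratesEdges

end EdgeEnumeration

/-! ### Pauli strings -/

section PauliStrings

variable {V : Type*} [Fintype V] [DecidableEq V]

theorem tensor_mul_tensor (P Q : V → Matrix (Fin 2) (Fin 2) ℂ) :
    tensor P * tensor Q = tensor fun u => P u * Q u := by
  ext x y
  simp only [tensor, Matrix.mul_apply, Matrix.of_apply, Finset.prod_univ_sum,
    Fintype.piFinset_univ, Finset.prod_mul_distrib]

omit [DecidableEq V] in
theorem tensor_one : tensor (fun _ : V => (1 : Matrix (Fin 2) (Fin 2) ℂ)) = 1 := by
  ext x y
  by_cases h : x = y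
  · subst h; simp [tensor]
  · obtain ⟨w, hw⟩ := Function.ne_iff.mp h
    rw [Matrix.one_apply_ne h]
    exact Finset.prod_eq_zero (Finset.mem_univ w) (Matrix.one_apply_ne hw)

theorem opX_mul_self (u : V) : opX u * opX u = 1 := by
  rw [opX, tensor_mul_tensor, ← tensor_one]
  congr 1
  funext w
  by_cases h : w = u
  · simp [h, pauliX, Matrix.one_fin_two]
  · simp [h]

theorem opX_commute (u v : V) : Commute (opX u) (opX v) := by
  rw [Commute, SemiconjBy, opX, opX, tensor_mul_tensor, tensor_mul_tensor]
  congr 1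
  funext w
  by_cases h : w = u <;> by_cases h' : w = v <;> simp [h, h']

theorem differ_exactly_at_of_opX_apply_ne_zero {u : V} {x y : V → Fin 2} (h : opX u x y ≠ 0) :
    x u ≠ y u ∧ ∀ w, w ≠ u → x w = y w := by
  simp only [opX, tensor, Matrix.of_apply, Finset.prod_ne_zero_iff, Finset.mem_univ,
    forall_const] at h
  constructor
  · intro hu
    have hdiag : pauliX (y u) (y u) ≠ 0 := by simpa [hu] using h u
    generalize y u = b at hdiag
    fin_cases b <;> simp [pauliX] at hdiag
  · intro w hw
    by_contra hxy
    exact h w (by rw [if_neg hw, Matrix.one_apply_ne hxy])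

/-- The eigenvalue of `Z` on a computational basis state. -/
def spin (a : Fin 2) : ℤ := if a = 0 then 1 else -1

theorem pauliZ_apply_self (a : Fin 2) : pauliZ a a = (spin a : ℂ) := by
  fin_cases a <;> simp [pauliZ, spin]

theorem spin_eq_neg_of_ne {a b : Fin 2} (h : a ≠ b) : spin b = -spin a := by
  fin_cases a <;> fin_cases b <;> simp_all [spin]

theorem intCast_spin_zmod_two (a : Fin 2) : ((spin a : ℤ) : ZMod 2) = 1 := by
  fin_cases a <;> simp [spin]

theorem opZ_mul_opX_of_ne {u v : V} (h : u ≠ v) : opZ v * opX u = opX u * opZ v := by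
  rw [opZ_eq_diagonal]
  ext x y
  rw [Matrix.diagonal_mul, Matrix.mul_diagonal]
  by_cases hxy : opX u x y = 0
  · rw [hxy, mul_zero, zero_mul]
  · rw [(differ_exactly_at_of_opX_apply_ne_zero hxy).2 v h.symm, mul_comm]

theorem opZ_mul_opX_self (u : V) : opZ u * opX u = -(opX u * opZ u) := by
  rw [opZ_eq_diagonal]
  ext x y
  rw [Matrix.neg_apply, Matrix.diagonal_mul, Matrix.mul_diagonal]
  by_cases hxy : opX u x y = 0
  · rw [hxy, mul_zero, zero_mul, neg_zero]
  · rw [pauliZ_apply_self, pauliZ_apply_self,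
      spin_eq_neg_of_ne (differ_exactly_at_of_opX_apply_ne_zero hxy).1]
    push_cast
    ring

theorem opZ_mul_opZ_eq_diagonal (u v : V) : opZ u * opZ v =
    Matrix.diagonal fun x : V → Fin 2 => ((spin (x u) * spin (x v) : ℤ) : ℂ) := by
  simp only [opZ_eq_diagonal, Matrix.diagonal_mul_diagonal, pauliZ_apply_self, Int.cast_mul]

theorem opZ_mul_opZ_mul_opX_of_notMem {u v w : V} (hu : w ≠ u) (hv : w ≠ v) :
    opZ u * opZ v * opX w = opX w * (opZ u * opZ v) := by
  rw [mul_assoc, opZ_mul_opX_of_ne hv, ← mul_assoc, opZ_mul_opX_of_ne hu, mul_assoc]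

theorem opZ_mul_opZ_mul_opX_of_mem {u v w : V} (huv : u ≠ v) (hw : w = u ∨ w = v) :
    opZ u * opZ v * opX w = -(opX w * (opZ u * opZ v)) := by
  rcases hw with rfl | rfl
  · rw [mul_assoc, opZ_mul_opX_of_ne huv, ← mul_assoc, opZ_mul_opX_self, neg_mul, mul_assoc]
  · rw [mul_assoc, opZ_mul_opX_self, mul_neg, ← mul_assoc, opZ_mul_opX_of_ne huv.symm, mul_assoc]

end PauliStrings

/-! ### Parity filters -/

section SubsetSums

variable {ι M : Type*} [Fintype ι] [AddCommGroup M]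

open Classical in
/-- The sum of the generators `f a` over a subset `F` of the index type. Predicates are taken to be
decidable classically, as the subsets below are given by parity conditions. -/
noncomputable def subsetSum (f : ι → M) (F : Set ι) : M :=
  ∑ a with a ∈ F, f a

theorem subsetSum_univ (f : ι → M) : subsetSum f Set.univ = ∑ a, f a := by
  simp [subsetSum]

theorem subsetSum_empty (f : ι → M) : subsetSum f ∅ = 0 := by
  simp [subsetSum]

theorem subsetSum_singleton (f : ι → M) (a : ι) : subsetSum f {a} = f a := by
  classical
  rw [subsetSum, ← Finset.sum_singleton f a]
  congr 1
  ext
  simp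

theorem subsetSum_pair (f : ι → M) {a b : ι} (h : a ≠ b) : subsetSum f {a, b} = f a + f b := by
  classical
  rw [subsetSum, ← Finset.sum_pair h]
  congr 1
  ext
  simp

theorem subsetSum_inter_add_sdiff (f : ι → M) (F F' : Set ι) :
    subsetSum f (F ∩ F') + subsetSum f (F \ F') = subsetSum f F := by
  classical
  simp only [subsetSum, Set.mem_inter_iff, Set.mem_sdiff, ← Finset.filter_filter]
  exact Finset.sum_filter_add_sum_filter_not _ _ _

theorem subsetSum_sdiff (f : ι → M) {F F' : Set ι} (h : F' ⊆ F) :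
    subsetSum f (F \ F') = subsetSum f F - subsetSum f F' := by
  rw [← subsetSum_inter_add_sdiff f F F', Set.inter_eq_right.mpr h, add_sub_cancel_left]

end SubsetSums

section ParityFilters

variable {V ι : Type*} [Fintype V] [DecidableEq V] [Fintype ι]

attribute [local instance] LieRing.ofAssociativeRing

theorem smul_sq_sub_pow_mem {κ : Type*} [Fintype κ] [DecidableEq κ]
    {L : LieSubalgebra ℝ (Matrix κ κ ℂ)} {b : κ → ℝ}
    (hb : Complex.I • Matrix.diagonal (fun x => (b x : ℂ)) ∈ L) {M : Matrix κ κ ℂ} (hM : M ∈ L)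
    (k : ℕ) : Matrix.of (fun x y => ((b x - b y) ^ 2) ^ k • M x y) ∈ L := by
  induction k with
  | zero =>
    convert hM using 1
    ext
    simp
  | succ k ih =>
    convert neg_mem (L.lie_mem hb (L.lie_mem hb ih)) using 1
    ext x y
    simp only [Ring.lie_def, Matrix.neg_apply, Matrix.sub_apply, smul_mul_assoc,
      mul_smul_comm, Matrix.smul_apply, Matrix.diagonal_mul, Matrix.mul_diagonal,
      Matrix.of_apply, smul_eq_mul, Complex.real_smul]
    push_cast
    linear_combination (((b x : ℂ) - b y) ^ 2) ^ (k + 1) * M x y * Complex.I_sq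

/-- Interpolation turns powers of the adjoint action into its spectral projections. -/
theorem smul_function_sq_sub_mem {κ : Type*} [Fintype κ] [DecidableEq κ]
    {L : LieSubalgebra ℝ (Matrix κ κ ℂ)} {b : κ → ℝ}
    (hb : Complex.I • Matrix.diagonal (fun x => (b x : ℂ)) ∈ L) {M : Matrix κ κ ℂ} (hM : M ∈ L)
    (g : ℝ → ℝ) : Matrix.of (fun x y => g ((b x - b y) ^ 2) • M x y) ∈ L := by
  have hpoly (p : Polynomial ℝ) :
      Matrix.of (fun x y => p.eval ((b x - b y) ^ 2) • M x y) ∈ L := by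
    induction p using Polynomial.induction_on' with
    | add p q hp hq =>
      convert L.add_mem hp hq using 1
      ext x y
      simp [add_smul]
    | monomial k a =>
      convert L.smul_mem a (smul_sq_sub_pow_mem hb hM k) using 1
      ext x y
      simp [mul_assoc]
  let nodes : Finset ℝ := Finset.univ.image fun xy : κ × κ => (b xy.1 - b xy.2) ^ 2
  convert hpoly (Lagrange.interpolate nodes id g) using 6 with x y
  have hnode : (b x - b y) ^ 2 ∈ nodes := Finset.mem_image.mpr ⟨(x, y), Finset.mem_univ _, rfl⟩
  exact (Lagrange.eval_interpolate_at_node (v := id) g Function.injective_id.injOn hnode).symm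

/-- `i` times the sum of `X_u` over the vertices in `S`. -/
noncomputable def xSum (S : Set V) : Operator V :=
  subsetSum (fun u => Complex.I • opX u) S

/-- `i` times the sum of `Z_{p a} Z_{q a}` over the edges `a` in `F`. -/
noncomputable def zSum (p q : ι → V) (F : Set ι) : Operator V :=
  subsetSum (fun a => Complex.I • (opZ (p a) * opZ (q a))) F

open Classical in
/-- The energy of a basis state under the sum of `Z_{p a} Z_{q a}` over the edges `a` in `F`. -/
noncomputable def energy (p q : ι → V) (F : Set ι) (x : V → Fin 2) : ℤ :=
  ∑ a with a ∈ F, spin (x (p a)) * spin (x (q a))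

variable {L : LieSubalgebra ℝ (Operator V)} {p q : ι → V}

theorem zSum_eq_diagonal (F : Set ι) :
    zSum p q F = Complex.I • Matrix.diagonal fun x => ((energy p q F x : ℝ) : ℂ) := by
  classical
  rw [zSum, subsetSum, ← Finset.smul_sum]
  congr 1
  ext x y
  by_cases h : x = y
  · subst h
    simp [Matrix.sum_apply, opZ_mul_opZ_eq_diagonal, energy]
  · simp [Matrix.sum_apply, opZ_mul_opZ_eq_diagonal, h]

omit [Fintype V] [DecidableEq V] in
/-- The edges at `u` are exactly those whose term changes sign, and each such term is odd. -/
theorem exists_energy_sub_eq_two_mul (hpq : ∀ a, p a ≠ q a) (F : Set ι) {u : V} {x y : V → Fin 2}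
    (hu : x u ≠ y u) (hxy : ∀ w, w ≠ u → x w = y w) :
    ∃ k : ℤ, energy p q F x - energy p q F y = 2 * k ∧
      (Odd k ↔ Odd {a | a ∈ F ∧ (p a = u ∨ q a = u)}.ncard) := by
  classical
  refine ⟨∑ a with a ∈ F, if p a = u ∨ q a = u then spin (x (p a)) * spin (x (q a)) else 0,
    ?_, ?_⟩
  · rw [energy, energy, ← Finset.sum_sub_distrib, Finset.mul_sum]
    refine Finset.sum_congr rfl fun a _ => ?_
    by_cases hp : p a = u
    · have hq : q a ≠ u := fun hq => hpq a (hp.trans hq.symm)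
      rw [if_pos (Or.inl hp), hp, ← hxy _ hq, spin_eq_neg_of_ne hu]
      ring
    by_cases hq : q a = u
    · rw [if_pos (Or.inr hq), hq, ← hxy _ hp, spin_eq_neg_of_ne hu]
      ring
    · rw [if_neg (by tauto), hxy _ hp, hxy _ hq]
      ring
  · have hset : {a | a ∈ F ∧ (p a = u ∨ q a = u)} =
        ↑((Finset.univ.filter (· ∈ F)).filter fun a => p a = u ∨ q a = u) := by
      ext a; simp
    rw [hset, Set.ncard_coe_finset, ← ZMod.natCast_eq_one_iff_odd, ← ZMod.intCast_eq_one_iff_odd,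
      Int.cast_sum, Finset.card_filter, Nat.cast_sum]
    refine Eq.congr_left (Finset.sum_congr rfl fun a _ => ?_)
    split_ifs <;> simp [intCast_spin_zmod_two]

theorem xSum_odd_mem (hpq : ∀ a, p a ≠ q a) {S : Set V} {F : Set ι} (hS : xSum S ∈ L)
    (hF : zSum p q F ∈ L) :
    xSum {u | u ∈ S ∧ Odd {a | a ∈ F ∧ (p a = u ∨ q a = u)}.ncard} ∈ L := by
  classical
  rw [zSum_eq_diagonal] at hF
  let g : ℝ → ℝ := fun s => if ∃ k : ℤ, Odd k ∧ s = (2 * k) ^ 2 then 1 else 0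
  have hg (u : V) {x y : V → Fin 2} (hu : opX u x y ≠ 0) :
      g (((energy p q F x : ℝ) - energy p q F y) ^ 2) =
        if Odd {a | a ∈ F ∧ (p a = u ∨ q a = u)}.ncard then 1 else 0 := by
    obtain ⟨hxu, hxy⟩ := differ_exactly_at_of_opX_apply_ne_zero hu
    obtain ⟨k, hk, hodd⟩ := exists_energy_sub_eq_two_mul hpq F hxu hxy
    have hdiff : (energy p q F x : ℝ) - energy p q F y = 2 * k := mod_cast hk
    rw [hdiff]
    refine if_congr (Iff.trans ⟨?_, fun h => ⟨k, h, rfl⟩⟩ hodd) rfl rfl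
    rintro ⟨k', hk', h⟩
    have hsq : (2 * k) ^ 2 = (2 * k') ^ 2 := mod_cast h
    rcases sq_eq_sq_iff_eq_or_eq_neg.mp hsq with h | h
    · rwa [show k = k' by omega]
    · rw [show k = -k' by omega]
      exact hk'.neg
  convert smul_function_sq_sub_mem hF hS g using 1
  ext x y
  simp only [xSum, subsetSum, Matrix.of_apply, Matrix.sum_apply, Finset.smul_sum,
    Set.mem_ofPred_eq]
  rw [← Finset.filter_filter, Finset.sum_filter]
  refine Finset.sum_congr rfl fun u _ => ?_
  by_cases hu : opX u x y = 0
  · simp [hu]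
  · rw [hg u hu]
    split_ifs <;> simp

theorem xSum_commute (S S' : Set V) : Commute (xSum S) (xSum S') :=
  Commute.sum_left _ _ _ fun u _ => Commute.sum_right _ _ _ fun v _ =>
    ((opX_commute u v).smul_right _).smul_left _

theorem lie_xSum_edge {u v : V} (huv : u ≠ v) (S : Set V) :
    ⁅xSum S, opZ u * opZ v⁆ = 2 • (xSum (S ∩ {u, v}) * (opZ u * opZ v)) := by
  have hcommute : opZ u * opZ v * xSum (S \ {u, v}) = xSum (S \ {u, v}) * (opZ u * opZ v) := by
    simp only [xSum, subsetSum, Finset.mul_sum, Finset.sum_mul]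
    refine Finset.sum_congr rfl fun w hw => ?_
    simp only [Finset.mem_filter, Set.mem_sdiff, Set.mem_insert_iff, Set.mem_singleton_iff,
      not_or] at hw
    rw [mul_smul_comm, smul_mul_assoc, opZ_mul_opZ_mul_opX_of_notMem hw.2.2.1 hw.2.2.2]
  have hanticommute :
      opZ u * opZ v * xSum (S ∩ {u, v}) = -(xSum (S ∩ {u, v}) * (opZ u * opZ v)) := by
    simp only [xSum, subsetSum, Finset.mul_sum, Finset.sum_mul, ← Finset.sum_neg_distrib]
    refine Finset.sum_congr rfl fun w hw => ?_
    simp only [Finset.mem_filter, Set.mem_inter_iff, Set.mem_insert_iff,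
      Set.mem_singleton_iff] at hw
    rw [mul_smul_comm, smul_mul_assoc, opZ_mul_opZ_mul_opX_of_mem huv hw.2.2, smul_neg]
  have hsplit : xSum S = xSum (S ∩ {u, v}) + xSum (S \ {u, v}) :=
    (subsetSum_inter_add_sdiff _ _ _).symm
  rw [Ring.lie_def, hsplit, add_mul, mul_add, hcommute, hanticommute]
  abel

theorem lie_lie_of_lie_eq_two_nsmul_mul {R : Type*} [Ring R] {A c z : R}
    (hAz : ⁅A, z⁆ = 2 • (c * z)) (hAc : Commute A c) (k : ℕ) :
    ⁅A, ⁅A, c ^ k * z⁆⁆ = 4 • (c ^ (k + 2) * z) := by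
  have hlie (k : ℕ) : ⁅A, c ^ k * z⁆ = 2 • (c ^ (k + 1) * z) := by
    have hcomm : A * c ^ k = c ^ k * A := hAc.pow_right k
    rw [Ring.lie_def] at hAz ⊢
    rw [← mul_assoc, hcomm, mul_assoc, mul_assoc, ← mul_sub, hAz, mul_smul_comm, ← mul_assoc,
      ← pow_succ]
  rw [hlie, lie_nsmul, hlie, smul_smul]
  rfl

theorem xSum_singleton_sq (u : V) : xSum {u} ^ 2 = (-1 : Operator V) := by
  rw [xSum, subsetSum_singleton, pow_two, smul_mul_smul_comm, opX_mul_self, Complex.I_mul_I,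
    neg_one_smul]

theorem xSum_pair_pow_four {u v : V} (huv : u ≠ v) :
    xSum {u, v} ^ 4 + 4 • xSum {u, v} ^ 2 = (0 : Operator V) := by
  have hpair : xSum {u, v} = xSum {u} + xSum {v} := by
    simp only [xSum, subsetSum_pair _ huv, subsetSum_singleton]
  have hcomm := xSum_commute {u} {v}
  have hsq : xSum {u, v} ^ 2 = 2 • (xSum {u} * xSum {v} - 1 : Operator V) := by
    rw [hpair, hcomm.add_sq, xSum_singleton_sq, xSum_singleton_sq]
    noncomm_ring
  have hprod : (xSum {u} * xSum {v}) ^ 2 = (1 : Operator V) := by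
    rw [hcomm.mul_pow, xSum_singleton_sq, xSum_singleton_sq, neg_mul_neg, one_mul]
  rw [pow_mul _ 2 2, hsq]
  generalize xSum {u} * xSum {v} = c at hprod
  have hexpand : (2 • (c - 1)) ^ 2 + 4 • (2 • (c - 1)) = 4 • (c ^ 2 - 1) := by noncomm_ring
  rw [hexpand, hprod, sub_self, smul_zero]

open Classical in
theorem xSum_inter_pair_pow_four {u v : V} (huv : u ≠ v) (S : Set V) :
    xSum (S ∩ {u, v}) ^ 4 + 4 • xSum (S ∩ {u, v}) ^ 2 =
      if Xor (u ∈ S) (v ∈ S) then (-3 : Operator V) else 0 := by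
  have hone (w : V) : xSum {w} ^ 4 + 4 • xSum {w} ^ 2 = (-3 : Operator V) := by
    rw [pow_mul _ 2 2, xSum_singleton_sq, nsmul_eq_mul]
    norm_num
  by_cases hu : u ∈ S <;> by_cases hv : v ∈ S
  · rw [Set.inter_eq_right.mpr (by simp [Set.insert_subset_iff, hu, hv]), xSum_pair_pow_four huv,
      if_neg (by simp [Xor, hu, hv])]
  · rw [Set.inter_insert_of_mem hu, Set.inter_singleton_eq_empty.mpr hv, insert_empty_eq, hone,
      if_pos (by simp [Xor, hu, hv])]
  · rw [Set.inter_insert_of_notMem hu, Set.inter_eq_right.mpr (by simpa using hv), hone,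
      if_pos (by simp [Xor, hu, hv])]
  · rw [Set.inter_insert_of_notMem hu, Set.inter_singleton_eq_empty.mpr hv, xSum,
      subsetSum_empty, if_neg (by simp [Xor, hu, hv])]
    simp

open Classical in
/-- On `Z_u Z_v` the square of the adjoint action of `xSum S` has the eigenvalue `-4` if exactly one
of `u`, `v` is in `S`; otherwise `Z_u Z_v` splits into parts with eigenvalues `0` and `-16`. -/
theorem lie_four_xSum_edge {u v : V} (huv : u ≠ v) (S : Set V) :
    ⁅xSum S, ⁅xSum S, ⁅xSum S, ⁅xSum S, opZ u * opZ v⁆⁆⁆⁆ +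
      16 • ⁅xSum S, ⁅xSum S, opZ u * opZ v⁆⁆ =
      if Xor (u ∈ S) (v ∈ S) then (-48 : ℤ) • (opZ u * opZ v) else 0 := by
  have hlie := lie_lie_of_lie_eq_two_nsmul_mul (lie_xSum_edge huv S) (xSum_commute S _)
  have htwo := hlie 0
  rw [pow_zero, one_mul] at htwo
  have hfactor (c z : Operator V) :
      4 • 4 • (c ^ (2 + 2) * z) + 16 • 4 • (c ^ (0 + 2) * z) = 16 • ((c ^ 4 + 4 • c ^ 2) * z) := by
    noncomm_ring
  rw [htwo, lie_nsmul, lie_nsmul, hlie 2, hfactor, xSum_inter_pair_pow_four huv]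
  split_ifs
  · noncomm_ring
  · noncomm_ring

theorem zSum_xor_mem (hpq : ∀ a, p a ≠ q a) {S : Set V} {F : Set ι} (hS : xSum S ∈ L)
    (hF : zSum p q F ∈ L) :
    zSum p q {a | a ∈ F ∧ Xor (p a ∈ S) (q a ∈ S)} ∈ L := by
  classical
  have htwo := L.lie_mem hS (L.lie_mem hS hF)
  have hfour := L.lie_mem hS (L.lie_mem hS htwo)
  convert L.smul_mem (-48⁻¹ : ℝ) (L.add_mem hfour (nsmul_mem htwo 16)) using 1
  have hfilter : ⁅xSum S, ⁅xSum S, ⁅xSum S, ⁅xSum S, zSum p q F⁆⁆⁆⁆ +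
      16 • ⁅xSum S, ⁅xSum S, zSum p q F⁆⁆ =
      ∑ a with a ∈ F, Complex.I • (if Xor (p a ∈ S) (q a ∈ S) then
        (-48 : ℤ) • (opZ (p a) * opZ (q a)) else 0) := by
    simp only [zSum, subsetSum, lie_sum, Finset.smul_sum, ← Finset.sum_add_distrib]
    refine Finset.sum_congr rfl fun a _ => ?_
    rw [← lie_four_xSum_edge (hpq a) S]
    simp only [Ring.lie_def, mul_smul_comm, smul_mul_assoc, ← smul_sub, smul_add,
      smul_comm (16 : ℕ) Complex.I]
  rw [hfilter, zSum, subsetSum, Finset.smul_sum]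
  simp only [Set.mem_ofPred_eq, ← Finset.filter_filter]
  rw [Finset.sum_filter]
  refine Finset.sum_congr rfl fun a _ => ?_
  split_ifs
  · rw [smul_comm, ← Int.cast_smul_eq_zsmul ℝ, smul_smul]
    norm_num
  · simp

/-- A family `X` of vertex sets and a family `Z` of sets of edges `p a, q a` that contain the full
sets and are closed under relative complements and under the two parity filters. The sets whose
generator sums lie in a Lie algebra containing both Hamiltonians form such families, and everything
else about these Lie algebras is combinatorics of such families. -/
structure ParityClosed {V ι : Type*} (p q : ι → V) (X : Set V → Prop) (Z : Set ι → Prop) :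
    Prop where
  vertices_univ : X Set.univ
  edges_univ : Z Set.univ
  vertices_sdiff : ∀ {S S'}, X S → X S' → S' ⊆ S → X (S \ S')
  edges_sdiff : ∀ {F F'}, Z F → Z F' → F' ⊆ F → Z (F \ F')
  vertices_odd : ∀ {S F}, X S → Z F → X {u | u ∈ S ∧ Odd {a | a ∈ F ∧ (p a = u ∨ q a = u)}.ncard}
  edges_xor : ∀ {S F}, X S → Z F → Z {a | a ∈ F ∧ Xor (p a ∈ S) (q a ∈ S)}

theorem parityClosed_sum_mem (hpq : ∀ a, p a ≠ q a) (hX : xSum Set.univ ∈ L)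
    (hZ : zSum p q Set.univ ∈ L) :
    ParityClosed p q (fun S => xSum S ∈ L) (fun F => zSum p q F ∈ L) where
  vertices_univ := hX
  edges_univ := hZ
  vertices_sdiff hS hS' h := by
    rw [xSum, subsetSum_sdiff _ h]
    exact L.sub_mem hS hS'
  edges_sdiff hF hF' h := by
    rw [zSum, subsetSum_sdiff _ h]
    exact L.sub_mem hF hF'
  vertices_odd := xSum_odd_mem hpq
  edges_xor := zSum_xor_mem hpq

theorem smul_mixerHamiltonian : Complex.I • mixerHamiltonian V = xSum Set.univ := by
  rw [xSum, subsetSum_univ, mixerHamiltonian, Finset.smul_sum]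

theorem EnumeratesEdges.smul_problemHamiltonian {G : SimpleGraph V} (h : EnumeratesEdges G p q) :
    Complex.I • problemHamiltonian G = zSum p q Set.univ := by
  rw [problemHamiltonian, h.sum_edgeFinset, zSum, subsetSum_univ, Finset.smul_sum]
  rfl

omit [Fintype ι] in
theorem EnumeratesEdges.isFreeDLA [Finite ι] {G : SimpleGraph V} (h : EnumeratesEdges G p q)
    (hsingletons : ∀ (X : Set V → Prop) (Z : Set ι → Prop), ParityClosed p q X Z →
      (∀ u, X {u}) ∧ ∀ a, Z {a}) :
    IsFreeDLA G := by
  cases nonempty_fintype ι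
  apply le_antisymm
  · refine LieSubalgebra.lieSpan_le.mpr ?_
    rintro M (rfl | rfl)
    · rw [h.smul_problemHamiltonian, zSum, subsetSum_univ]
      refine sum_mem fun a _ => LieSubalgebra.subset_lieSpan (Or.inr ⟨s(p a, q a), ?_, rfl⟩)
      exact h.range_eq ▸ Set.mem_range_self a
    · rw [smul_mixerHamiltonian, xSum, subsetSum_univ]
      exact sum_mem fun u _ => LieSubalgebra.subset_lieSpan (Or.inl ⟨u, rfl⟩)
  · have hX : xSum Set.univ ∈ dla G :=
      smul_mixerHamiltonian (V := V) ▸ LieSubalgebra.subset_lieSpan (Or.inr rfl)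
    have hZ : zSum p q Set.univ ∈ dla G :=
      h.smul_problemHamiltonian ▸ LieSubalgebra.subset_lieSpan (Or.inl rfl)
    obtain ⟨hu, ha⟩ := hsingletons _ _ (parityClosed_sum_mem h.ne hX hZ)
    simp only [xSum, zSum, subsetSum_singleton] at hu ha
    refine LieSubalgebra.lieSpan_le.mpr ?_
    rintro M (⟨u, rfl⟩ | ⟨e, he, rfl⟩)
    · exact hu u
    · rw [← h.range_eq] at he
      obtain ⟨a, rfl⟩ := he
      exact ha a

end ParityFilters

/-! ### Peeling of paths -/

section Peeling

variable {V τ : Type*} {ℓ : τ → ℕ}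

/-- The edges of a family of paths: the path `t` has `2 * ℓ t + 2` inner vertices, hence
`2 * ℓ t + 3` edges. -/
abbrev PathEdge (ℓ : τ → ℕ) := Σ t, Fin (2 * ℓ t + 3)

/-- The first vertex of an edge on a path. -/
def edgeFst (v : τ → ℕ → V) (a : PathEdge ℓ) : V := v a.1 a.2

/-- The second vertex of an edge on a path. -/
def edgeSnd (v : τ → ℕ → V) (a : PathEdge ℓ) : V := v a.1 (a.2 + 1)

/-- The two ends of a path. -/
def pathEnds (ℓ : τ → ℕ) (v : τ → ℕ → V) (t : τ) : Set V := {v t 0, v t (2 * ℓ t + 3)}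

/-- The inner vertices `v t j` with `P (ℓ t) j`. In a path system `ℓ t` determines `t`, so every set
of inner vertices has this form, and with `P` a formula of linear arithmetic, set identities become
arithmetic equivalences. -/
def innerSet (ℓ : τ → ℕ) (v : τ → ℕ → V) (P : ℕ → ℕ → Prop) : Set V :=
  {x | ∃ t j, 1 ≤ j ∧ j ≤ 2 * ℓ t + 2 ∧ x = v t j ∧ P (ℓ t) j}

/-- The edges number `i` of paths `t` with `P (ℓ t) i`. -/
def edgeSetOf (ℓ : τ → ℕ) (P : ℕ → ℕ → Prop) : Set (PathEdge ℓ) :=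
  {a | P (ℓ a.1) a.2}

theorem edgeSetOf_true : edgeSetOf ℓ (fun _ _ => True) = Set.univ :=
  Set.eq_univ_of_forall fun _ => trivial

/-- A family of paths `v t 0, …, v t (2 * ℓ t + 3)` of different lengths whose ends are among the
vertices in `O` and whose inner vertices are the vertices outside `O`, each occurring once: the
subdivision of a graph on `O` in which the numbers of new vertices are even and pairwise
different. -/
structure PathSystem (ℓ : τ → ℕ) (v : τ → ℕ → V) (O : Set V) : Prop where
  length_injective : Function.Injective ℓ
  src_mem : ∀ t, v t 0 ∈ O
  tgt_mem : ∀ t, v t (2 * ℓ t + 3) ∈ O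
  src_ne_tgt : ∀ t, v t 0 ≠ v t (2 * ℓ t + 3)
  inner_notMem : ∀ t j, 1 ≤ j → j ≤ 2 * ℓ t + 2 → v t j ∉ O
  inner_inj : ∀ t t' j j', 1 ≤ j → j ≤ 2 * ℓ t + 2 → 1 ≤ j' → j' ≤ 2 * ℓ t' + 2 →
    v t j = v t' j' → t = t' ∧ j = j'
  inner_surj : ∀ x, x ∉ O → ∃ t j, 1 ≤ j ∧ j ≤ 2 * ℓ t + 2 ∧ x = v t j

namespace PathSystem

variable {v : τ → ℕ → V} {O : Set V} (hv : PathSystem ℓ v O)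

include hv

theorem pathEnds_subset (t : τ) : pathEnds ℓ v t ⊆ O := by
  rintro _ (rfl | rfl)
  exacts [hv.src_mem t, hv.tgt_mem t]

theorem mem_iff {t : τ} {j : ℕ} (hj : j ≤ 2 * ℓ t + 3) :
    v t j ∈ O ↔ j = 0 ∨ j = 2 * ℓ t + 3 := by
  constructor
  · intro h
    by_contra hne
    exact hv.inner_notMem t j (by omega) (by omega) h
  · rintro (rfl | rfl)
    exacts [hv.src_mem t, hv.tgt_mem t]

theorem eq_of_eq_inner {t t' : τ} {i j : ℕ} (hi : i ≤ 2 * ℓ t' + 3) (h1 : 1 ≤ j)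
    (h2 : j ≤ 2 * ℓ t + 2) (h : v t' i = v t j) : t' = t ∧ i = j := by
  have hnotMem : v t' i ∉ O := h ▸ hv.inner_notMem t j h1 h2
  rw [hv.mem_iff hi] at hnotMem
  exact hv.inner_inj _ _ _ _ (by omega) (by omega) h1 h2 h

theorem mem_innerSet {P : ℕ → ℕ → Prop} {t : τ} {j : ℕ} (hj : j ≤ 2 * ℓ t + 3) :
    v t j ∈ innerSet ℓ v P ↔ 1 ≤ j ∧ j ≤ 2 * ℓ t + 2 ∧ P (ℓ t) j := by
  constructor
  · rintro ⟨t', j', h1', h2', h, hP⟩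
    obtain ⟨rfl, rfl⟩ := hv.eq_of_eq_inner hj h1' h2' h
    exact ⟨h1', h2', hP⟩
  · rintro ⟨h1, h2, hP⟩
    exact ⟨t, j, h1, h2, rfl, hP⟩

theorem notMem_innerSet {P : ℕ → ℕ → Prop} {x : V} (hx : x ∈ O) : x ∉ innerSet ℓ v P := by
  rintro ⟨t, j, h1, h2, rfl, -⟩
  exact hv.inner_notMem t j h1 h2 hx

theorem eq_innerSet {S : Set V} {P : ℕ → ℕ → Prop} (hO : ∀ x ∈ O, x ∉ S)
    (h : ∀ t j, 1 ≤ j → j ≤ 2 * ℓ t + 2 → (v t j ∈ S ↔ P (ℓ t) j)) : S = innerSet ℓ v P := by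
  ext x
  by_cases hx : x ∈ O
  · exact iff_of_false (hO x hx) (hv.notMem_innerSet hx)
  · obtain ⟨t, j, h1, h2, rfl⟩ := hv.inner_surj x hx
    rw [hv.mem_innerSet (by omega), h t j h1 h2]
    tauto

theorem innerSet_true : innerSet ℓ v (fun _ _ => True) = Oᶜ :=
  (hv.eq_innerSet (fun _ hx h => absurd hx h) fun t j h1 h2 =>
    iff_of_true (hv.inner_notMem t j h1 h2) trivial).symm

theorem edge_at_inner_iff {t : τ} {j : ℕ} (h1 : 1 ≤ j) (h2 : j ≤ 2 * ℓ t + 2) (a : PathEdge ℓ) :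
    edgeFst v a = v t j ∨ edgeSnd v a = v t j ↔
      a = ⟨t, j - 1, by omega⟩ ∨ a = ⟨t, j, by omega⟩ := by
  obtain ⟨s, i, hi⟩ := a
  constructor
  · rintro (h | h)
    · obtain ⟨rfl, rfl⟩ := hv.eq_of_eq_inner (by omega) h1 h2 h
      exact Or.inr rfl
    · obtain ⟨rfl, hij⟩ := hv.eq_of_eq_inner (Nat.succ_le_of_lt hi) h1 h2 h
      change i + 1 = j at hij
      obtain rfl : i = j - 1 := by omega
      exact Or.inl rfl
  · rintro (h | h) <;> cases h
    · exact Or.inr (congrArg (v t) (Nat.sub_add_cancel h1))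
    · exact Or.inl rfl

theorem odd_edges_at_inner_iff (Q : ℕ → ℕ → Prop) {t : τ} {j : ℕ} (h1 : 1 ≤ j)
    (h2 : j ≤ 2 * ℓ t + 2) :
    Odd {a | a ∈ edgeSetOf ℓ Q ∧ (edgeFst v a = v t j ∨ edgeSnd v a = v t j)}.ncard ↔
      Xor (Q (ℓ t) (j - 1)) (Q (ℓ t) j) := by
  classical
  let before : PathEdge ℓ := ⟨t, j - 1, by omega⟩
  let after : PathEdge ℓ := ⟨t, j, by omega⟩
  have hne : before ≠ after := by
    simp only [before, after, ne_eq, Sigma.mk.injEq, heq_eq_eq, Fin.mk.injEq, true_and]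
    omega
  have hset : {a | a ∈ edgeSetOf ℓ Q ∧ (edgeFst v a = v t j ∨ edgeSnd v a = v t j)} =
      ↑(({before, after} : Finset (PathEdge ℓ)).filter fun a => Q (ℓ a.1) a.2) := by
    ext a
    rw [Set.mem_ofPred_eq, hv.edge_at_inner_iff h1 h2, Finset.coe_filter, Set.mem_ofPred_eq,
      Finset.mem_insert, Finset.mem_singleton, and_comm]
    rfl
  rw [hset, Set.ncard_coe_finset, Finset.filter_insert, Finset.filter_singleton]
  by_cases hbefore : Q (ℓ t) (j - 1) <;> by_cases hafter : Q (ℓ t) j <;>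
    simp [before, after, hbefore, hafter, Xor, Finset.card_pair hne, parity_simps]

theorem ncard_edges_at_end (Q : ℕ → ℕ → Prop) (hQ : ∀ t, Q (ℓ t) 0 ↔ Q (ℓ t) (2 * ℓ t + 2))
    {x : V} (hx : x ∈ O) :
    {a | a ∈ edgeSetOf ℓ Q ∧ (edgeFst v a = x ∨ edgeSnd v a = x)}.ncard =
      {t | Q (ℓ t) 0 ∧ x ∈ pathEnds ℓ v t}.ncard := by
  have hat_end (a : PathEdge ℓ) (h : edgeFst v a = x ∨ edgeSnd v a = x) :
      (a.2 : ℕ) = 0 ∧ v a.1 0 = x ∨ (a.2 : ℕ) = 2 * ℓ a.1 + 2 ∧ v a.1 (2 * ℓ a.1 + 3) = x := by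
    obtain ⟨t, i, hi⟩ := a
    rcases h with h | h
    · have hmem : edgeFst v ⟨t, ⟨i, hi⟩⟩ ∈ O := h.symm ▸ hx
      obtain rfl : i = 0 := by have := (hv.mem_iff hi.le).mp hmem; omega
      exact Or.inl ⟨rfl, h⟩
    · have hmem : edgeSnd v ⟨t, ⟨i, hi⟩⟩ ∈ O := h.symm ▸ hx
      obtain rfl : i = 2 * ℓ t + 2 := by have := (hv.mem_iff hi).mp hmem; omega
      exact Or.inr ⟨rfl, h⟩
  rw [← Set.InjOn.ncard_image (f := Sigma.fst)]
  · congr 1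
    ext t
    constructor
    · rintro ⟨a, ⟨haQ, ha⟩, rfl⟩
      rw [edgeSetOf, Set.mem_ofPred_eq] at haQ
      rcases hat_end a ha with ⟨hi, rfl⟩ | ⟨hi, rfl⟩ <;> rw [hi] at haQ
      exacts [⟨haQ, Or.inl rfl⟩, ⟨(hQ _).mpr haQ, Or.inr rfl⟩]
    · rintro ⟨h, rfl | rfl⟩
      · exact ⟨⟨t, 0, by omega⟩, ⟨h, Or.inl rfl⟩, rfl⟩
      · exact ⟨⟨t, 2 * ℓ t + 2, by omega⟩, ⟨(hQ t).mp h, Or.inr rfl⟩, rfl⟩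
  · rintro ⟨t, i⟩ ⟨-, ha⟩ ⟨t', i'⟩ ⟨-, hb⟩ (rfl : t = t')
    have hne := hv.src_ne_tgt t
    obtain rfl : i = i' := Fin.ext <| by
      rcases hat_end _ ha with ⟨hi, h⟩ | ⟨hi, h⟩ <;>
        rcases hat_end _ hb with ⟨hi', h'⟩ | ⟨hi', h'⟩
      exacts [hi.trans hi'.symm, absurd (h.trans h'.symm) hne, absurd (h'.trans h.symm) hne,
        hi.trans hi'.symm]
    rfl

variable {X : Set V → Prop} {Z : Set (PathEdge ℓ) → Prop}
  (hc : ParityClosed (edgeFst v) (edgeSnd v) X Z)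

include hc

omit hv in
theorem edges_true : Z (edgeSetOf ℓ fun _ _ => True) :=
  edgeSetOf_true (ℓ := ℓ) ▸ hc.edges_univ

theorem inner_of_odd {P Q R : ℕ → ℕ → Prop} (hP : X (innerSet ℓ v P)) (hQ : Z (edgeSetOf ℓ Q))
    (hR : ∀ t j, 1 ≤ j → j ≤ 2 * t + 2 → (P t j ∧ Xor (Q t (j - 1)) (Q t j) ↔ R t j)) :
    X (innerSet ℓ v R) := by
  convert hc.vertices_odd hP hQ using 1
  refine (hv.eq_innerSet (fun x hx h => hv.notMem_innerSet hx h.1) fun t j h1 h2 => ?_).symm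
  rw [Set.mem_ofPred_eq, hv.mem_innerSet (by omega), hv.odd_edges_at_inner_iff Q h1 h2,
    ← hR _ j h1 h2]
  tauto

theorem inner_sdiff {P Q R : ℕ → ℕ → Prop} (hP : X (innerSet ℓ v P)) (hQ : X (innerSet ℓ v Q))
    (h : ∀ t j, 1 ≤ j → j ≤ 2 * t + 2 → Q t j → P t j)
    (hR : ∀ t j, 1 ≤ j → j ≤ 2 * t + 2 → (P t j ∧ ¬ Q t j ↔ R t j)) :
    X (innerSet ℓ v R) := by
  convert hc.vertices_sdiff hP hQ ?_ using 1
  · refine (hv.eq_innerSet (fun x hx h => hv.notMem_innerSet hx h.1) fun t j h1 h2 => ?_).symm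
    rw [Set.mem_sdiff, hv.mem_innerSet (by omega), hv.mem_innerSet (by omega), ← hR _ j h1 h2]
    tauto
  · rintro x ⟨t, j, h1, h2, rfl, hx⟩
    exact ⟨t, j, h1, h2, rfl, h _ _ h1 h2 hx⟩

theorem edges_of_xor {P Q R : ℕ → ℕ → Prop} (hP : X (innerSet ℓ v P)) (hQ : Z (edgeSetOf ℓ Q))
    (hR : ∀ t i, i ≤ 2 * t + 2 →
      (Q t i ∧ Xor (1 ≤ i ∧ P t i) (i + 1 ≤ 2 * t + 2 ∧ P t (i + 1)) ↔ R t i)) :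
    Z (edgeSetOf ℓ R) := by
  convert hc.edges_xor hP hQ using 1
  ext ⟨t, i, hi⟩
  simp only [edgeSetOf, Set.mem_ofPred_eq, edgeFst, edgeSnd,
    hv.mem_innerSet (show i ≤ 2 * ℓ t + 3 by omega),
    hv.mem_innerSet (show i + 1 ≤ 2 * ℓ t + 3 by omega), ← hR (ℓ t) i (by omega),
    show i ≤ 2 * ℓ t + 2 by omega, show 1 ≤ i + 1 by omega, true_and]

omit hv in
theorem edges_sdiff {P Q R : ℕ → ℕ → Prop} (hP : Z (edgeSetOf ℓ P)) (hQ : Z (edgeSetOf ℓ Q))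
    (h : ∀ t i, i ≤ 2 * t + 2 → Q t i → P t i)
    (hR : ∀ t i, i ≤ 2 * t + 2 → (P t i ∧ ¬ Q t i ↔ R t i)) :
    Z (edgeSetOf ℓ R) := by
  convert hc.edges_sdiff hP hQ ?_ using 1
  · ext ⟨t, i, hi⟩
    exact (hR (ℓ t) i (by omega)).symm
  · rintro ⟨t, i, hi⟩ ha
    exact h (ℓ t) i (by omega) ha

/-- If the vertices in `O` have odd degree, then summing over all edges at a vertex separates them
from the inner vertices, whose degree is two. -/
theorem ends_and_inner (hodd : ∀ x ∈ O, Odd {t | x ∈ pathEnds ℓ v t}.ncard) :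
    X O ∧ X (innerSet ℓ v fun _ _ => True) := by
  have hO : X O := by
    convert hc.vertices_odd hc.vertices_univ (edges_true hc) using 1
    ext x
    rw [Set.mem_ofPred_eq, and_iff_right (Set.mem_univ x)]
    by_cases hx : x ∈ O
    · rw [hv.ncard_edges_at_end _ (fun _ => Iff.rfl) hx]
      simpa only [true_and, hx, true_iff] using hodd x hx
    · obtain ⟨t, j, h1, h2, rfl⟩ := hv.inner_surj x hx
      rw [hv.odd_edges_at_inner_iff _ h1 h2]
      simpa only [xor_self, iff_false, id] using hx
  refine ⟨hO, ?_⟩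
  rw [hv.innerSet_true, Set.compl_eq_univ_sdiff]
  exact hc.vertices_sdiff hc.vertices_univ hO (Set.subset_univ _)

theorem end_edges (hO : X O) : Z (edgeSetOf ℓ fun t i => min i (2 * t + 2 - i) = 0) := by
  convert hc.edges_xor hO (edges_true hc) using 1
  ext ⟨t, i, hi⟩
  simp only [edgeSetOf, Set.mem_ofPred_eq, edgeFst, edgeSnd, true_and, Xor,
    hv.mem_iff (show i ≤ 2 * ℓ t + 3 by omega), hv.mem_iff (show i + 1 ≤ 2 * ℓ t + 3 by omega)]
  omega

/-- Layer by layer, the inner vertices and the edges are separated by their distance from the ends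
of the paths; the middle edge of a path is never reached, as it joins vertices of one layer. -/
theorem deep_layers (hO : X O) (hI : X (innerSet ℓ v fun _ _ => True)) (k : ℕ) :
    X (innerSet ℓ v fun t j => k + 1 ≤ min j (2 * t + 3 - j)) ∧
      Z (edgeSetOf ℓ fun t i => k + 1 ≤ min i (2 * t + 2 - i) ∨ i = t + 1) := by
  induction k with
  | zero =>
    constructor
    · convert hI using 1
      refine hv.eq_innerSet (fun x hx => hv.notMem_innerSet hx) fun t j h1 h2 => ?_
      rw [hv.mem_innerSet (by omega)]
      exact iff_of_true ⟨h1, h2, by omega⟩ trivial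
    · exact edges_sdiff hc (edges_true hc) (hv.end_edges hc hO) (fun _ _ _ _ => trivial)
        fun t i hi => by rw [true_and]; omega
  | succ k ih =>
    obtain ⟨hX, hZ⟩ := ih
    have hlayer := hv.inner_of_odd hc hX hZ (R := fun t j => min j (2 * t + 3 - j) = k + 1)
      fun t j h1 h2 => by simp only [Xor]; omega
    refine ⟨hv.inner_sdiff hc hX hlayer (fun t j _ _ => by omega) fun t j _ _ => by omega, ?_⟩
    have hedges := hv.edges_of_xor hc hlayer hZ
      (R := fun t i => i ≠ t + 1 ∧ min i (2 * t + 2 - i) = k + 1)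
      fun t i hi => by simp only [Xor]; omega
    exact edges_sdiff hc hZ hedges (fun t i _ => by omega) fun t i hi => by omega

theorem inner_layer (hO : X O) (hI : X (innerSet ℓ v fun _ _ => True)) (k : ℕ) :
    X (innerSet ℓ v fun t j => min j (2 * t + 3 - j) = k + 1) := by
  obtain ⟨hX, hZ⟩ := hv.deep_layers hc hO hI k
  exact hv.inner_of_odd hc hX hZ fun t j h1 h2 => by simp only [Xor]; omega

theorem edge_layer (hO : X O) (hI : X (innerSet ℓ v fun _ _ => True)) (k : ℕ) :
    Z (edgeSetOf ℓ fun t i => i ≠ t + 1 ∧ min i (2 * t + 2 - i) = k) := by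
  cases k with
  | zero =>
    convert hv.end_edges hc hO using 4
    omega
  | succ k =>
    exact hv.edges_of_xor hc (hv.inner_layer hc hO hI k) (hv.deep_layers hc hO hI k).2
      fun t i hi => by simp only [Xor]; omega

/-- The two middle vertices of a path form a layer together with vertices that are not in the middle
of their paths, as the lengths of the paths are different. -/
theorem middle_pair (hO : X O) (hI : X (innerSet ℓ v fun _ _ => True)) (s : ℕ) :
    X (innerSet ℓ v fun t j => t = s ∧ min j (2 * t + 3 - j) = s + 1) := by
  refine hv.inner_of_odd hc (hv.inner_layer hc hO hI s) (hv.deep_layers hc hO hI (s + 1)).2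
    fun t j h1 h2 => ?_
  simp only [Xor]
  omega

/-- Going back from the middle of a path to its ends. -/
theorem inner_pair_and_edge_pair (hO : X O) (hI : X (innerSet ℓ v fun _ _ => True)) {s d : ℕ}
    (hd : d ≤ s) :
    X (innerSet ℓ v fun t j => t = s ∧ min j (2 * t + 3 - j) = d + 1) ∧
      Z (edgeSetOf ℓ fun t i => t = s ∧ min i (2 * t + 2 - i) = d) := by
  have hedge {d : ℕ} (hd : d ≤ s)
      (hX : X (innerSet ℓ v fun t j => t = s ∧ min j (2 * t + 3 - j) = d + 1)) :
      Z (edgeSetOf ℓ fun t i => t = s ∧ min i (2 * t + 2 - i) = d) :=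
    hv.edges_of_xor hc hX (hv.edge_layer hc hO hI d) fun t i hi => by simp only [Xor]; omega
  induction hd using Nat.decreasingInduction with
  | self => exact ⟨hv.middle_pair hc hO hI s, hedge le_rfl (hv.middle_pair hc hO hI s)⟩
  | of_succ d hd ih =>
    have hX : X (innerSet ℓ v fun t j => t = s ∧ min j (2 * t + 3 - j) = d + 1) :=
      hv.inner_of_odd hc (hv.inner_layer hc hO hI d) ih.2 fun t j h1 h2 => by
        simp only [Xor]; omega
    exact ⟨hX, hedge hd.le hX⟩

theorem inter_pathEnds (hO : X O) (hI : X (innerSet ℓ v fun _ _ => True)) {S : Set V} (hS : X S)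
    (hSO : S ⊆ O) (s : τ) : X (S ∩ pathEnds ℓ v s) := by
  convert hc.vertices_odd hS (hv.inner_pair_and_edge_pair hc hO hI (Nat.zero_le (ℓ s))).2 using 1
  ext x
  refine and_congr_right fun hx => ?_
  rw [hv.ncard_edges_at_end _ (fun t => by omega) (hSO hx)]
  have hset : {t | (ℓ t = ℓ s ∧ min 0 (2 * ℓ t + 2 - 0) = 0) ∧ x ∈ pathEnds ℓ v t} =
      {t | t = s ∧ x ∈ pathEnds ℓ v s} := by
    ext t
    simp only [Set.mem_ofPred_eq, hv.length_injective.eq_iff, Nat.zero_min, and_true]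
    exact and_congr_right fun h => by rw [h]
  rw [hset]
  by_cases h : x ∈ pathEnds ℓ v s <;> simp [h]

theorem end_singleton (hO : X O) (hI : X (innerSet ℓ v fun _ _ => True)) {x : V} {t t' : τ}
    (hx : x ∈ pathEnds ℓ v t) (ht' : pathEnds ℓ v t ∩ pathEnds ℓ v t' = {v t 0}) : X {x} := by
  have hsubset := hv.pathEnds_subset t
  have hends : X (pathEnds ℓ v t) := by
    simpa only [Set.inter_eq_right.mpr hsubset] using hv.inter_pathEnds hc hO hI hO le_rfl t
  have hsrc : X {v t 0} := ht' ▸ hv.inter_pathEnds hc hO hI hends hsubset t'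
  rcases hx with rfl | rfl
  · exact hsrc
  · convert hc.vertices_sdiff hends hsrc (Set.singleton_subset_iff.mpr (Or.inl rfl)) using 1
    exact (Set.insert_sdiff_self_of_notMem (a := v t 0) (s := {v t (2 * ℓ t + 3)})
      (hv.src_ne_tgt t)).symm

theorem first_edge (hO : X O) (hI : X (innerSet ℓ v fun _ _ => True)) {s : τ} (hsrc : X {v s 0}) :
    Z (edgeSetOf ℓ fun t i => t = ℓ s ∧ i = 0) := by
  convert hc.edges_xor hsrc (hv.inner_pair_and_edge_pair hc hO hI (Nat.zero_le (ℓ s))).2 using 1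
  ext ⟨t, i, hi⟩
  simp only [edgeSetOf, Set.mem_ofPred_eq, edgeFst, edgeSnd, Set.mem_singleton_iff, and_assoc]
  refine and_congr_right fun hts => ?_
  obtain rfl := hv.length_injective hts
  have heq_src_iff {j : ℕ} (hj : j ≤ 2 * ℓ t + 3) : v t j = v t 0 ↔ j = 0 := by
    refine ⟨fun h => ?_, fun h => h ▸ rfl⟩
    have hmem := (hv.mem_iff hj).mp (h ▸ hv.src_mem t)
    exact hmem.resolve_right fun hj => hv.src_ne_tgt t (hj ▸ h).symm
  rw [heq_src_iff (by omega), heq_src_iff (by omega), Xor]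
  omega

theorem edge_and_inner_along_path (hI : X (innerSet ℓ v fun _ _ => True)) {s k : ℕ}
    (hfirst : Z (edgeSetOf ℓ fun t i => t = s ∧ i = 0)) (hk : k ≤ 2 * s + 2) :
    Z (edgeSetOf ℓ fun t i => t = s ∧ i = k) ∧
      X (innerSet ℓ v fun t j => t = s ∧ j = k + 1) := by
  induction k with
  | zero =>
    refine ⟨hfirst, hv.inner_of_odd hc hI hfirst fun t j h1 _ => ?_⟩
    rw [true_and, Xor]
    omega
  | succ k ih =>
    obtain ⟨hZ, hX⟩ := ih (by omega)
    have hedges := hv.edges_of_xor hc hX (edges_true hc)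
      (R := fun t i => t = s ∧ (i = k ∨ i = k + 1)) fun t i hi => by
        rw [true_and, Xor]; omega
    have hnext : Z (edgeSetOf ℓ fun t i => t = s ∧ i = k + 1) :=
      edges_sdiff hc hedges hZ (fun t i _ => by omega) fun t i _ => by omega
    have hinner := hv.inner_of_odd hc hI hnext
      (R := fun t j => t = s ∧ (j = k + 1 ∨ j = k + 2)) fun t j h1 _ => by
        rw [true_and, Xor]; omega
    exact ⟨hnext,
      hv.inner_sdiff hc hinner hX (fun t j _ _ => by omega) fun t j _ _ => by omega⟩

/-- All vertices and edges can be separated if the graph of which the paths form the subdivision has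
only odd degrees, and every vertex is on an edge that shares exactly its first end with another
one. -/
theorem singletons (hodd : ∀ x ∈ O, Odd {t | x ∈ pathEnds ℓ v t}.ncard)
    (hsep : ∀ x ∈ O, ∃ t t', x ∈ pathEnds ℓ v t ∧ pathEnds ℓ v t ∩ pathEnds ℓ v t' = {v t 0}) :
    (∀ x, X {x}) ∧ ∀ a, Z {a} := by
  obtain ⟨hO, hI⟩ := hv.ends_and_inner hc hodd
  have hend {x : V} (hx : x ∈ O) : X {x} := by
    obtain ⟨t, t', hxt, ht'⟩ := hsep x hx
    exact hv.end_singleton hc hO hI hxt ht'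
  have halong (s : τ) {k : ℕ} (hk : k ≤ 2 * ℓ s + 2) :=
    hv.edge_and_inner_along_path hc hI (hv.first_edge hc hO hI (hend (hv.src_mem s))) hk
  constructor
  · intro x
    by_cases hx : x ∈ O
    · exact hend hx
    obtain ⟨t, j, h1, h2, rfl⟩ := hv.inner_surj x hx
    convert (halong t (k := j - 1) (by omega)).2 using 1
    refine hv.eq_innerSet (fun y hy h => hx (h ▸ hy)) fun t' j' h1' h2' => ?_
    rw [Set.mem_singleton_iff, hv.length_injective.eq_iff, Nat.sub_add_cancel h1]
    constructor
    · exact hv.inner_inj t' t j' j h1' h2' h1 h2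
    · rintro ⟨rfl, rfl⟩
      rfl
  · rintro ⟨t, i, hi⟩
    convert (halong t (k := i) (by omega)).1 using 1
    ext ⟨t', i', hi'⟩
    simp only [Set.mem_singleton_iff, edgeSetOf, Set.mem_ofPred_eq, hv.length_injective.eq_iff]
    constructor
    · intro h
      cases h
      exact ⟨rfl, rfl⟩
    · rintro ⟨rfl, rfl⟩
      rfl

end PathSystem

end Peeling

/-! ### Path systems as subdivisions -/

section Subdivision

/-- The index of an edge in an enumeration of the edges. -/
noncomputable def EnumeratesEdges.index {W ι : Type*} {H : SimpleGraph W} {p q : ι → W}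
    (h : EnumeratesEdges H p q) : H.edgeSet ≃ ι :=
  ((Equiv.ofInjective _ h.injective).trans (Equiv.setCongr h.range_eq)).symm

theorem EnumeratesEdges.mk_index {W ι : Type*} {H : SimpleGraph W} {p q : ι → W}
    (h : EnumeratesEdges H p q) (e : H.edgeSet) : s(p (h.index e), q (h.index e)) = e.1 :=
  congrArg Subtype.val (h.index.symm_apply_apply e)

namespace PathSystem

variable {V τ : Type*} {ℓ : τ → ℕ} {v : τ → ℕ → V} {O : Set V} (hv : PathSystem ℓ v O)

include hv

theorem edge_ne (a : PathEdge ℓ) : edgeFst v a ≠ edgeSnd v a := by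
  obtain ⟨t, i, hi⟩ := a
  simp only [edgeFst, edgeSnd]
  intro h
  rcases Nat.eq_zero_or_pos i with rfl | hpos
  · have := (hv.eq_of_eq_inner (by omega) le_rfl (by omega) h).2
    omega
  · have := (hv.eq_of_eq_inner (by omega) hpos (by omega) h.symm).2
    omega

theorem edge_injective :
    Function.Injective fun a : PathEdge ℓ => s(edgeFst v a, edgeSnd v a) := by
  rintro ⟨t, i, hi⟩ ⟨t', i', hi'⟩ h
  suffices t = t' ∧ i = i' by
    obtain ⟨rfl, rfl⟩ := this
    rfl
  rcases Sym2.eq_iff.mp h with ⟨hfst, hsnd⟩ | ⟨hfst, hsnd⟩ <;>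
    simp only [edgeFst, edgeSnd] at hfst hsnd
  · by_cases hfirst : i' = 0
    · obtain ⟨rfl, heq⟩ := hv.eq_of_eq_inner (by omega) (by omega) (by omega) hsnd
      exact ⟨rfl, by omega⟩
    · exact hv.eq_of_eq_inner (by omega) (by omega) (by omega) hfst
  · by_cases hfirst : i' = 0
    · obtain ⟨rfl, _⟩ := hv.eq_of_eq_inner (by omega) (by omega) (by omega) hfst
      have := (hv.eq_of_eq_inner (by omega) (by omega) (by omega) hsnd.symm).2
      omega
    · obtain ⟨rfl, _⟩ := hv.eq_of_eq_inner (by omega) (by omega) (by omega) hsnd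
      by_cases hlast : i' = 2 * ℓ t + 2
      · have := (hv.eq_of_eq_inner (by omega) (by omega) (by omega) hfst.symm).2
        omega
      · have := (hv.eq_of_eq_inner (by omega) (by omega) (by omega) hfst).2
        omega

theorem isFreeDLA [Fintype V] [DecidableEq V] [Finite τ] {G : SimpleGraph V}
    (hG : EnumeratesEdges G (edgeFst v) (edgeSnd (ℓ := ℓ) v))
    (hodd : ∀ x ∈ O, Odd {t | x ∈ pathEnds ℓ v t}.ncard)
    (hsep : ∀ x ∈ O, ∃ t t', x ∈ pathEnds ℓ v t ∧ pathEnds ℓ v t ∩ pathEnds ℓ v t' = {v t 0}) :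
    IsFreeDLA G :=
  hG.isFreeDLA fun _ _ hc => hv.singletons hc hodd hsep

variable {W : Type*} {H : SimpleGraph W} {p q : τ → W} (hH : EnumeratesEdges H p q)

omit hv in
/-- The vertex of a path system that corresponds to a vertex of a subdivision of `H`, where `f`
maps the vertices of `H` to the ends of the paths. -/
noncomputable def ofSubdivision (ℓ : τ → ℕ) (v : τ → ℕ → V) (f : W → V) :
    W ⊕ (Σ e : H.edgeSet, Fin (2 * ℓ (hH.index e) + 2)) → V :=
  Sum.elim f fun a => v (hH.index a.1) (a.2 + 1)

theorem ofSubdivision_bijective {f : W → V} (hf : Function.Injective f) (hfO : Set.range f = O) :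
    Function.Bijective (ofSubdivision hH ℓ v f) := by
  have hne (w : W) (e : H.edgeSet) (j : Fin (2 * ℓ (hH.index e) + 2)) :
      f w ≠ v (hH.index e) (j + 1) := fun h =>
    hv.inner_notMem _ (j + 1) (by omega) (by omega) (h ▸ hfO ▸ Set.mem_range_self w)
  constructor
  · rintro (w | ⟨e, j⟩) (w' | ⟨e', j'⟩) h
    · exact congrArg Sum.inl (hf h)
    · exact absurd h (hne w e' j')
    · exact absurd h.symm (hne w' e j)
    · obtain ⟨he, hj⟩ := hv.inner_inj _ _ (j + 1) (j' + 1) (by omega) j.isLt (by omega) j'.isLt h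
      obtain rfl := hH.index.injective he
      rw [Fin.ext (Nat.succ_injective hj)]
  · intro x
    by_cases hx : x ∈ O
    · obtain ⟨w, rfl⟩ := hfO ▸ hx
      exact ⟨Sum.inl w, rfl⟩
    · obtain ⟨t, j, h1, h2, rfl⟩ := hv.inner_surj x hx
      obtain ⟨e, rfl⟩ := hH.index.surjective t
      refine ⟨Sum.inr ⟨e, j - 1, by omega⟩, ?_⟩
      simp only [ofSubdivision, Sum.elim_inr, Nat.sub_add_cancel h1]

omit hv in
theorem ofSubdivision_pathVertex {f : W → V} (hp : ∀ t, f (p t) = v t 0)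
    (hq : ∀ t, f (q t) = v t (2 * ℓ t + 3)) (e : H.edgeSet) {j : ℕ}
    (hj : j ≤ 2 * ℓ (hH.index e) + 3) :
    ofSubdivision hH ℓ v f (pathVertex (fun e => p (hH.index e)) (fun e => q (hH.index e))
      (fun e => 2 * ℓ (hH.index e) + 2) e j) = v (hH.index e) j := by
  cases j with
  | zero => exact hp _
  | succ j =>
    by_cases hinner : j < 2 * ℓ (hH.index e) + 2
    · simp only [pathVertex, hinner, dite_true, ofSubdivision, Sum.elim_inr]
    · obtain rfl : j = 2 * ℓ (hH.index e) + 2 := by omega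
      simp only [pathVertex, lt_irrefl, dite_false, ofSubdivision, Sum.elim_inl, hq]

include hH in
theorem isAsymmetricSubdivision {G : SimpleGraph V}
    (hG : EnumeratesEdges G (edgeFst v) (edgeSnd (ℓ := ℓ) v)) {f : W → V}
    (hf : Function.Injective f) (hfO : Set.range f = O)
    (hp : ∀ t, f (p t) = v t 0) (hq : ∀ t, f (q t) = v t (2 * ℓ t + 3)) :
    IsAsymmetricSubdivision H G := by
  have hbij := hv.ofSubdivision_bijective hH hf hfO
  refine ⟨fun e => p (hH.index e), fun e => q (hH.index e), fun e => 2 * ℓ (hH.index e) + 2,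
    hH.mk_index, fun e he => absurd he (Nat.succ_ne_zero _), fun e _ e' _ h => ?_,
    ⟨RelIso.symm ⟨Equiv.ofBijective _ hbij, fun {x y} => ?_⟩⟩⟩
  · exact hH.index.injective (hv.length_injective (by grind))
  · have hpath {e : H.edgeSet} {j : ℕ} := ofSubdivision_pathVertex hH hp hq e (j := j)
    set F := ofSubdivision hH ℓ v f
    have hmap (a b) : s(F a, F b) = s(F x, F y) ↔ s(x, y) = s(a, b) := by
      rw [← Sym2.map_mk F a b, ← Sym2.map_mk F x y, (Sym2.map.injective hbij.1).eq_iff, eq_comm]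
    have hadj : G.Adj (F x) (F y) ↔ ∃ e, ∃ i ≤ 2 * ℓ (hH.index e) + 2,
        s(v (hH.index e) i, v (hH.index e) (i + 1)) = s(F x, F y) := by
      rw [hG.adj_iff]
      constructor
      · rintro ⟨⟨t, i⟩, h⟩
        obtain ⟨e, rfl⟩ := hH.index.surjective t
        exact ⟨e, i, by omega, h⟩
      · rintro ⟨e, i, hi, h⟩
        exact ⟨⟨hH.index e, i, by omega⟩, h⟩
    change G.Adj (F x) (F y) ↔ _
    rw [subdivide, SimpleGraph.fromEdgeSet_adj,
      ← and_iff_left_of_imp (b := x ≠ y) fun h : G.Adj (F x) (F y) => ne_of_apply_ne F h.ne]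
    refine and_congr_left' (hadj.trans ?_)
    refine exists_congr fun e => exists_congr fun i => and_congr_right fun hi => ?_
    rw [← hmap, hpath (hi.trans (Nat.le_succ _)), hpath (Nat.succ_le_succ hi)]

end PathSystem

end Subdivision

/-! ### Cuts of path systems -/

section Cuts

/-- The number of colour changes among the first `k` steps of a sequence of colours. -/
def changes (c : ℕ → Bool) (k : ℕ) : ℕ :=
  ∑ i ∈ Finset.range k, if c i = c (i + 1) then 0 else 1

theorem changes_le (c : ℕ → Bool) (k : ℕ) : changes c k ≤ k := by
  calc changes c k ≤ ∑ _i ∈ Finset.range k, 1 :=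
        Finset.sum_le_sum fun i _ => by split_ifs <;> simp
    _ = k := by simp

theorem changes_mod_two (c : ℕ → Bool) (k : ℕ) :
    changes c k % 2 = if c 0 = c k then 0 else 1 := by
  induction k with
  | zero => simp [changes]
  | succ k ih =>
    rw [changes, Finset.sum_range_succ, ← changes, Nat.add_mod, ih]
    cases c 0 <;> cases c k <;> cases c (k + 1) <;> rfl

theorem changes_two_mul_add_one_le (c : ℕ → Bool) (a : ℕ) :
    changes c (2 * a + 1) ≤ 2 * a + if c 0 = c (2 * a + 1) then 0 else 1 := by
  have hle := changes_le c (2 * a + 1)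
  have hmod := changes_mod_two c (2 * a + 1)
  split_ifs at hmod ⊢ <;> omega

theorem changes_of_alternating {c : ℕ → Bool} {k : ℕ} (h : ∀ i < k, c (i + 1) = !c i) :
    changes c k = k := by
  rw [changes, Finset.sum_congr rfl fun i hi => if_neg ?_]
  · simp
  · simp [h i (Finset.mem_range.mp hi)]

theorem changes_two_mul_add_one_of_alternating {c : ℕ → Bool} {a : ℕ}
    (h : ∀ i < 2 * a, c (i + 1) = !c i) :
    changes c (2 * a + 1) = 2 * a + if c 0 = c (2 * a + 1) then 0 else 1 := by
  have heven := changes_of_alternating h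
  have hend : c 0 = c (2 * a) := by
    by_contra hne
    have hmod := changes_mod_two c (2 * a)
    rw [if_neg hne] at hmod
    omega
  rw [changes, Finset.sum_range_succ, ← changes, heven, hend]

section PathCuts

variable {V τ : Type*} [Fintype V] [Fintype τ] {ℓ : τ → ℕ} {v : τ → ℕ → V} {G : SimpleGraph V}
  (hG : EnumeratesEdges G (edgeFst v) (edgeSnd (ℓ := ℓ) v))

include hG

theorem cutSize_paths (C : V → Bool) :
    cutSize G C = ∑ t, changes (fun j => C (v t j)) (2 * ℓ t + 3) := by
  rw [hG.cutSize_eq, Fintype.sum_sigma]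
  refine Finset.sum_congr rfl fun t _ => ?_
  rw [changes, Finset.sum_range]
  rfl

theorem cutSize_paths_le (C : V → Bool) : cutSize G C ≤
    ∑ t, (2 * ℓ t + 2 + if C (v t 0) = C (v t (2 * ℓ t + 3)) then 0 else 1) := by
  rw [cutSize_paths hG]
  exact Finset.sum_le_sum fun t _ =>
    changes_two_mul_add_one_le (fun j => C (v t j)) (ℓ t + 1)

theorem cutSize_paths_of_alternating {C : V → Bool}
    (hC : ∀ t, ∀ i < 2 * ℓ t + 2, C (v t (i + 1)) = !C (v t i)) :
    cutSize G C = ∑ t, (2 * ℓ t + 2 + if C (v t 0) = C (v t (2 * ℓ t + 3)) then 0 else 1) := by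
  rw [cutSize_paths hG]
  exact Finset.sum_congr rfl fun t _ =>
    changes_two_mul_add_one_of_alternating (a := ℓ t + 1) (hC t)

end PathCuts

section MaxCut

variable {V : Type*} [Fintype V]

theorem cutSize_le_maxCut (G : SimpleGraph V) (C : V → Bool) : cutSize G C ≤ maxCut G := by
  classical
  exact Finset.le_sup (f := fun C => cutSize G C) (Finset.mem_univ C)

theorem exists_isOptimalCut (G : SimpleGraph V) : ∃ C, IsOptimalCut G C := by
  classical
  obtain ⟨C, -, hC⟩ := Finset.exists_mem_eq_sup (Finset.univ : Finset (V → Bool))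
    Finset.univ_nonempty fun C => cutSize G C
  exact ⟨C, hC.symm⟩

variable {V' : Type*} [Fintype V'] {G : SimpleGraph V} {G' : SimpleGraph V'} {d : ℕ}
  {r : (V' → Bool) → V → Bool} (hle : ∀ C', cutSize G' C' ≤ cutSize G (r C') + d)

include hle

theorem maxCut_eq_add (hext : ∀ C, ∃ C', cutSize G' C' = cutSize G C + d) :
    maxCut G' = maxCut G + d := by
  obtain ⟨C, hC⟩ := exists_isOptimalCut G
  obtain ⟨C', hC'⟩ := exists_isOptimalCut G'
  obtain ⟨D, hD⟩ := hext C
  have hrestrict := hle C'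
  have hmax := cutSize_le_maxCut G (r C')
  have hmax' := cutSize_le_maxCut G' D
  rw [IsOptimalCut] at hC hC'
  omega

theorem IsOptimalCut.restrict (hmax : maxCut G' = maxCut G + d) {C' : V' → Bool}
    (hC' : IsOptimalCut G' C') : IsOptimalCut G (r C') := by
  have hrestrict := hle C'
  have hle_max := cutSize_le_maxCut G (r C')
  rw [IsOptimalCut] at hC' ⊢
  omega

end MaxCut

end Cuts

/-! ### Listed edges -/

section Listing

/-- The position `j` on the path that replaces the edge number `t` from `src t` to `tgt t`; the
`2 * t + 2` inner vertices of this path are numbered from `h + t * (t + 1)` on. -/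
def pathPos (h : ℕ) (src tgt : ℕ → ℕ) (t : ℕ) : ℕ → ℕ
  | 0 => src t
  | j + 1 => if j < 2 * t + 2 then h + t * (t + 1) + j else tgt t

theorem pathPos_add_one (h : ℕ) (src tgt : ℕ → ℕ) {t j : ℕ} (h1 : 1 ≤ j) (h2 : j ≤ 2 * t + 2) :
    pathPos h src tgt t j + 1 = h + t * (t + 1) + j := by
  obtain ⟨j, rfl⟩ := Nat.exists_eq_add_of_le' h1
  rw [pathPos, if_pos (by omega), add_assoc]

theorem pathPos_last (h : ℕ) (src tgt : ℕ → ℕ) (t : ℕ) :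
    pathPos h src tgt t (2 * t + 3) = tgt t := by
  simp [pathPos]

theorem mul_succ_add_le_of_lt {t t' : ℕ} (h : t < t') :
    t * (t + 1) + (2 * t + 2) ≤ t' * (t' + 1) := by
  calc t * (t + 1) + (2 * t + 2) = (t + 1) * (t + 1 + 1) := by ring
    _ ≤ t' * (t' + 1) := by gcongr <;> omega

theorem exists_eq_mul_succ_add {K y : ℕ} (h : y < K * (K + 1)) :
    ∃ t < K, ∃ j < 2 * t + 2, y = t * (t + 1) + j := by
  induction K with
  | zero => omega
  | succ K ih =>
    by_cases hy : y < K * (K + 1)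
    · obtain ⟨t, ht, h⟩ := ih hy
      exact ⟨t, by omega, h⟩
    · have : (K + 1) * (K + 1 + 1) = K * (K + 1) + (2 * K + 2) := by ring
      exact ⟨K, by omega, y - K * (K + 1), by omega, by omega⟩

theorem mul_succ_add_inj {t t' i i' : ℕ} (hi : i < 2 * t + 2) (hi' : i' < 2 * t' + 2)
    (h : t * (t + 1) + i = t' * (t' + 1) + i') : t = t' ∧ i = i' := by
  rcases lt_trichotomy t t' with hlt | rfl | hlt
  · have := mul_succ_add_le_of_lt hlt
    omega
  · exact ⟨rfl, by omega⟩
  · have := mul_succ_add_le_of_lt hlt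
    omega

theorem sum_two_mul_add_two (K : ℕ) : ∑ t : Fin K, (2 * (t : ℕ) + 2) = K * (K + 1) := by
  rw [Fin.sum_univ_eq_sum_range fun t => 2 * t + 2]
  induction K with
  | zero => rfl
  | succ K ih => rw [Finset.sum_range_succ, ih]; ring

/-- The pairs `src t, tgt t` for `t < K` are the edges, each listed once, of a graph on
`{0, …, h - 1}`. -/
structure IsEdgeListing (h K : ℕ) (src tgt : ℕ → ℕ) : Prop where
  src_lt : ∀ t < K, src t < h
  tgt_lt : ∀ t < K, tgt t < h
  ne : ∀ t < K, src t ≠ tgt t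
  inj : ∀ t < K, ∀ t' < K, s(src t, tgt t) = s(src t', tgt t') → t = t'

namespace IsEdgeListing

variable {h K : ℕ} {src tgt : ℕ → ℕ} (hE : IsEdgeListing h K src tgt)

include hE

/-- The graph with the listed edges. -/
def graph : SimpleGraph (Fin h) :=
  SimpleGraph.fromEdgeSet (Set.range fun t : Fin K =>
    s((⟨src t, hE.src_lt t t.2⟩ : Fin h), ⟨tgt t, hE.tgt_lt t t.2⟩))

theorem enumeratesEdges_graph : EnumeratesEdges hE.graph
    (fun t : Fin K => (⟨src t, hE.src_lt t t.2⟩ : Fin h)) fun t => ⟨tgt t, hE.tgt_lt t t.2⟩ :=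
  enumeratesEdges_fromEdgeSet (fun t ht => hE.ne t t.2 (Fin.mk.inj ht)) fun t t' htt' =>
    Fin.ext (hE.inj t t.2 t' t'.2 (congrArg (Sym2.map Fin.val) htt'))

theorem graph_adj {x y : Fin h} : hE.graph.Adj x y ↔
    ∃ t < K, x.1 = src t ∧ y.1 = tgt t ∨ x.1 = tgt t ∧ y.1 = src t := by
  rw [hE.enumeratesEdges_graph.adj_iff]
  simp only [Sym2.eq_iff, Fin.ext_iff, Fin.exists_iff, exists_prop]
  grind

theorem cutSize_graph (c : ℕ → Bool) : cutSize hE.graph (fun x => c x) =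
    ∑ t ∈ Finset.range K, if c (src t) = c (tgt t) then 0 else 1 := by
  rw [hE.enumeratesEdges_graph.cutSize_eq, Finset.sum_range]

theorem ncard_edgeSet_graph : hE.graph.edgeSet.ncard = K := by
  rw [hE.enumeratesEdges_graph.ncard_edgeSet, Fintype.card_fin]

theorem ncard_neighborSet_graph (x : Fin h) :
    (hE.graph.neighborSet x).ncard = {t : Fin K | src t = x ∨ tgt t = x}.ncard := by
  simp only [hE.enumeratesEdges_graph.ncard_neighborSet, Fin.ext_iff]

theorem pathPos_lt {t : ℕ} (ht : t < K) (j : ℕ) : pathPos h src tgt t j < h + K * (K + 1) := by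
  cases j with
  | zero => exact (hE.src_lt t ht).trans_le (Nat.le_add_right _ _)
  | succ j =>
    rw [pathPos]
    split_ifs with hj
    · have := mul_succ_add_le_of_lt ht
      omega
    · exact (hE.tgt_lt t ht).trans_le (Nat.le_add_right _ _)

/-- The vertex at position `j` of the path that replaces the edge number `t`. -/
def vert (t : Fin K) (j : ℕ) : Fin (h + K * (K + 1)) :=
  ⟨pathPos h src tgt t j, hE.pathPos_lt t.2 j⟩

theorem vert_last (t : Fin K) : hE.vert t (2 * t + 3) =
    Fin.castLE (Nat.le_add_right _ _) ⟨tgt t, hE.tgt_lt t t.2⟩ :=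
  Fin.ext (pathPos_last h src tgt t)

theorem pathSystem : PathSystem Fin.val hE.vert {x | x.1 < h} where
  length_injective := Fin.val_injective
  src_mem t := hE.src_lt t t.2
  tgt_mem t := by
    rw [vert_last]
    exact hE.tgt_lt t t.2
  src_ne_tgt t := by
    rw [vert_last]
    exact fun heq => hE.ne t t.2 (congrArg Fin.val heq)
  inner_notMem t j h1 h2 := by
    have := pathPos_add_one h src tgt h1 h2
    simp only [Set.mem_ofPred_eq, vert]
    omega
  inner_inj t t' j j' h1 h2 h1' h2' heq := by
    have hpos := pathPos_add_one h src tgt h1 h2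
    have hpos' := pathPos_add_one h src tgt h1' h2'
    simp only [vert, Fin.mk.injEq] at heq
    have := mul_succ_add_inj (t := t) (t' := t') (i := j - 1) (i' := j' - 1) (by omega) (by omega)
      (by omega)
    exact ⟨Fin.ext this.1, by omega⟩
  inner_surj x hx := by
    simp only [Set.mem_ofPred_eq, not_lt] at hx
    obtain ⟨t, ht, j, hj, hy⟩ := exists_eq_mul_succ_add (K := K) (y := x - h)
      (by have := x.2; omega)
    refine ⟨⟨t, ht⟩, j + 1, by omega, Nat.succ_le_of_lt hj, Fin.ext ?_⟩
    have := pathPos_add_one h src tgt (t := t) (j := j + 1) (by omega) (by omega)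
    simp only [vert]
    omega

/-- The subdivision in which the edge number `t` receives `2 * t + 2` new vertices. -/
def subdivision : SimpleGraph (Fin (h + K * (K + 1))) :=
  SimpleGraph.fromEdgeSet
    (Set.range fun a : PathEdge Fin.val => s(edgeFst hE.vert a, edgeSnd hE.vert a))

theorem enumeratesEdges_subdivision :
    EnumeratesEdges hE.subdivision (edgeFst hE.vert) (edgeSnd (ℓ := Fin.val) hE.vert) :=
  enumeratesEdges_fromEdgeSet hE.pathSystem.edge_ne hE.pathSystem.edge_injective

theorem isAsymmetricSubdivision : IsAsymmetricSubdivision hE.graph hE.subdivision := by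
  refine hE.pathSystem.isAsymmetricSubdivision hE.enumeratesEdges_graph
    hE.enumeratesEdges_subdivision (Fin.castLE_injective (Nat.le_add_right h (K * (K + 1)))) ?_
    (fun _ => rfl) fun t => (hE.vert_last t).symm
  ext x
  constructor
  · rintro ⟨y, rfl⟩
    exact y.2
  · exact fun hx => ⟨⟨x, hx⟩, rfl⟩

theorem mem_pathEnds_vert {x : Fin (h + K * (K + 1))} {t : Fin K} :
    x ∈ pathEnds Fin.val hE.vert t ↔ src t = x ∨ tgt t = x := by
  rw [pathEnds, vert_last, Set.mem_insert_iff, Set.mem_singleton_iff]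
  exact or_congr (Fin.ext_iff.trans eq_comm) (Fin.ext_iff.trans eq_comm)

theorem isFreeDLA (hodd : ∀ x, Odd (hE.graph.neighborSet x).ncard)
    (hsep : ∀ x < h, ∃ t < K, ∃ t' < K,
      (src t = x ∨ tgt t = x) ∧ src t = src t' ∧ tgt t ≠ tgt t') :
    IsFreeDLA hE.subdivision := by
  refine hE.pathSystem.isFreeDLA hE.enumeratesEdges_subdivision (fun x hx => ?_) fun x hx => ?_
  · simpa only [mem_pathEnds_vert, ncard_neighborSet_graph] using hodd ⟨x, hx⟩
  · obtain ⟨t, ht, t', ht', hmem, hsrc, htgt⟩ := hsep x hx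
    refine ⟨⟨t, ht⟩, ⟨t', ht'⟩, hE.mem_pathEnds_vert.mpr hmem, ?_⟩
    ext y
    rw [Set.mem_inter_iff, mem_pathEnds_vert, mem_pathEnds_vert, Set.mem_singleton_iff, Fin.ext_iff]
    change _ ↔ y.1 = src t
    have := hE.ne t ht
    grind

theorem ncard_edgeSet_subdivision : hE.subdivision.edgeSet.ncard = K * (K + 1) + K := by
  rw [hE.enumeratesEdges_subdivision.ncard_edgeSet, Fintype.card_sigma, ← sum_two_mul_add_two]
  simp only [Fintype.card_fin, Finset.sum_add_distrib, Finset.sum_const, Finset.card_univ,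
    smul_eq_mul]
  ring

theorem sum_path_cut (c : ℕ → Bool) :
    ∑ t : Fin K, (2 * (t : ℕ) + 2 +
      if c (hE.vert t 0) = c (hE.vert t (2 * t + 3)) then 0 else 1) =
    cutSize hE.graph (fun x => c x) + K * (K + 1) := by
  rw [Finset.sum_add_distrib, sum_two_mul_add_two, add_comm, hE.enumeratesEdges_graph.cutSize_eq]
  simp only [vert_last]
  rfl

theorem cutSize_subdivision_le (c : ℕ → Bool) :
    cutSize hE.subdivision (fun x => c x) ≤ cutSize hE.graph (fun x => c x) + K * (K + 1) :=
  (cutSize_paths_le hE.enumeratesEdges_subdivision _).trans_eq (hE.sum_path_cut c)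

theorem cutSize_subdivision_of_alternating {c : ℕ → Bool}
    (hc : ∀ t < K, ∀ i < 2 * t + 2,
      c (pathPos h src tgt t (i + 1)) = !c (pathPos h src tgt t i)) :
    cutSize hE.subdivision (fun x => c x) = cutSize hE.graph (fun x => c x) + K * (K + 1) :=
  (cutSize_paths_of_alternating hE.enumeratesEdges_subdivision fun t => hc t t.2).trans
    (hE.sum_path_cut c)

end IsEdgeListing

end Listing

section PairLists

/-- The first component of the entry number `t` of a list of pairs, `0` beyond the end. -/
def listSrc (l : List (ℕ × ℕ)) (t : ℕ) : ℕ := (l.getD t (0, 0)).1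

/-- The second component of the entry number `t` of a list of pairs, `0` beyond the end. -/
def listTgt (l : List (ℕ × ℕ)) (t : ℕ) : ℕ := (l.getD t (0, 0)).2

/-- All components of the pairs in a list. -/
def ends (l : List (ℕ × ℕ)) : List ℕ := l.flatMap fun p => [p.1, p.2]

variable {l : List (ℕ × ℕ)}

theorem listSrc_of_lt {t : ℕ} (ht : t < l.length) : listSrc l t = l[t].1 := by
  rw [listSrc, List.getD_eq_getElem _ _ ht]

theorem listTgt_of_lt {t : ℕ} (ht : t < l.length) : listTgt l t = l[t].2 := by
  rw [listTgt, List.getD_eq_getElem _ _ ht]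

theorem mem_iff_exists_listSrc {a b : ℕ} :
    (a, b) ∈ l ↔ ∃ t < l.length, listSrc l t = a ∧ listTgt l t = b := by
  rw [List.mem_iff_getElem]
  refine exists_congr fun t => ⟨fun ⟨ht, h⟩ => ⟨ht, ?_⟩, fun ⟨ht, h⟩ => ⟨ht, ?_⟩⟩
  · rw [listSrc_of_lt ht, listTgt_of_lt ht, h]
    exact ⟨rfl, rfl⟩
  · rw [listSrc_of_lt ht, listTgt_of_lt ht] at h
    exact Prod.ext h.1 h.2

theorem sum_map_eq_sum_listSrc (f : ℕ → ℕ → ℕ) :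
    (l.map fun p => f p.1 p.2).sum =
      ∑ t ∈ Finset.range l.length, f (listSrc l t) (listTgt l t) := by
  rw [← Fin.sum_univ_fun_getElem, Finset.sum_range]
  refine Finset.sum_congr rfl fun t _ => ?_
  rw [listSrc_of_lt t.2, listTgt_of_lt t.2]

theorem count_ends (x : ℕ) :
    (ends l).count x = (l.map Prod.fst).count x + (l.map Prod.snd).count x := by
  induction l with
  | nil => rfl
  | cons p l ih =>
    rw [ends, List.flatMap_cons, ← ends, List.count_append, ih]
    simp only [List.map_cons, List.count_cons, List.count_nil]
    ring

theorem length_ends : (ends l).length = 2 * l.length := by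
  simp [ends, List.length_flatMap, mul_comm]

theorem ncard_setOf_listSrc_or_listTgt (hl : ∀ p ∈ l, p.1 ≠ p.2) (x : ℕ) :
    {t : Fin l.length | listSrc l t = x ∨ listTgt l t = x}.ncard = (ends l).count x := by
  classical
  rw [ends, List.count_flatMap, ← Fin.sum_univ_fun_getElem, Set.ncard_eq_toFinset_card',
    Finset.card_eq_sum_ones, Set.toFinset_ofPred, Finset.sum_filter]
  refine Finset.sum_congr rfl fun t _ => ?_
  have hne := hl _ (List.getElem_mem t.2)
  simp only [listSrc_of_lt t.2, listTgt_of_lt t.2, Function.comp_apply, List.count_cons,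
    List.count_nil, beq_iff_eq]
  grind

variable {h : ℕ} (hl : ∀ p ∈ l, p.1 < p.2 ∧ p.2 < h) (hnodup : l.Nodup)

include hl hnodup

theorem isEdgeListing_list : IsEdgeListing h l.length (listSrc l) (listTgt l) := by
  have hlt : ∀ t < l.length, listSrc l t < listTgt l t ∧ listTgt l t < h := fun t ht =>
    hl _ (mem_iff_exists_listSrc.mpr ⟨t, ht, rfl, rfl⟩)
  refine ⟨fun t ht => (hlt t ht).1.trans (hlt t ht).2, fun t ht => (hlt t ht).2,
    fun t ht => (hlt t ht).1.ne, fun t ht t' ht' heq => ?_⟩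
  have h1 := hlt t ht
  have h2 := hlt t' ht'
  rw [← hnodup.getElem_inj_iff (hi := ht) (hj := ht'), Prod.ext_iff, ← listSrc_of_lt,
    ← listTgt_of_lt, ← listSrc_of_lt, ← listTgt_of_lt]
  rcases Sym2.eq_iff.mp heq with heq | heq
  · exact heq
  · omega

theorem graph_list_adj {x y : Fin h} :
    (isEdgeListing_list hl hnodup).graph.Adj x y ↔ (x.1, y.1) ∈ l ∨ (y.1, x.1) ∈ l := by
  rw [IsEdgeListing.graph_adj, mem_iff_exists_listSrc, mem_iff_exists_listSrc, ← exists_or]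
  grind

theorem cutSize_graph_list (c : ℕ → Bool) :
    cutSize (isEdgeListing_list hl hnodup).graph (fun x => c x) =
      (l.map fun p => if c p.1 = c p.2 then 0 else 1).sum := by
  rw [IsEdgeListing.cutSize_graph, sum_map_eq_sum_listSrc fun a b => if c a = c b then 0 else 1]

theorem ncard_neighborSet_graph_list (x : Fin h) :
    ((isEdgeListing_list hl hnodup).graph.neighborSet x).ncard = (ends l).count x.1 := by
  rw [IsEdgeListing.ncard_neighborSet_graph,
    ncard_setOf_listSrc_or_listTgt fun p hp => (hl p hp).1.ne]

end PairLists

/-! ### The odd graph and its subdivision -/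

section OddGraph

variable {n : ℕ} (G : SimpleGraph (Fin n))

open Classical in
/-- Adjacency of the vertices numbered `i` and `j`, `false` unless both are less than `n`. -/
noncomputable def adjNat (i j : ℕ) : Bool :=
  decide (∃ (hi : i < n) (hj : j < n), G.Adj ⟨i, hi⟩ ⟨j, hj⟩)

/-- The edges from `i` to larger vertices below `k`. -/
noncomputable def edgeRow (i k : ℕ) : List (ℕ × ℕ) :=
  ((List.range k).filter fun j => decide (i < j) && adjNat G i j).map (Prod.mk i)

/-- The edges `(i, j)` of `G`, where `i < j`, in lexicographic order. -/
noncomputable def edgeList : List (ℕ × ℕ) :=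
  (List.range n).flatMap fun i => edgeRow G i n

/-- The neighbours of the leaves attached to `G`: one leaf for every end of an edge, and three
leaves for every vertex. A vertex of degree `a` thus gets the odd degree `2 * a + 3`. -/
noncomputable def leaves : List ℕ :=
  ends (edgeList G) ++ (List.range n).flatMap fun i => [i, i, i]

/-- The edges of the odd graph: those of `G`, followed by those to the leaves, which are numbered
from `n` on. -/
noncomputable def oddList : List (ℕ × ℕ) := edgeList G ++ (leaves G).zipIdx n

variable {G}

theorem adjNat_iff {i j : ℕ} :
    adjNat G i j = true ↔ ∃ (hi : i < n) (hj : j < n), G.Adj ⟨i, hi⟩ ⟨j, hj⟩ := by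
  classical
  rw [adjNat, decide_eq_true_iff]

theorem mem_edgeList {p : ℕ × ℕ} : p ∈ edgeList G ↔ p.1 < p.2 ∧ adjNat G p.1 p.2 = true := by
  obtain ⟨i, j⟩ := p
  simp only [edgeList, edgeRow, List.mem_flatMap, List.mem_range, List.mem_map, List.mem_filter,
    Bool.and_eq_true, decide_eq_true_eq, Prod.mk.injEq]
  constructor
  · rintro ⟨_, _, _, h, rfl, rfl⟩
    exact h.2
  · intro h
    obtain ⟨hi, hj, -⟩ := adjNat_iff.mp h.2
    exact ⟨i, hi, j, ⟨hj, h⟩, rfl, rfl⟩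

theorem lt_of_mem_edgeList {p : ℕ × ℕ} (hp : p ∈ edgeList G) : p.1 < p.2 ∧ p.2 < n := by
  obtain ⟨hlt, hadj⟩ := mem_edgeList.mp hp
  exact ⟨hlt, (adjNat_iff.mp hadj).2.1⟩

variable (G)

theorem nodup_edgeList : (edgeList G).Nodup := by
  rw [edgeList, List.nodup_flatMap]
  refine ⟨fun i _ => (List.nodup_range.filter _).map (Prod.mk_right_injective i), ?_⟩
  refine List.nodup_range.imp fun {i j} hij => ?_
  simp only [Function.onFun, List.disjoint_left, edgeRow, List.mem_map]
  rintro _ ⟨a, -, rfl⟩ ⟨b, -, h⟩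
  exact hij (congrArg Prod.fst h).symm

theorem isEdgeListing_edgeList : IsEdgeListing n (edgeList G).length
    (listSrc (edgeList G)) (listTgt (edgeList G)) :=
  isEdgeListing_list (fun _ => lt_of_mem_edgeList) (nodup_edgeList G)

theorem graph_edgeList : (isEdgeListing_edgeList G).graph = G := by
  ext x y
  rw [graph_list_adj (fun _ => lt_of_mem_edgeList) (nodup_edgeList G), mem_edgeList, mem_edgeList]
  simp only [adjNat_iff, x.2, y.2, exists_true_left, Fin.eta, SimpleGraph.adj_comm G y x]
  exact ⟨fun h => h.elim And.right And.right, fun h =>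
    (lt_or_gt_of_ne (Fin.val_ne_of_ne h.ne)).imp (⟨·, h⟩) (⟨·, h⟩)⟩

theorem length_edgeList : (edgeList G).length = G.edgeSet.ncard := by
  conv_rhs => rw [← graph_edgeList G, IsEdgeListing.ncard_edgeSet_graph]

theorem cutSize_eq_sum_edgeList (c : ℕ → Bool) : cutSize G (fun x => c x) =
    ((edgeList G).map fun p => if c p.1 = c p.2 then 0 else 1).sum := by
  rw [← cutSize_graph_list (fun _ => lt_of_mem_edgeList) (nodup_edgeList G), graph_edgeList]

theorem length_leaves : (leaves G).length = 2 * (edgeList G).length + 3 * n := by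
  simp [leaves, length_ends, List.length_flatMap, mul_comm]

theorem length_oddList_eq_add :
    (oddList G).length = (edgeList G).length + (leaves G).length := by
  simp [oddList]

theorem length_oddList : (oddList G).length = 3 * (edgeList G).length + 3 * n := by
  rw [length_oddList_eq_add, length_leaves]
  ring

variable {G}

theorem lt_of_mem_leaves {a : ℕ} (ha : a ∈ leaves G) : a < n := by
  simp only [leaves, ends, List.mem_append, List.mem_flatMap, List.mem_range, List.mem_cons,
    List.not_mem_nil, or_false] at ha
  rcases ha with ⟨e, he, ha⟩ | ⟨i, hi, ha⟩
  · have := lt_of_mem_edgeList he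
    omega
  · omega

theorem lt_of_mem_zipIdx_leaves {p : ℕ × ℕ} (hp : p ∈ (leaves G).zipIdx n) :
    p.1 < n ∧ n ≤ p.2 ∧ p.2 < n + (leaves G).length :=
  ⟨lt_of_mem_leaves (List.fst_mem_of_mem_zipIdx hp), List.le_snd_of_mem_zipIdx hp,
    List.snd_lt_add_of_mem_zipIdx hp⟩

theorem lt_of_mem_oddList {p : ℕ × ℕ} (hp : p ∈ oddList G) :
    p.1 < p.2 ∧ p.2 < n + (leaves G).length := by
  rcases List.mem_append.mp hp with hp | hp
  · have := lt_of_mem_edgeList hp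
    omega
  · have := lt_of_mem_zipIdx_leaves hp
    omega

variable (G)

theorem nodup_oddList : (oddList G).Nodup := by
  refine (nodup_edgeList G).append (.of_map Prod.snd ?_) fun p hp hp' => ?_
  · rw [List.zipIdx_map_snd]
    exact List.nodup_range'
  · have := lt_of_mem_edgeList hp
    have := lt_of_mem_zipIdx_leaves hp'
    omega

theorem isEdgeListing_oddList : IsEdgeListing (n + (leaves G).length) (oddList G).length
    (listSrc (oddList G)) (listTgt (oddList G)) :=
  isEdgeListing_list (fun _ => lt_of_mem_oddList) (nodup_oddList G)

variable {G}

theorem listSrc_oddList_leaf {s : ℕ} (hs : s < (leaves G).length) :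
    listSrc (oddList G) ((edgeList G).length + s) = (leaves G)[s] := by
  simp [listSrc, oddList, List.getD_eq_getElem?_getD, hs]

theorem listTgt_oddList_leaf {s : ℕ} (hs : s < (leaves G).length) :
    listTgt (oddList G) ((edgeList G).length + s) = n + s := by
  simp [listTgt, oddList, List.getD_eq_getElem?_getD, hs]

theorem listSrc_oddList_leaf_lt {s : ℕ} (hs : s < (leaves G).length) :
    listSrc (oddList G) ((edgeList G).length + s) < n := by
  rw [listSrc_oddList_leaf hs]
  exact lt_of_mem_leaves (List.getElem_mem hs)

theorem count_leaves {x : ℕ} (hx : x < n) :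
    (leaves G).count x = (ends (edgeList G)).count x + 3 := by
  rw [leaves, List.count_append, List.count_flatMap,
    List.sum_map_eq_nsmul_single x _ fun i hi _ => by simp [hi],
    List.count_eq_one_of_mem List.nodup_range (List.mem_range.mpr hx)]
  simp

theorem odd_count_ends_oddList {x : ℕ} (hx : x < n + (leaves G).length) :
    Odd ((ends (oddList G)).count x) := by
  rw [count_ends, oddList, List.map_append, List.map_append, List.count_append, List.count_append,
    List.zipIdx_map_fst, List.zipIdx_map_snd, add_add_add_comm, ← count_ends]
  by_cases hxn : x < n
  · rw [count_leaves hxn, List.count_eq_zero_of_not_mem (l := List.range' _ _)]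
    · exact ⟨(ends (edgeList G)).count x + 1, by ring⟩
    · rw [List.mem_range'_1]
      omega
  · rw [List.count_eq_one_of_mem List.nodup_range' (List.mem_range'_1.mpr (by omega)),
      List.count_eq_zero_of_not_mem, List.count_eq_zero_of_not_mem]
    · exact odd_one
    · exact fun hx => hxn (lt_of_mem_leaves hx)
    · simp only [ends, List.mem_flatMap, List.mem_cons, List.not_mem_nil, or_false, not_exists]
      rintro p ⟨hp, hxp⟩
      have := lt_of_mem_edgeList hp
      omega

theorem exists_ne_leaf {s : ℕ} (hs : s < (leaves G).length) :
    ∃ s', ∃ hs' : s' < (leaves G).length, s' ≠ s ∧ (leaves G)[s'] = (leaves G)[s] := by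
  have hcount : 2 ≤ (leaves G).count (leaves G)[s] := by
    rw [count_leaves (lt_of_mem_leaves (List.getElem_mem hs))]
    omega
  obtain ⟨i, j, hij, hi, hj⟩ :=
    List.duplicate_iff_exists_distinct_get.mp (List.duplicate_iff_two_le_count.mpr hcount)
  by_cases his : i.1 = s
  · exact ⟨j, j.2, fun hjs => hij.ne (Fin.ext (his.trans hjs.symm)), hj.symm⟩
  · exact ⟨i, i.2, his, hi.symm⟩

theorem exists_leaf_edge {x : ℕ} (hx : x < n + (leaves G).length) :
    ∃ s, ∃ hs : s < (leaves G).length, (leaves G)[s] = x ∨ n + s = x := by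
  by_cases hxn : x < n
  · have hmem : x ∈ leaves G := by
      rw [← List.count_pos_iff, count_leaves hxn]
      omega
    obtain ⟨s, hs, hget⟩ := List.mem_iff_getElem.mp hmem
    exact ⟨s, hs, Or.inl hget⟩
  · exact ⟨x - n, by omega, Or.inr (by omega)⟩

theorem exists_separating {x : ℕ} (hx : x < n + (leaves G).length) :
    ∃ t < (oddList G).length, ∃ t' < (oddList G).length,
      (listSrc (oddList G) t = x ∨ listTgt (oddList G) t = x) ∧
      listSrc (oddList G) t = listSrc (oddList G) t' ∧
      listTgt (oddList G) t ≠ listTgt (oddList G) t' := by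
  have hlen := length_oddList_eq_add G
  obtain ⟨s, hs, hxs⟩ := exists_leaf_edge hx
  obtain ⟨s', hs', hne, heq⟩ := exists_ne_leaf hs
  refine ⟨(edgeList G).length + s, by omega, (edgeList G).length + s', by omega, ?_⟩
  rw [listSrc_oddList_leaf hs, listTgt_oddList_leaf hs, listSrc_oddList_leaf hs',
    listTgt_oddList_leaf hs']
  exact ⟨hxs, heq.symm, by omega⟩

variable (G)

/-- The odd graph obtained from `G` by attaching leaves. -/
noncomputable def oddGraph : SimpleGraph (Fin (n + (leaves G).length)) :=
  (isEdgeListing_oddList G).graph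

/-- The number of vertices of the reduced graph. -/
noncomputable def reducedSize : ℕ :=
  n + (leaves G).length + (oddList G).length * ((oddList G).length + 1)

/-- The reduction: the asymmetric subdivision of the odd graph in which the edge number `t` receives
`2 * t + 2` new vertices. -/
noncomputable def reducedGraph : SimpleGraph (Fin (reducedSize G)) :=
  (isEdgeListing_oddList G).subdivision

theorem oddGraph_adj {x y : Fin (n + (leaves G).length)} :
    (oddGraph G).Adj x y ↔ (x.1, y.1) ∈ oddList G ∨ (y.1, x.1) ∈ oddList G :=
  graph_list_adj (fun _ => lt_of_mem_oddList) (nodup_oddList G)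

theorem odd_ncard_neighborSet_oddGraph (x : Fin (n + (leaves G).length)) :
    Odd ((oddGraph G).neighborSet x).ncard := by
  rw [oddGraph, ncard_neighborSet_graph_list (fun _ => lt_of_mem_oddList) (nodup_oddList G)]
  exact odd_count_ends_oddList x.2

theorem isFreeDLA_reducedGraph : IsFreeDLA (reducedGraph G) :=
  (isEdgeListing_oddList G).isFreeDLA (odd_ncard_neighborSet_oddGraph G) fun _ => exists_separating

/-- The inclusion of `G` into the odd graph. -/
noncomputable def toOddGraph : G →g oddGraph G where
  toFun := Fin.castLE (Nat.le_add_right _ _)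
  map_rel' {x y} h := by
    rw [← graph_edgeList G, graph_list_adj (fun _ => lt_of_mem_edgeList) (nodup_edgeList G)] at h
    exact (oddGraph_adj G).mpr (h.imp (List.mem_append_left _) (List.mem_append_left _))

theorem exists_reachable_toOddGraph (x : Fin (n + (leaves G).length)) :
    ∃ a, (oddGraph G).Reachable x (toOddGraph G a) := by
  by_cases hx : x.1 < n
  · exact ⟨⟨x, hx⟩, SimpleGraph.Reachable.refl _⟩
  · have hs : x.1 - n < (leaves G).length := by omega
    refine ⟨⟨(leaves G)[x.1 - n], lt_of_mem_leaves (List.getElem_mem hs)⟩,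
      SimpleGraph.Adj.reachable ((oddGraph_adj G).mpr (Or.inr (List.mem_append_right _ ?_)))⟩
    exact List.mem_zipIdx_iff_le_and_getElem?_sub.mpr
      ⟨not_lt.mp hx, List.getElem?_eq_getElem hs⟩

variable {G}

theorem connected_oddGraph (hG : G.Connected) : (oddGraph G).Connected := by
  have := hG.nonempty
  refine (SimpleGraph.connected_iff _).mpr ⟨fun x y => ?_, this.map (toOddGraph G)⟩
  obtain ⟨a, ha⟩ := exists_reachable_toOddGraph G x
  obtain ⟨b, hb⟩ := exists_reachable_toOddGraph G y
  exact ha.trans (((hG.preconnected a b).map (toOddGraph G)).trans hb.symm)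

theorem isOddGraph_oddGraph (hG : G.Connected) : IsOddGraph (oddGraph G) where
  connected := connected_oddGraph hG
  three_le_card := by
    have : 0 < n := Fin.pos_iff_nonempty.mpr hG.nonempty
    rw [Fintype.card_fin, length_leaves]
    omega
  odd_degree := odd_ncard_neighborSet_oddGraph G

theorem isAsymmetricallySubdividedOddGraph_reducedGraph (hG : G.Connected) :
    IsAsymmetricallySubdividedOddGraph (reducedGraph G) :=
  ⟨_, oddGraph G, isOddGraph_oddGraph hG, (isEdgeListing_oddList G).isAsymmetricSubdivision⟩

theorem length_oddList_le (hG : G.Connected) :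
    (oddList G).length ≤ 6 * G.edgeSet.ncard + 3 := by
  have hn : n ≤ G.edgeSet.ncard + 1 := by
    simpa using hG.card_vert_le_card_edgeSet_add_one
  rw [length_oddList, length_edgeList]
  omega

theorem le_hundred_mul_max_sq {K E : ℕ} (hK : K ≤ 6 * E + 3) :
    K * (K + 1) + K ≤ 99 * max 1 (E ^ 2) := by
  have hmul : K * (K + 1) + K ≤ (6 * E + 3) * (6 * E + 3 + 1) + (6 * E + 3) := by gcongr
  rcases E.eq_zero_or_pos with rfl | hE
  · simp only [mul_zero, zero_add] at hmul
    omega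
  · have := le_max_right 1 (E ^ 2)
    nlinarith

theorem reducedSize_le (hG : G.Connected) :
    reducedSize G ≤ 100 * max 1 (G.edgeSet.ncard ^ 2) := by
  have hn : n ≤ G.edgeSet.ncard + 1 := by
    simpa using hG.card_vert_le_card_edgeSet_add_one
  have hle := le_hundred_mul_max_sq (length_oddList_le hG)
  have hadd := length_oddList_eq_add G
  rw [length_edgeList] at hadd
  have := le_max_left 1 (G.edgeSet.ncard ^ 2)
  rw [reducedSize]
  omega

theorem ncard_edgeSet_reducedGraph_le (hG : G.Connected) :
    (reducedGraph G).edgeSet.ncard ≤ 100 * max 1 (G.edgeSet.ncard ^ 2) :=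
  (isEdgeListing_oddList G).ncard_edgeSet_subdivision.trans_le
    ((le_hundred_mul_max_sq (length_oddList_le hG)).trans (by gcongr; decide))

variable (G)

theorem cutSize_oddGraph (c : ℕ → Bool) :
    cutSize (oddGraph G) (fun x => c x) = cutSize G (fun x => c x) +
      (((leaves G).zipIdx n).map fun p => if c p.1 = c p.2 then 0 else 1).sum := by
  rw [oddGraph, cutSize_graph_list (fun _ => lt_of_mem_oddList) (nodup_oddList G), oddList,
    List.map_append, List.sum_append, cutSize_eq_sum_edgeList]

theorem cutSize_oddGraph_le (c : ℕ → Bool) :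
    cutSize (oddGraph G) (fun x => c x) ≤ cutSize G (fun x => c x) + (leaves G).length := by
  rw [cutSize_oddGraph]
  gcongr
  refine (List.sum_le_card_nsmul _ 1 fun x hx => ?_).trans_eq (by simp)
  obtain ⟨p, -, rfl⟩ := List.mem_map.mp hx
  split_ifs <;> decide

variable {G} in
theorem cutSize_oddGraph_of_alternating {c : ℕ → Bool}
    (hc : ∀ p ∈ (leaves G).zipIdx n, c p.2 = !c p.1) :
    cutSize (oddGraph G) (fun x => c x) = cutSize G (fun x => c x) + (leaves G).length := by
  rw [cutSize_oddGraph, List.map_congr_left (g := fun _ => 1)]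
  · simp
  · exact fun p hp => if_neg (by simp [hc p hp])

theorem le_reducedSize : n ≤ reducedSize G :=
  (Nat.le_add_right _ _).trans (Nat.le_add_right _ _)

/-- The restriction of a colouring of the reduced graph to the vertices of `G`. -/
noncomputable def restrictCut (C : Fin (reducedSize G) → Bool) (x : Fin n) : Bool :=
  C (Fin.castLE (le_reducedSize G) x)

theorem cutSize_reducedGraph_le (C : Fin (reducedSize G) → Bool) :
    cutSize (reducedGraph G) C ≤ cutSize G (restrictCut G C) +
      ((leaves G).length + (oddList G).length * ((oddList G).length + 1)) := by
  obtain ⟨c, rfl⟩ := Fin.val_injective.surjective_comp_right C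
  have hsub := (isEdgeListing_oddList G).cutSize_subdivision_le c
  have hodd := cutSize_oddGraph_le G c
  exact hsub.trans ((Nat.add_le_add_right hodd _).trans_eq (add_assoc _ _ _))

/-- A colouring of the reduced graph that alternates along the paths and on the edges to the
leaves. -/
structure IsAlternating (c : ℕ → Bool) : Prop where
  leaf : ∀ p ∈ (leaves G).zipIdx n, c p.2 = !c p.1
  path : ∀ t < (oddList G).length, ∀ i < 2 * t + 2,
    c (pathPos (n + (leaves G).length) (listSrc (oddList G)) (listTgt (oddList G)) t (i + 1)) =
      !c (pathPos (n + (leaves G).length) (listSrc (oddList G)) (listTgt (oddList G)) t i)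

variable {G}

theorem IsAlternating.cutSize_reducedGraph {c : ℕ → Bool} (hc : IsAlternating G c) :
    cutSize (reducedGraph G) (fun x => c x) = cutSize G (fun x => c x) +
      ((leaves G).length + (oddList G).length * ((oddList G).length + 1)) := by
  have hsub := (isEdgeListing_oddList G).cutSize_subdivision_of_alternating hc.path
  have hodd := cutSize_oddGraph_of_alternating hc.leaf
  exact hsub.trans ((congrArg (· + _) hodd).trans (add_assoc _ _ _))

theorem exists_alternating_paths {h K : ℕ} {src tgt : ℕ → ℕ} (hsrc : ∀ t < K, src t < h)
    (c₀ : ℕ → Bool) : ∃ c : ℕ → Bool, (∀ x < h, c x = c₀ x) ∧ ∀ t < K, ∀ i < 2 * t + 2,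
      c (pathPos h src tgt t (i + 1)) = !c (pathPos h src tgt t i) := by
  let pos : (Σ t : ℕ, Fin (2 * t + 2)) → ℕ := fun p => h + (p.1 * (p.1 + 1) + p.2)
  have hpos : Function.Injective pos := by
    rintro ⟨t, i⟩ ⟨t', i'⟩ heq
    obtain ⟨rfl, hi⟩ := mul_succ_add_inj i.2 i'.2 (Nat.add_left_cancel heq)
    rw [Fin.ext hi]
  let c := Function.extend pos (fun p => !(c₀ (src p.1) ^^ p.2.1.bodd)) c₀
  have hold : ∀ x < h, c x = c₀ x := fun x hx =>
    Function.extend_apply' _ _ _ (by rintro ⟨p, rfl⟩; simp only [pos] at hx; omega)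
  have hnew : ∀ t, ∀ i < 2 * t + 2,
      c (pathPos h src tgt t (i + 1)) = !(c₀ (src t) ^^ i.bodd) := fun t i hi => by
    rw [pathPos, if_pos hi, add_assoc]
    exact hpos.extend_apply _ _ ⟨t, ⟨i, hi⟩⟩
  refine ⟨c, hold, fun t ht i hi => ?_⟩
  rw [hnew t i hi]
  cases i with
  | zero => simp [pathPos, hold _ (hsrc t ht)]
  | succ i => simp [hnew t i (by omega)]

variable (G) in
theorem exists_isAlternating (C : ℕ → Bool) : ∃ c, IsAlternating G c ∧ ∀ x < n, c x = C x := by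
  obtain ⟨c, hold, hpath⟩ := exists_alternating_paths (tgt := listTgt (oddList G))
    (isEdgeListing_oddList G).src_lt
    fun x => if x < n then C x else !C ((leaves G).getD (x - n) 0)
  have hC : ∀ x < n, c x = C x := fun x hx => by rw [hold x (by omega), if_pos hx]
  refine ⟨c, ⟨fun p hp => ?_, hpath⟩, hC⟩
  obtain ⟨hlt, hle, hlt'⟩ := lt_of_mem_zipIdx_leaves hp
  obtain ⟨-, hget⟩ := List.mem_zipIdx_iff_le_and_getElem?_sub.mp hp
  rw [hC _ hlt, hold _ hlt', if_neg (by omega), List.getD_eq_getElem?_getD, hget, Option.getD_some]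

variable (G) in
theorem exists_extension (C : Fin n → Bool) :
    ∃ c, IsAlternating G c ∧ (fun x : Fin n => c x) = C := by
  obtain ⟨C, rfl⟩ := Fin.val_injective.surjective_comp_right C
  obtain ⟨c, hc, hcC⟩ := exists_isAlternating G C
  exact ⟨c, hc, funext fun x => hcC x x.2⟩

variable (G) in
theorem maxCut_reducedGraph : maxCut (reducedGraph G) =
    maxCut G + ((leaves G).length + (oddList G).length * ((oddList G).length + 1)) := by
  refine maxCut_eq_add (cutSize_reducedGraph_le G) fun C => ?_
  obtain ⟨c, hc, rfl⟩ := exists_extension G C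
  exact ⟨_, hc.cutSize_reducedGraph⟩

theorem IsOptimalCut.restrictCut {C : Fin (reducedSize G) → Bool}
    (hC : IsOptimalCut (reducedGraph G) C) : IsOptimalCut G (restrictCut G C) :=
  hC.restrict (cutSize_reducedGraph_le G) (maxCut_reducedGraph G)

theorem IsAlternating.isOptimalCut {c : ℕ → Bool} (hc : IsAlternating G c)
    (hopt : IsOptimalCut G fun x => c x) : IsOptimalCut (reducedGraph G) fun x => c x := by
  rw [IsOptimalCut] at hopt ⊢
  rw [hc.cutSize_reducedGraph, hopt, maxCut_reducedGraph]

end OddGraph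

/-! ### Programs that read a graph -/

section ProgramLogic

/-- The total-correctness Hoare triple with a running time, for a fixed initial state: started in
`σ`, the program `p` halts after at most `t` steps in a state satisfying `Q`. -/
def HaltsWithin (p : Program) (σ : RamState) (t : ℕ) (Q : RamState → Prop) : Prop :=
  ∃ (τ : RamState) (s : ℕ), s ≤ t ∧ Run p σ τ s ∧ Q τ

variable {p q : Program} {σ : RamState} {t t' : ℕ} {P Q Q' : RamState → Prop}

theorem HaltsWithin.mono (h : HaltsWithin p σ t Q) (ht : t ≤ t') (hQ : ∀ τ, Q τ → Q' τ) :
    HaltsWithin p σ t' Q' := by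
  obtain ⟨τ, s, hs, hr, hq⟩ := h
  exact ⟨τ, s, hs.trans ht, hr, hQ τ hq⟩

theorem HaltsWithin.mono_time (h : HaltsWithin p σ t Q) (ht : t ≤ t') : HaltsWithin p σ t' Q :=
  h.mono ht fun _ hτ => hτ

theorem HaltsWithin.seq (hp : HaltsWithin p σ t P) (hq : ∀ τ, P τ → HaltsWithin q τ t' Q) :
    HaltsWithin (.seq p q) σ (t + t') Q := by
  obtain ⟨τ, s, hs, hr, hP⟩ := hp
  obtain ⟨υ, s', hs', hr', hQ⟩ := hq τ hP
  exact ⟨υ, s + s', by omega, .seq hr hr', hQ⟩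

/-- The straight-line program that executes a list of instructions. -/
def block : List Instr → Program
  | [] => .skip
  | c :: l => .seq (.instr c) (block l)

/-- The effect of a list of instructions on the state. -/
def execAll : List Instr → RamState → RamState
  | [], σ => σ
  | c :: l, σ => execAll l (c.exec σ)

theorem haltsWithin_block {l : List Instr} (h : Q (execAll l σ)) :
    HaltsWithin (block l) σ (l.length + 1) Q := by
  induction l generalizing σ with
  | nil => exact ⟨σ, 1, le_rfl, .skip σ, h⟩
  | cons c l ih =>
    obtain ⟨τ, s, hs, hr, hq⟩ := ih h
    exact ⟨τ, 1 + s, by simp only [List.length_cons]; omega, .seq (.instr c σ) hr, hq⟩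

theorem haltsWithin_loop {r N b : ℕ} (I : ℕ → RamState → Prop)
    (hr : ∀ i ≤ N, ∀ τ, I i τ → (τ.reg r = 0 ↔ i = N))
    (step : ∀ i < N, ∀ τ, I i τ → HaltsWithin p τ b (I (i + 1))) (h0 : I 0 σ) :
    HaltsWithin (.loop r p) σ (N * (b + 1) + 1) (I N) := by
  suffices key : ∀ k i σ, i + k = N → I i σ →
      HaltsWithin (.loop r p) σ (k * (b + 1) + 1) (I N) from key N 0 σ (by omega) h0
  intro k
  induction k with
  | zero =>
    intro i σ hi hI
    obtain rfl : i = N := hi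
    exact ⟨σ, 1, by omega, .loop_done ((hr i le_rfl σ hI).mpr rfl), hI⟩
  | succ k ih =>
    intro i σ hi hI
    obtain ⟨τ, s, hs, hrun, hI'⟩ := step i (by omega) σ hI
    obtain ⟨υ, s', hs', hrun', hN⟩ := ih (i + 1) τ (by omega) hI'
    have hne : σ.reg r ≠ 0 := fun h => by have := (hr i (by omega) σ hI).mp h; omega
    exact ⟨υ, s + s' + 1, by rw [Nat.succ_mul]; omega, .loop_step hne hrun hrun', hN⟩

theorem haltsWithin_countdown {r N b : ℕ} (I : ℕ → RamState → Prop)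
    (hr : ∀ i τ, I i τ → τ.reg r = N - i)
    (step : ∀ i < N, ∀ τ, I i τ → HaltsWithin p τ b (I (i + 1))) (h0 : I 0 σ) :
    HaltsWithin (.loop r p) σ (N * (b + 1) + 1) (I N) :=
  haltsWithin_loop I (fun i hi τ hτ => by rw [hr i τ hτ]; omega) step h0

theorem haltsWithin_loop_block {r N : ℕ} {l : List Instr} (I : ℕ → RamState → Prop)
    (hr : ∀ i τ, I i τ → τ.reg r = N - i) (step : ∀ i < N, ∀ τ, I i τ → I (i + 1) (execAll l τ))
    (h0 : I 0 σ) :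
    HaltsWithin (.loop r (block l)) σ (N * (l.length + 2) + 1) (I N) :=
  haltsWithin_countdown I hr (fun i hi τ hτ => haltsWithin_block (step i hi τ hτ)) h0

end ProgramLogic

section ListingTheOddGraph

attribute [local simp] execAll Instr.exec

/-- The arrays `f` and `g` start with the first and the second components of the pairs in `l`. -/
def Lists (f g : ℕ → ℕ) (l : List (ℕ × ℕ)) : Prop :=
  ∀ k < l.length, f k = listSrc l k ∧ g k = listTgt l k

theorem Lists.update {f g : ℕ → ℕ} {l : List (ℕ × ℕ)} (h : Lists f g l) (a b : ℕ) :
    Lists (Function.update f l.length a) (Function.update g l.length b) l := by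
  intro k hk
  rw [Function.update_of_ne hk.ne, Function.update_of_ne hk.ne]
  exact h k hk

theorem Lists.append {f g : ℕ → ℕ} {l : List (ℕ × ℕ)} (h : Lists f g l) (a b : ℕ) :
    Lists (Function.update f l.length a) (Function.update g l.length b) (l ++ [(a, b)]) := by
  intro k hk
  rw [listSrc_of_lt hk, listTgt_of_lt hk]
  rw [List.length_append, List.length_singleton] at hk
  obtain hkl | rfl : k < l.length ∨ k = l.length := by omega
  · rw [List.getElem_append_left hkl, ← listSrc_of_lt hkl, ← listTgt_of_lt hkl]
    exact h.update a b k hkl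
  · simp

theorem Lists.append_two {f g : ℕ → ℕ} {l : List (ℕ × ℕ)} (h : Lists f g l) (a b c d : ℕ) :
    Lists (Function.update (Function.update f l.length a) (l.length + 1) c)
      (Function.update (Function.update g l.length b) (l.length + 1) d)
      (l ++ [(a, b), (c, d)]) := by
  have h' := (h.append a b).append c d
  rwa [List.length_append, List.length_singleton, List.append_assoc, List.singleton_append] at h'

theorem Lists.append_three {f g : ℕ → ℕ} {l : List (ℕ × ℕ)} (h : Lists f g l)
    (a b c d a' b' : ℕ) :
    Lists (Function.update (Function.update (Function.update f l.length a) (l.length + 1) c)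
        (l.length + 2) a')
      (Function.update (Function.update (Function.update g l.length b) (l.length + 1) d)
        (l.length + 2) b') (l ++ [(a, b), (c, d), (a', b')]) := by
  have h' := (h.append_two a b c d).append a' b'
  rwa [List.length_append, List.append_assoc] at h'

/-- The state throughout a program that reads a graph with `n` vertices. In all programs below,
registers `1` and `19` hold the constants `1` and `0`, so that `.add r s 19` copies `s` to `r`;
register `2` holds `n`, and array `0` is the input. -/
structure Base (n : ℕ) (inp : ℕ → ℕ) (σ : RamState) : Prop where
  one : σ.reg 1 = 1
  zero : σ.reg 19 = 0
  size : σ.reg 2 = n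
  input : σ.arr 0 = inp

/-- Sets up the constants and counts the ones at the beginning of the input. -/
def parse : Program :=
  .seq (block [.const 1 1, .const 2 0, .const 19 0, .load 10 0 2])
    (.loop 10 (block [.add 2 2 1, .load 10 0 2]))

/-- The state when no output has been written yet. -/
structure Parsed (n : ℕ) (inp : ℕ → ℕ) (σ : RamState) : Prop where
  base : Base n inp σ
  output : σ.arr 1 = fun _ => 0

/-- The state of `parse` after reading `i` ones. -/
structure Parsing (inp : ℕ → ℕ) (i : ℕ) (σ : RamState) : Prop where
  parsed : Parsed i inp σ
  bit : σ.reg 10 = inp i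

theorem haltsWithin_parse {n : ℕ} {inp : ℕ → ℕ} (h1 : ∀ i < n, inp i ≠ 0) (h2 : inp n = 0)
    {σ : RamState} (hinput : σ.arr 0 = inp) (houtput : σ.arr 1 = fun _ => 0) :
    HaltsWithin parse σ (4 * n + 6) (Parsed n inp) := by
  have hstart : Parsing inp 0
      (execAll [.const 1 1, .const 2 0, .const 19 0, .load 10 0 2] σ) := by
    refine ⟨⟨⟨?_, ?_, ?_, ?_⟩, ?_⟩, ?_⟩ <;> simp [*]
  have hstep : ∀ i τ, Parsing inp i τ →
      Parsing inp (i + 1) (execAll [.add 2 2 1, .load 10 0 2] τ) := by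
    rintro i τ ⟨⟨⟨hone, hzero, hsize, hin⟩, hout⟩, -⟩
    refine ⟨⟨⟨?_, ?_, ?_, ?_⟩, ?_⟩, ?_⟩ <;> simp [*]
  have htest : ∀ i ≤ n, ∀ τ, Parsing inp i τ → (τ.reg 10 = 0 ↔ i = n) := by
    refine fun i hi τ hτ => hτ.bit ▸ ⟨fun h => ?_, fun h => h ▸ h2⟩
    exact hi.eq_of_not_lt fun hlt => h1 i hlt h
  refine ((haltsWithin_block hstart).seq fun τ hτ => haltsWithin_loop (Parsing inp) htest
    (fun i _ τ hτ => haltsWithin_block (hstep i τ hτ)) hτ).mono ?_ fun τ hτ => hτ.parsed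
  simp only [List.length_cons, List.length_nil]
  omega

variable {n : ℕ} (G : SimpleGraph (Fin n))

/-- The input array `inp` starts with the encoding of `G`. -/
structure IsInput (inp : ℕ → ℕ) : Prop where
  size : ∀ i < n, inp i ≠ 0
  sep : inp n = 0
  adj : ∀ i < n, ∀ j < n, inp (n + 1 + i * n + j) = (adjNat G i j).toNat

/-- The edges met before the entry `(i, j)` when the adjacency matrix is read row by row. -/
noncomputable def edgesBefore (i j : ℕ) : List (ℕ × ℕ) :=
  ((List.range i).flatMap fun i' => edgeRow G i' n) ++ edgeRow G i j

theorem edgesBefore_succ_right (i j : ℕ) : edgesBefore G i (j + 1) =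
    edgesBefore G i j ++ if i < j ∧ adjNat G i j = true then [(i, j)] else [] := by
  rw [edgesBefore, edgesBefore, List.append_assoc, edgeRow, List.range_succ, List.filter_append,
    List.map_append, edgeRow]
  congr 2
  by_cases h1 : i < j <;> by_cases h2 : adjNat G i j = true <;> simp [h1, h2]

theorem edgesBefore_succ_left (i : ℕ) : edgesBefore G (i + 1) 0 = edgesBefore G i n := by
  simp [edgesBefore, List.range_succ, edgeRow]

theorem edgesBefore_zero : edgesBefore G 0 0 = [] := by simp [edgesBefore, edgeRow]

theorem edgesBefore_self : edgesBefore G n 0 = edgeList G := by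
  simp [edgesBefore, edgeList, edgeRow]

/-- The state when the `reg 3` pairs of the list `l` are stored in the arrays `2` and `3`. -/
structure Listed (n : ℕ) (inp : ℕ → ℕ) (l : List (ℕ × ℕ)) (σ : RamState) : Prop where
  parsed : Parsed n inp σ
  length : σ.reg 3 = l.length
  lists : Lists (σ.arr 2) (σ.arr 3) l

/-- The instructions that read one entry of the adjacency matrix. A pair is stored in any case, and
counted only if it is an edge `(i, j)` with `i < j`: register `10` then still holds the entry
`1 = 1 - (1 - (j - i))`, and otherwise becomes `0`. -/
def entryStep : List Instr :=
  [.load 10 0 5, .sub 11 7 6, .sub 12 10 11, .sub 10 10 12, .store 2 3 6, .store 3 3 7,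
    .add 3 3 10, .add 5 5 1, .add 7 7 1, .sub 9 9 1]

/-- Reads one row of the adjacency matrix. -/
def listRow : Program :=
  .seq (block [.const 7 0, .add 9 2 19])
    (.seq (.loop 9 (block entryStep)) (block [.add 6 6 1, .sub 8 8 1]))

/-- Stores the list of the edges of the input graph. -/
def listEdges : Program :=
  .seq (block [.add 5 2 1, .const 6 0, .const 3 0, .add 8 2 19]) (.loop 8 listRow)

/-- The state of `listEdges` before reading the entry `(i, j)`, without the counters for `j`. -/
structure RowScan (inp : ℕ → ℕ) (i j : ℕ) (σ : RamState) : Prop where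
  listed : Listed n inp (edgesBefore G i j) σ
  pos : σ.reg 5 = n + 1 + i * n + j
  row : σ.reg 6 = i
  rowsLeft : σ.reg 8 = n - i

/-- The state of `listEdges` before reading the entry `(i, j)`. -/
structure EntryScan (inp : ℕ → ℕ) (i j : ℕ) (σ : RamState) : Prop where
  rowScan : RowScan G inp i j σ
  col : σ.reg 7 = j
  colsLeft : σ.reg 9 = n - j

variable {G}

theorem EntryScan.execAll_entryStep {inp : ℕ → ℕ} (hinp : IsInput G inp) {i j : ℕ} (hi : i < n)
    (hj : j < n) {σ : RamState} (hσ : EntryScan G inp i j σ) :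
    EntryScan G inp i (j + 1) (execAll entryStep σ) := by
  obtain ⟨⟨⟨⟨⟨hone, hzero, hsize, hin⟩, hout⟩, hlength, hlists⟩, hpos, hrow, hrows⟩, hcol, hcols⟩ :=
    hσ
  have hentry := hinp.adj i hi j hj
  have hlength' : (execAll entryStep σ).reg 3 = (edgesBefore G i (j + 1)).length := by
    rw [edgesBefore_succ_right, List.length_append, ← hlength]
    by_cases hij : i < j <;> cases hadj : adjNat G i j <;>
      simp [entryStep, *] <;> omega
  refine ⟨⟨⟨⟨⟨?_, ?_, ?_, ?_⟩, ?_⟩, hlength', ?lists⟩, ?_, ?_, ?_⟩, ?_, ?_⟩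
  case lists =>
    rw [edgesBefore_succ_right]
    split_ifs
    · simpa [entryStep, *] using hlists.append i j
    · simpa [entryStep, *] using hlists.update i j
  all_goals simp [entryStep, *, add_assoc, Nat.sub_sub]

theorem haltsWithin_listRow {inp : ℕ → ℕ} (hinp : IsInput G inp) {i : ℕ} (hi : i < n)
    {σ : RamState} (hσ : RowScan G inp i 0 σ) :
    HaltsWithin listRow σ (n * 12 + 7) (RowScan G inp (i + 1) 0) := by
  refine ((haltsWithin_block (Q := EntryScan G inp i 0) ?_).seq fun τ hτ =>
    (haltsWithin_loop_block (EntryScan G inp i) (fun j τ hτ => hτ.colsLeft)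
      (fun j hj τ hτ => hτ.execAll_entryStep hinp hi hj) hτ).seq fun τ hτ =>
    haltsWithin_block ?_).mono_time ?_
  · obtain ⟨⟨⟨⟨hone, hzero, hsize, hin⟩, hout⟩, hlength, hlists⟩, hpos, hrow, hrows⟩ := hσ
    refine ⟨⟨⟨⟨⟨?_, ?_, ?_, ?_⟩, ?_⟩, ?_, ?_⟩, ?_, ?_, ?_⟩, ?_, ?_⟩ <;> simp [*]
  · obtain ⟨⟨⟨⟨⟨hone, hzero, hsize, hin⟩, hout⟩, hlength, hlists⟩, hpos, hrow, hrows⟩, -, -⟩ := hτ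
    refine ⟨⟨⟨⟨?_, ?_, ?_, ?_⟩, ?_⟩, ?_, ?_⟩, ?_, ?_, ?_⟩ <;>
      simp [*, edgesBefore_succ_left, Nat.sub_sub, Nat.succ_mul, add_assoc]
  · simp only [entryStep, List.length_cons, List.length_nil]
    omega

theorem haltsWithin_listEdges {inp : ℕ → ℕ} (hinp : IsInput G inp) {σ : RamState}
    (hσ : Parsed n inp σ) :
    HaltsWithin listEdges σ (n * (n * 12 + 8) + 6) fun τ =>
      Listed n inp (edgeList G) τ ∧ τ.reg 5 = n + 1 + n * n := by
  have hstart : RowScan G inp 0 0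
      (execAll [.add 5 2 1, .const 6 0, .const 3 0, .add 8 2 19] σ) := by
    obtain ⟨⟨hone, hzero, hsize, hin⟩, hout⟩ := hσ
    refine ⟨⟨⟨⟨?_, ?_, ?_, ?_⟩, ?_⟩, ?_, ?_⟩, ?_, ?_, ?_⟩ <;> simp [*, edgesBefore_zero, Lists]
  refine ((haltsWithin_block hstart).seq fun τ hτ =>
    haltsWithin_countdown (fun i => RowScan G inp i 0) (fun i τ hτ => hτ.rowsLeft)
      (fun i hi τ hτ => haltsWithin_listRow hinp hi hτ) hτ).mono
    ?_ fun τ hτ => ⟨edgesBefore_self G ▸ hτ.listed, hτ.pos⟩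
  simp only [List.length_cons, List.length_nil]
  linarith

/-- Attaches a leaf to both ends of the edge number `reg 6`. -/
def attachToEdge : List Instr :=
  [.load 10 2 6, .load 11 3 6, .store 2 3 10, .store 3 3 4, .add 4 4 1, .add 3 3 1,
    .store 2 3 11, .store 3 3 4, .add 4 4 1, .add 3 3 1, .add 6 6 1, .sub 8 8 1]

/-- Attaches three leaves to the vertex `reg 6`. -/
def attachToVertex : List Instr :=
  [.store 2 3 6, .store 3 3 4, .add 4 4 1, .add 3 3 1, .store 2 3 6, .store 3 3 4, .add 4 4 1,
    .add 3 3 1, .store 2 3 6, .store 3 3 4, .add 4 4 1, .add 3 3 1, .add 6 6 1, .sub 8 8 1]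

/-- Appends the edges to the leaves to the stored list of edges. -/
def addLeaves : Program :=
  .seq (block [.add 13 3 19, .add 4 2 19, .add 8 3 19, .const 6 0])
    (.seq (.loop 8 (block attachToEdge))
      (.seq (block [.const 6 0, .add 8 2 19]) (.loop 8 (block attachToVertex))))

/-- The state after attaching leaves to the vertices in `ls`. -/
structure Attached (n : ℕ) (inp : ℕ → ℕ) (es : List (ℕ × ℕ)) (ls : List ℕ) (σ : RamState) :
    Prop where
  listed : Listed n inp (es ++ ls.zipIdx n) σ
  edges : σ.reg 13 = es.length
  size : σ.reg 4 = n + ls.length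
  pos : σ.reg 5 = n + 1 + n * n

/-- The state of a loop of `addLeaves` after `i` of `N` rounds. -/
structure Attaching (n : ℕ) (inp : ℕ → ℕ) (es : List (ℕ × ℕ)) (ls : List ℕ) (N i : ℕ)
    (σ : RamState) : Prop where
  attached : Attached n inp es ls σ
  index : σ.reg 6 = i
  left : σ.reg 8 = N - i

variable {inp : ℕ → ℕ} {es : List (ℕ × ℕ)} {ls : List ℕ} {N i : ℕ} {σ : RamState}

theorem Attaching.execAll_attachToEdge (hi : i < es.length)
    (hσ : Attaching n inp es ls N i σ) :
    Attaching n inp es (ls ++ [es[i].1, es[i].2]) N (i + 1) (execAll attachToEdge σ) := by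
  obtain ⟨⟨⟨⟨⟨hone, hzero, hsize, hin⟩, hout⟩, hlength, hlists⟩, hedges, horder, hpos⟩, hindex,
    hleft⟩ := hσ
  have hi' : i < (es ++ ls.zipIdx n).length := by rw [List.length_append]; omega
  have hsrc : σ.arr 2 i = es[i].1 := by
    rw [(hlists i hi').1, listSrc_of_lt hi', List.getElem_append_left hi]
  have htgt : σ.arr 3 i = es[i].2 := by
    rw [(hlists i hi').2, listTgt_of_lt hi', List.getElem_append_left hi]
  refine ⟨⟨⟨⟨⟨?_, ?_, ?_, ?_⟩, ?_⟩, ?_, ?lists⟩, ?_, ?_, ?_⟩, ?_, ?_⟩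
  case lists =>
    rw [List.zipIdx_append, ← List.append_assoc]
    simpa [attachToEdge, *, add_assoc] using
      hlists.append_two es[i].1 (n + ls.length) es[i].2 (n + ls.length + 1)
  all_goals simp [attachToEdge, *, Nat.sub_sub, add_assoc]

theorem Attaching.execAll_attachToVertex (hσ : Attaching n inp es ls N i σ) :
    Attaching n inp es (ls ++ [i, i, i]) N (i + 1) (execAll attachToVertex σ) := by
  obtain ⟨⟨⟨⟨⟨hone, hzero, hsize, hin⟩, hout⟩, hlength, hlists⟩, hedges, horder, hpos⟩, hindex,
    hleft⟩ := hσ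
  refine ⟨⟨⟨⟨⟨?_, ?_, ?_, ?_⟩, ?_⟩, ?_, ?lists⟩, ?_, ?_, ?_⟩, ?_, ?_⟩
  case lists =>
    rw [List.zipIdx_append, ← List.append_assoc]
    simpa [attachToVertex, *, add_assoc] using
      hlists.append_three i (n + ls.length) i (n + ls.length + 1) i (n + ls.length + 2)
  all_goals simp [attachToVertex, *, Nat.sub_sub, add_assoc]

theorem haltsWithin_addLeaves (hσ : Listed n inp es σ ∧ σ.reg 5 = n + 1 + n * n) :
    HaltsWithin addLeaves σ (es.length * 14 + n * 16 + 10)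
      (Attached n inp es (ends es ++ (List.range n).flatMap fun i => [i, i, i])) := by
  let I : ℕ → RamState → Prop := fun t => Attaching n inp es (ends (es.take t)) es.length t
  let J : ℕ → RamState → Prop := fun i =>
    Attaching n inp es (ends es ++ (List.range i).flatMap fun i => [i, i, i]) n i
  have hstart : I 0 (execAll [.add 13 3 19, .add 4 2 19, .add 8 3 19, .const 6 0] σ) := by
    obtain ⟨⟨⟨⟨hone, hzero, hsize, hin⟩, hout⟩, hlength, hlists⟩, hpos⟩ := hσ
    refine ⟨⟨⟨⟨⟨?_, ?_, ?_, ?_⟩, ?_⟩, ?_, ?_⟩, ?_, ?_, ?_⟩, ?_, ?_⟩ <;> simp [*, ends]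
  have hI : ∀ t < es.length, ∀ τ, I t τ → I (t + 1) (execAll attachToEdge τ) := by
    intro t ht τ hτ
    simpa only [I, List.take_succ_eq_append_getElem ht, ends, List.flatMap_append,
      List.flatMap_singleton] using hτ.execAll_attachToEdge ht
  have hmid : ∀ τ, I es.length τ → J 0 (execAll [.const 6 0, .add 8 2 19] τ) := by
    rintro τ ⟨⟨⟨⟨⟨hone, hzero, hsize, hin⟩, hout⟩, hlength, hlists⟩, hedges, horder, hpos⟩, -, -⟩
    rw [List.take_length] at hlength hlists horder
    refine ⟨⟨⟨⟨⟨?_, ?_, ?_, ?_⟩, ?_⟩, ?_, ?_⟩, ?_, ?_, ?_⟩, ?_, ?_⟩ <;> simp [*]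
  have hJ : ∀ i < n, ∀ τ, J i τ → J (i + 1) (execAll attachToVertex τ) := by
    intro i _ τ hτ
    simpa only [J, List.range_succ, List.flatMap_append, List.flatMap_singleton,
      List.append_assoc] using hτ.execAll_attachToVertex
  refine ((haltsWithin_block hstart).seq fun τ hτ =>
    (haltsWithin_loop_block I (fun t τ hτ => hτ.left) hI hτ).seq fun τ hτ =>
    (haltsWithin_block (hmid τ hτ)).seq fun τ hτ =>
      haltsWithin_loop_block J (fun i τ hτ => hτ.left) hJ hτ).mono ?_ fun τ hτ => hτ.attached
  simp only [attachToEdge, attachToVertex, List.length_cons, List.length_nil]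
  omega

/-- Stores the list of the edges of the odd graph. -/
def listOddGraph : Program :=
  .seq parse (.seq listEdges addLeaves)

variable (G) in
theorem length_edgeList_le : (edgeList G).length ≤ n * n := by
  have hsub : edgeList G ⊆ List.range n ×ˢ List.range n := fun p hp => by
    obtain ⟨h1, h2⟩ := lt_of_mem_edgeList hp
    exact List.pair_mem_product.mpr ⟨List.mem_range.mpr (h1.trans h2), List.mem_range.mpr h2⟩
  have := (List.subperm_of_subset (nodup_edgeList G) hsub).length_le
  rwa [List.length_product, List.length_range] at this

theorem haltsWithin_listOddGraph (hinp : IsInput G inp) (hinput : σ.arr 0 = inp)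
    (houtput : σ.arr 1 = fun _ => 0) :
    HaltsWithin listOddGraph σ (26 * (n * n) + 29 * n + 22)
      (Attached n inp (edgeList G) (leaves G)) := by
  refine ((haltsWithin_parse hinp.size hinp.sep hinput houtput).seq fun τ hτ =>
    (haltsWithin_listEdges hinp hτ).seq fun τ hτ => haltsWithin_addLeaves hτ).mono_time ?_
  linarith [length_edgeList_le G]

end ListingTheOddGraph

/-! ### Writing the reduced graph -/

section Encodings

variable {n : ℕ} (G : SimpleGraph (Fin n)) (r : List Bool)

theorem length_encodeGraph : (encodeGraph G).length = n + 1 + n * n := by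
  simp only [encodeGraph, List.length_append, List.length_replicate, List.length_cons,
    List.length_ofFn]
  ring

theorem getD_encodeGraph_of_lt {i : ℕ} (hi : i < n) : (encodeGraph G ++ r).getD i false = true := by
  simp [encodeGraph, List.getD_eq_getElem?_getD, List.getElem?_append_left, hi]

theorem getD_encodeGraph_self : (encodeGraph G ++ r).getD n false = false := by
  simp [encodeGraph, List.getD_eq_getElem?_getD]

theorem getD_encodeGraph_adj {i j : ℕ} (hi : i < n) (hj : j < n) :
    (encodeGraph G ++ r).getD (n + 1 + i * n + j) false = adjNat G i j := by
  classical
  have hk : i * n + j < n * n := by nlinarith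
  have hdiv : (⟨i * n + j, hk⟩ : Fin (n * n)).divNat = ⟨i, hi⟩ := Fin.ext <| by
    change (i * n + j) / n = i
    rw [mul_comm, Nat.mul_add_div (by omega), Nat.div_eq_of_lt hj, add_zero]
  have hmod : (⟨i * n + j, hk⟩ : Fin (n * n)).modNat = ⟨j, hj⟩ := Fin.ext <| by
    change (i * n + j) % n = j
    rw [mul_comm, Nat.mul_add_mod, Nat.mod_eq_of_lt hj]
  rw [encodeGraph, List.append_assoc, List.getD_append_right _ _ _ _ (by simp; omega),
    List.length_replicate, show n + 1 + i * n + j - n = i * n + j + 1 by omega, List.cons_append,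
    List.getD_cons_succ, List.getD_append _ _ _ _ (by simpa using hk),
    List.getD_eq_getElem _ _ (by simpa using hk), List.getElem_ofFn, hdiv, hmod, Bool.eq_iff_iff,
    adjNat_iff, decide_eq_true_iff]
  exact ⟨fun h => ⟨hi, hj, h⟩, fun ⟨_, _, h⟩ => h⟩

theorem getD_encodeGraph_append (k : ℕ) :
    (encodeGraph G ++ r).getD (n + 1 + n * n + k) false = r.getD k false := by
  rw [List.getD_append_right _ _ _ _ (by rw [length_encodeGraph]; omega), length_encodeGraph,
    Nat.add_sub_cancel_left]

theorem arr_inputState_zero (x : List Bool) (i : ℕ) :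
    (inputState x).arr 0 i = (x.getD i false).toNat := by
  simp only [inputState, if_true]

theorem arr_inputState_one (x : List Bool) : (inputState x).arr 1 = fun _ => 0 := by
  simp only [inputState, one_ne_zero, if_false]

theorem isInput_inputState : IsInput G ((inputState (encodeGraph G ++ r)).arr 0) where
  size i hi := by
    rw [arr_inputState_zero, getD_encodeGraph_of_lt G r hi]
    exact one_ne_zero
  sep := by rw [arr_inputState_zero, getD_encodeGraph_self, Bool.toNat_false]
  adj i hi j hj := by rw [arr_inputState_zero, getD_encodeGraph_adj G r hi hj]

theorem length_encodeCut (C : Fin n → Bool) : (encodeCut C).length = n := List.length_ofFn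

theorem getD_encodeCut {C : Fin n → Bool} {i : ℕ} (hi : i < n) :
    (encodeCut C).getD i false = C ⟨i, hi⟩ := by
  rw [encodeCut, List.getD_eq_getElem _ _ (by simpa using hi), List.getElem_ofFn]

theorem showsOutput_encodeCut {C : Fin n → Bool} {τ : RamState} (h0 : τ.reg 0 = n)
    (h1 : ∀ i (hi : i < n), τ.arr 1 i = (C ⟨i, hi⟩).toNat) : ShowsOutput τ (encodeCut C) := by
  refine ⟨h0.trans (length_encodeCut C).symm, fun i hi => ?_⟩
  rw [length_encodeCut] at hi
  rw [getD_encodeCut hi, h1 i hi]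

open Classical in
/-- The output array for a graph on `{0, …, m - 1}` after entering the edges `{x, y}` with
`W x y`. -/
noncomputable def marked (m : ℕ) (W : ℕ → ℕ → Prop) (k : ℕ) : ℕ :=
  if k < m ∨ ∃ x y, W x y ∧ (k = m + 1 + x * m + y ∨ k = m + 1 + y * m + x) then 1 else 0

theorem update_marked (m : ℕ) (W : ℕ → ℕ → Prop) (a b : ℕ) :
    Function.update (Function.update (marked m W) (m + 1 + a * m + b) 1) (m + 1 + b * m + a) 1 =
      marked m fun x y => W x y ∨ x = a ∧ y = b := by
  classical
  funext k
  by_cases h1 : k = m + 1 + b * m + a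
  · rw [h1, Function.update_self, marked, if_pos (Or.inr ⟨a, b, Or.inr ⟨rfl, rfl⟩, Or.inr rfl⟩)]
  by_cases h2 : k = m + 1 + a * m + b
  · rw [Function.update_of_ne h1, h2, Function.update_self, marked,
      if_pos (Or.inr ⟨a, b, Or.inr ⟨rfl, rfl⟩, Or.inl rfl⟩)]
  · rw [Function.update_of_ne h1, Function.update_of_ne h2, marked, marked]
    refine if_congr (or_congr_right ⟨?_, ?_⟩) rfl rfl
    · rintro ⟨x, y, h, h'⟩
      exact ⟨x, y, Or.inl h, h'⟩
    · rintro ⟨x, y, h | ⟨rfl, rfl⟩, h'⟩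
      · exact ⟨x, y, h, h'⟩
      · exact absurd h' (not_or_intro h2 h1)

theorem eq_and_eq_of_mul_add_eq {x y a b : ℕ} (hy : y < n) (hb : b < n)
    (h : x * n + y = a * n + b) : x = a ∧ y = b := by
  have hn : 0 < n := by omega
  have hxa : x = a := by
    have := congrArg (· / n) h
    simpa [mul_comm _ n, Nat.mul_add_div hn, Nat.div_eq_of_lt hy, Nat.div_eq_of_lt hb] using this
  subst hxa
  exact ⟨rfl, by omega⟩

variable {W : ℕ → ℕ → Prop}

theorem marked_of_lt {k : ℕ} (hk : k < n) : marked n W k = 1 := if_pos (Or.inl hk)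

theorem marked_self : marked n W n = 0 := by
  rw [marked, if_neg]
  rintro (h | ⟨x, y, -, h | h⟩) <;> omega

open Classical in
theorem marked_entry (hW : ∀ x y, W x y → x < n ∧ y < n) {x y : ℕ} (hy : y < n) :
    marked n W (n + 1 + x * n + y) = if W x y ∨ W y x then 1 else 0 := by
  refine if_congr ⟨?_, fun h => Or.inr ?_⟩ rfl rfl
  · rintro (h | ⟨a, b, hab, h | h⟩)
    · omega
    · obtain ⟨rfl, rfl⟩ := eq_and_eq_of_mul_add_eq (x := x) (a := a) hy (hW _ _ hab).2 (by omega)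
      exact Or.inl hab
    · obtain ⟨rfl, rfl⟩ := eq_and_eq_of_mul_add_eq (x := x) (a := b) hy (hW _ _ hab).1 (by omega)
      exact Or.inr hab
  · exact h.elim (fun h => ⟨x, y, h, Or.inl rfl⟩) fun h => ⟨y, x, h, Or.inr rfl⟩

theorem showsOutput_encodeGraph {τ : RamState} (hW : ∀ x y, W x y → x < n ∧ y < n)
    (hG : ∀ x y : Fin n, G.Adj x y ↔ W x y ∨ W y x) (h0 : τ.reg 0 = n + 1 + n * n)
    (h1 : τ.arr 1 = marked n W) : ShowsOutput τ (encodeGraph G) := by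
  classical
  refine ⟨h0.trans (length_encodeGraph G).symm, fun k hk => ?_⟩
  rw [length_encodeGraph] at hk
  rw [h1, ← List.append_nil (encodeGraph G)]
  rcases lt_trichotomy k n with h | rfl | h
  · rw [getD_encodeGraph_of_lt G [] h, marked_of_lt h, Bool.toNat_true]
  · rw [getD_encodeGraph_self, marked_self, Bool.toNat_false]
  · obtain ⟨k, rfl⟩ : ∃ l, k = n + 1 + l := ⟨k - (n + 1), by omega⟩
    have hn : 0 < n := Nat.pos_of_ne_zero (by rintro rfl; omega)
    obtain ⟨x, y, hx, hy, rfl⟩ : ∃ x y, x < n ∧ y < n ∧ k = x * n + y :=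
      ⟨k / n, k % n, Nat.div_lt_of_lt_mul (by omega), Nat.mod_lt _ hn, (Nat.div_add_mod' k n).symm⟩
    have hadj : adjNat G x y = true ↔ W x y ∨ W y x :=
      adjNat_iff.trans ⟨fun ⟨_, _, h⟩ => (hG _ _).mp h, fun h => ⟨hx, hy, (hG _ _).mpr h⟩⟩
    rw [← add_assoc, getD_encodeGraph_adj G [] hx hy, marked_entry hW hy, ← if_congr hadj rfl rfl]
    cases adjNat G x y <;> rfl

end Encodings

section Reduction

attribute [local simp] execAll Instr.exec

/-- The state when a list of `K` edges `src t, tgt t` of a graph with `h` vertices is stored. As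
before, registers `1` and `19` hold the constants `1` and `0`. -/
structure Ready (h K : ℕ) (src tgt : ℕ → ℕ) (σ : RamState) : Prop where
  one : σ.reg 1 = 1
  zero : σ.reg 19 = 0
  length : σ.reg 3 = K
  size : σ.reg 4 = h
  src : ∀ t < K, σ.arr 2 t = src t
  tgt : ∀ t < K, σ.arr 3 t = tgt t

theorem Attached.ready {n : ℕ} {inp : ℕ → ℕ} {es : List (ℕ × ℕ)} {ls : List ℕ} {σ : RamState}
    (hσ : Attached n inp es ls σ) :
    Ready (n + ls.length) (es ++ ls.zipIdx n).length (listSrc (es ++ ls.zipIdx n))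
      (listTgt (es ++ ls.zipIdx n)) σ where
  one := hσ.listed.parsed.base.one
  zero := hσ.listed.parsed.base.zero
  length := hσ.listed.length
  size := hσ.size
  src t ht := (hσ.listed.lists t ht).1
  tgt t ht := (hσ.listed.lists t ht).2

/-- Computes the number of vertices of the subdivision. -/
def measure : Program :=
  .seq (block [.add 14 4 19, .const 15 2, .add 8 3 19])
    (.loop 8 (block [.add 14 14 15, .add 15 15 1, .add 15 15 1, .sub 8 8 1]))

variable {h K : ℕ} {src tgt : ℕ → ℕ} {σ : RamState}

/-- The state of `measure` after counting the new vertices on the first `t` edges. -/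
structure Measuring (h K : ℕ) (src tgt : ℕ → ℕ) (t : ℕ) (σ : RamState) : Prop where
  ready : Ready h K src tgt σ
  output : σ.arr 1 = fun _ => 0
  size : σ.reg 14 = h + t * (t + 1)
  step : σ.reg 15 = 2 * t + 2
  left : σ.reg 8 = K - t

theorem haltsWithin_measure (hσ : Ready h K src tgt σ) (hout : σ.arr 1 = fun _ => 0) :
    HaltsWithin measure σ (K * 6 + 5) (Measuring h K src tgt K) := by
  have hstart : Measuring h K src tgt 0
      (execAll [.add 14 4 19, .const 15 2, .add 8 3 19] σ) := by
    obtain ⟨hone, hzero, hlength, hsize, hsrc, htgt⟩ := hσ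
    refine ⟨⟨?_, ?_, ?_, ?_, hsrc, htgt⟩, ?_, ?_, ?_, ?_⟩ <;> simp [*]
  have hstep : ∀ t < K, ∀ τ, Measuring h K src tgt t τ → Measuring h K src tgt (t + 1)
      (execAll [.add 14 14 15, .add 15 15 1, .add 15 15 1, .sub 8 8 1] τ) := by
    rintro t - τ ⟨⟨hone, hzero, hlength, hsize, hsrc, htgt⟩, hout, hnumber, hinc, hleft⟩
    refine ⟨⟨?_, ?_, ?_, ?_, hsrc, htgt⟩, ?_, ?number, ?_, ?_⟩
    case number =>
      simp [*]
      ring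
    all_goals simp [*, mul_add, Nat.sub_sub]
  refine ((haltsWithin_block hstart).seq fun τ hτ =>
    haltsWithin_loop_block (Measuring h K src tgt) (fun t τ hτ => hτ.left) hstep hτ).mono_time ?_
  simp only [List.length_cons, List.length_nil]
  omega

/-- Writes one digit of the number of vertices, and the position of one row. -/
def layRow : List Instr :=
  [.store 1 6 1, .store 4 6 0, .add 0 0 14, .add 6 6 1, .sub 8 8 1]

/-- Writes the number of vertices in unary, and sets up array `4`, which holds the positions of the
rows of the adjacency matrix in the output. -/
def layRows : Program :=
  .seq (block [.add 0 14 1, .const 6 0, .add 8 14 19])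
    (.loop 8 (block layRow))

/-- The state of `layRows` after `x` of `m` rows. -/
structure Laying (h K : ℕ) (src tgt : ℕ → ℕ) (m x : ℕ) (σ : RamState) : Prop where
  ready : Ready h K src tgt σ
  output : σ.arr 1 = fun k => if k < x then 1 else 0
  rows : ∀ y < x, σ.arr 4 y = m + 1 + y * m
  next : σ.reg 0 = m + 1 + x * m
  size : σ.reg 14 = m
  index : σ.reg 6 = x
  left : σ.reg 8 = m - x

theorem Laying.execAll_layRow {m x : ℕ} (hσ : Laying h K src tgt m x σ) :
    Laying h K src tgt m (x + 1)
      (execAll layRow σ) := by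
  obtain ⟨⟨hone, hzero, hlength, hsize, hsrc, htgt⟩, hout, hrows, hnext, hm, hindex, hleft⟩ := hσ
  refine ⟨⟨?_, ?_, ?_, ?_, hsrc, htgt⟩, ?output, ?rows, ?_, ?_, ?_, ?_⟩
  case output =>
    funext k
    rcases lt_trichotomy k x with hk | rfl | hk
    · simp [layRow, *, hk.ne, hk.trans (Nat.lt_succ_self x)]
    · simp [layRow, *]
    · simp [layRow, *, hk.ne', hk.not_gt, (Nat.succ_le_of_lt hk).not_gt]
  case rows =>
    intro y hy
    obtain hyx | rfl : y < x ∨ y = x := by omega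
    · simp [layRow, *, hyx.ne]
    · simp [layRow, *]
  all_goals simp [layRow, *, Nat.sub_sub, Nat.succ_mul, add_assoc]

/-- The state when the edges `{x, y}` with `W x y` have been entered into the output. -/
structure Marked (h K : ℕ) (src tgt : ℕ → ℕ) (W : ℕ → ℕ → Prop) (σ : RamState) : Prop where
  ready : Ready h K src tgt σ
  total : σ.reg 0 = h + K * (K + 1) + 1 + (h + K * (K + 1)) * (h + K * (K + 1))
  rows : ∀ x < h + K * (K + 1), σ.arr 4 x = h + K * (K + 1) + 1 + x * (h + K * (K + 1))
  output : σ.arr 1 = marked (h + K * (K + 1)) W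

theorem Laying.marked (hσ : Laying h K src tgt (h + K * (K + 1)) (h + K * (K + 1)) σ) :
    Marked h K src tgt (fun _ _ => False) σ where
  ready := hσ.ready
  total := hσ.next
  rows := hσ.rows
  output := hσ.output.trans (funext fun k => by simp [DLAMaxCut.marked])

theorem haltsWithin_layRows (hσ : Measuring h K src tgt K σ) :
    HaltsWithin layRows σ ((h + K * (K + 1)) * 7 + 5) (Marked h K src tgt fun _ _ => False) := by
  have hstart : Laying h K src tgt (h + K * (K + 1)) 0
      (execAll [.add 0 14 1, .const 6 0, .add 8 14 19] σ) := by
    obtain ⟨⟨hone, hzero, hlength, hsize, hsrc, htgt⟩, hout, hnumber, -, -⟩ := hσ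
    refine ⟨⟨?_, ?_, ?_, ?_, hsrc, htgt⟩, ?_, ?_, ?_, ?_, ?_, ?_⟩ <;> simp [*]
  refine ((haltsWithin_block hstart).seq fun τ hτ =>
    haltsWithin_loop_block (Laying h K src tgt (h + K * (K + 1))) (fun x τ hτ => hτ.left)
      (fun x _ τ hτ => hτ.execAll_layRow) hτ).mono ?_ fun τ hτ => hτ.marked
  simp only [layRow, List.length_cons, List.length_nil]
  omega

/-- Enters the edge from the current inner vertex `reg 16` of a path to the next one, `reg 17`. -/
def walkStep : List Instr :=
  [.load 10 4 16, .add 10 10 17, .store 1 10 1, .load 10 4 17, .add 10 10 16, .store 1 10 1,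
    .add 16 17 19, .add 17 17 1, .sub 9 9 1]

/-- Enters the last edge of a path. -/
def closePath : List Instr :=
  [.load 12 3 6, .load 10 4 16, .add 10 10 12, .store 1 10 1, .load 10 4 12, .add 10 10 16,
    .store 1 10 1, .add 6 6 1, .add 15 15 1, .add 15 15 1, .sub 8 8 1]

/-- Enters the edges of the path that replaces the edge number `reg 6`. -/
def markPath : Program :=
  .seq (block [.load 16 2 6, .add 9 15 19]) (.seq (.loop 9 (block walkStep)) (block closePath))

/-- Enters the edges of the subdivision. -/
def markEdges : Program :=
  .seq (block [.const 6 0, .const 15 2, .add 17 4 19, .add 8 3 19]) (.loop 8 markPath)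

/-- The pair `(x, y)` is an edge of one of the first `t` paths, or one of the first `i` edges of the
path number `t`. -/
def PathEdgeBefore (h : ℕ) (src tgt : ℕ → ℕ) (t i x y : ℕ) : Prop :=
  ∃ t' i', (t' < t ∧ i' < 2 * t' + 3 ∨ t' = t ∧ i' < i) ∧
    x = pathPos h src tgt t' i' ∧ y = pathPos h src tgt t' (i' + 1)

theorem pathEdgeBefore_zero : PathEdgeBefore h src tgt 0 0 = fun _ _ => False := by
  funext x y
  simp [PathEdgeBefore]

theorem pathEdgeBefore_succ_right (t i : ℕ) : PathEdgeBefore h src tgt t (i + 1) = fun x y =>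
    PathEdgeBefore h src tgt t i x y ∨
      x = pathPos h src tgt t i ∧ y = pathPos h src tgt t (i + 1) := by
  funext x y
  refine propext ⟨?_, ?_⟩
  · rintro ⟨t', i', hi, hxy⟩
    obtain hi | ⟨rfl, rfl⟩ : (t' < t ∧ i' < 2 * t' + 3 ∨ t' = t ∧ i' < i) ∨ t' = t ∧ i' = i := by
      omega
    · exact Or.inl ⟨t', i', hi, hxy⟩
    · exact Or.inr hxy
  · rintro (⟨t', i', hi, hxy⟩ | hxy)
    · exact ⟨t', i', by omega, hxy⟩
    · exact ⟨t, i, by omega, hxy⟩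

theorem pathEdgeBefore_succ_left (t : ℕ) :
    PathEdgeBefore h src tgt (t + 1) 0 = PathEdgeBefore h src tgt t (2 * t + 3) := by
  funext x y
  refine propext (exists₂_congr fun t' i' => and_congr_left fun _ => ?_)
  omega

/-- The state of `markEdges` after `i` edges of the path number `t`, without the counters for
`i`. -/
structure PathScan (h K : ℕ) (src tgt : ℕ → ℕ) (t i : ℕ) (σ : RamState) : Prop where
  marked : Marked h K src tgt (PathEdgeBefore h src tgt t i) σ
  index : σ.reg 6 = t
  inner : σ.reg 15 = 2 * t + 2
  next : σ.reg 17 = h + t * (t + 1) + i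
  pathsLeft : σ.reg 8 = K - t

/-- The state of `markEdges` after `i` edges of the path number `t`. -/
structure StepScan (h K : ℕ) (src tgt : ℕ → ℕ) (t i : ℕ) (σ : RamState) : Prop where
  pathScan : PathScan h K src tgt t i σ
  here : σ.reg 16 = pathPos h src tgt t i
  stepsLeft : σ.reg 9 = 2 * t + 2 - i

theorem StepScan.execAll_walkStep (hE : IsEdgeListing h K src tgt) {t i : ℕ} (ht : t < K)
    (hi : i < 2 * t + 2) (hσ : StepScan h K src tgt t i σ) :
    StepScan h K src tgt t (i + 1) (execAll walkStep σ) := by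
  obtain ⟨⟨⟨⟨hone, hzero, hlength, hsize, hsrc, htgt⟩, htotal, hrows, hout⟩, hindex, hinner, hnext,
    hpaths⟩, hhere, hsteps⟩ := hσ
  have hnext' : σ.reg 17 = pathPos h src tgt t (i + 1) := by rw [hnext, pathPos, if_pos hi]
  have hrow := hrows _ (hE.pathPos_lt ht i)
  have hrow' := hrows _ (hE.pathPos_lt ht (i + 1))
  refine ⟨⟨⟨⟨?_, ?_, ?_, ?_, hsrc, htgt⟩, ?_, hrows, ?output⟩, ?_, ?_, ?_, ?_⟩, ?here, ?_⟩
  case output =>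
    rw [pathEdgeBefore_succ_right, ← update_marked]
    simp [walkStep, hone, hout, hhere, hnext', hrow, hrow']
  case here => simpa [walkStep, hzero] using hnext'
  all_goals simp [walkStep, *, Nat.sub_sub, add_assoc]

theorem StepScan.execAll_closePath (hE : IsEdgeListing h K src tgt) {t : ℕ} (ht : t < K)
    (hσ : StepScan h K src tgt t (2 * t + 2) σ) :
    PathScan h K src tgt (t + 1) 0 (execAll closePath σ) := by
  obtain ⟨⟨⟨⟨hone, hzero, hlength, hsize, hsrc, htgt⟩, htotal, hrows, hout⟩, hindex, hinner, hnext,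
    hpaths⟩, hhere, -⟩ := hσ
  have hrow := hrows _ (hE.pathPos_lt ht (2 * t + 2))
  have hrow' := hrows _ (hE.pathPos_lt ht (2 * t + 2 + 1))
  have hlast := htgt t ht
  rw [← pathPos_last h src tgt t] at hlast
  refine ⟨⟨⟨?_, ?_, ?_, ?_, hsrc, htgt⟩, ?_, hrows, ?output⟩, ?_, ?_, ?next, ?_⟩
  case output =>
    rw [pathEdgeBefore_succ_left, pathEdgeBefore_succ_right, ← update_marked]
    simp [closePath, hone, hout, hindex, hhere, hlast, hrow, hrow']
  case next =>
    simp [closePath, *]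
    ring
  all_goals simp [closePath, *, Nat.sub_sub, mul_add]

theorem haltsWithin_markPath (hE : IsEdgeListing h K src tgt) {t : ℕ} (ht : t < K)
    (hσ : PathScan h K src tgt t 0 σ) :
    HaltsWithin markPath σ (22 * K + 17) (PathScan h K src tgt (t + 1) 0) := by
  have hstart : StepScan h K src tgt t 0 (execAll [.load 16 2 6, .add 9 15 19] σ) := by
    obtain ⟨⟨⟨hone, hzero, hlength, hsize, hsrc, htgt⟩, htotal, hrows, hout⟩, hindex, hinner,
      hnext, hpaths⟩ := hσ
    refine ⟨⟨⟨⟨?_, ?_, ?_, ?_, hsrc, htgt⟩, ?_, hrows, ?_⟩, ?_, ?_, ?_, ?_⟩, ?_, ?_⟩ <;>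
      simp [*, pathPos]
  refine ((haltsWithin_block hstart).seq fun τ hτ =>
    (haltsWithin_loop_block (StepScan h K src tgt t) (fun i τ hτ => hτ.stepsLeft)
      (fun i hi τ hτ => hτ.execAll_walkStep hE ht hi) hτ).seq fun τ hτ =>
    haltsWithin_block (hτ.execAll_closePath hE ht)).mono_time ?_
  simp only [walkStep, closePath, List.length_cons, List.length_nil]
  omega

theorem haltsWithin_markEdges (hE : IsEdgeListing h K src tgt)
    (hσ : Marked h K src tgt (fun _ _ => False) σ) :
    HaltsWithin markEdges σ (K * (22 * K + 18) + 6)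
      (Marked h K src tgt (PathEdgeBefore h src tgt K 0)) := by
  have hstart : PathScan h K src tgt 0 0
      (execAll [.const 6 0, .const 15 2, .add 17 4 19, .add 8 3 19] σ) := by
    obtain ⟨⟨hone, hzero, hlength, hsize, hsrc, htgt⟩, htotal, hrows, hout⟩ := hσ
    refine ⟨⟨⟨?_, ?_, ?_, ?_, hsrc, htgt⟩, ?_, hrows, ?_⟩, ?_, ?_, ?_, ?_⟩ <;>
      simp [*, pathEdgeBefore_zero]
  refine ((haltsWithin_block hstart).seq fun τ hτ =>
    haltsWithin_countdown (fun t => PathScan h K src tgt t 0) (fun t τ hτ => hτ.pathsLeft)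
      (fun t ht τ hτ => haltsWithin_markPath hE ht hτ) hτ).mono ?_ fun τ hτ => hτ.marked
  simp only [List.length_cons, List.length_nil]
  linarith

theorem IsEdgeListing.subdivision_adj_iff (hE : IsEdgeListing h K src tgt)
    (x y : Fin (h + K * (K + 1))) :
    hE.subdivision.Adj x y ↔
      PathEdgeBefore h src tgt K 0 x y ∨ PathEdgeBefore h src tgt K 0 y x := by
  have hpath : ∀ u v : Fin (h + K * (K + 1)), PathEdgeBefore h src tgt K 0 u v ↔
      ∃ a : PathEdge Fin.val, edgeFst hE.vert a = u ∧ edgeSnd hE.vert a = v := by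
    intro u v
    constructor
    · rintro ⟨t, i, hti, h1, h2⟩
      exact ⟨⟨⟨t, by omega⟩, ⟨i, by simp only; omega⟩⟩, Fin.ext h1.symm, Fin.ext h2.symm⟩
    · rintro ⟨⟨t, i⟩, rfl, rfl⟩
      exact ⟨t, i, Or.inl ⟨t.2, i.2⟩, rfl, rfl⟩
  rw [hpath, hpath, ← exists_or]
  exact hE.enumeratesEdges_subdivision.adj_iff.trans (exists_congr fun a => Sym2.eq_iff)

theorem PathEdgeBefore.lt (hE : IsEdgeListing h K src tgt) {x y : ℕ}
    (hxy : PathEdgeBefore h src tgt K 0 x y) : x < h + K * (K + 1) ∧ y < h + K * (K + 1) := by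
  obtain ⟨t, i, hti, rfl, rfl⟩ := hxy
  exact ⟨hE.pathPos_lt (by omega) _, hE.pathPos_lt (by omega) _⟩

/-- The program that computes the reduced graph. -/
def reduction : Program :=
  .seq listOddGraph (.seq measure (.seq layRows markEdges))

variable {n : ℕ} (G : SimpleGraph (Fin n))

theorem length_oddList_le_length_encodeGraph :
    (oddList G).length ≤ 3 * (encodeGraph G).length := by
  have := length_edgeList_le G
  rw [length_oddList, length_encodeGraph]
  omega

theorem add_length_leaves_le_length_encodeGraph :
    n + (leaves G).length ≤ 4 * (encodeGraph G).length := by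
  have := length_edgeList_le G
  rw [length_leaves, length_encodeGraph]
  omega

theorem outputsWithin_reduction :
    OutputsWithin reduction (encodeGraph G) (encodeGraph (reducedGraph G))
      (1000 * (encodeGraph G).length ^ 2) := by
  have hin := isInput_inputState G []
  rw [List.append_nil] at hin
  have hE := isEdgeListing_oddList G
  obtain ⟨τ, s, hs, hrun, hτ⟩ := (haltsWithin_listOddGraph hin rfl (arr_inputState_one _)).seq
    fun τ hτ => (haltsWithin_measure hτ.ready hτ.listed.parsed.output).seq fun τ hτ =>
    (haltsWithin_layRows hτ).seq fun τ hτ => haltsWithin_markEdges hE hτ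
  refine ⟨τ, s, hs.trans ?_, hrun, showsOutput_encodeGraph (reducedGraph G)
    (fun x y hxy => hxy.lt hE) hE.subdivision_adj_iff hτ.total hτ.output⟩
  have hK := length_oddList_le_length_encodeGraph G
  have hl := add_length_leaves_le_length_encodeGraph G
  have hpos : 1 ≤ (encodeGraph G).length := by rw [length_encodeGraph]; omega
  have hn : n * n + n + 1 = (encodeGraph G).length := by rw [length_encodeGraph]; ring
  change _ + ((oddList G).length * 6 + 5 + ((n + _ + (oddList G).length * ((oddList G).length + 1))
    * 7 + 5 + _)) ≤ _
  nlinarith [Nat.mul_le_mul hK hK]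

end Reduction

/-! ### Transforming cuts -/

section Colouring

attribute [local simp] execAll Instr.exec

variable {n : ℕ} (G : SimpleGraph (Fin n))

/-- The state when the edges of the odd graph are stored and the vertices below `x` have been
coloured by `c`. -/
structure Coloured (c : ℕ → Bool) (x : ℕ) (σ : RamState) : Prop where
  one : σ.reg 1 = 1
  zero : σ.reg 19 = 0
  size : σ.reg 2 = n
  length : σ.reg 3 = (oddList G).length
  edges : σ.reg 13 = (edgeList G).length
  src : ∀ t < (oddList G).length, σ.arr 2 t = listSrc (oddList G) t
  next : σ.reg 6 = x
  colour : ∀ y < x, σ.arr 1 y = (c y).toNat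

variable {G} {c : ℕ → Bool} {σ : RamState}

theorem update_colour {f : ℕ → ℕ} {x : ℕ} (hf : ∀ y < x, f y = (c y).toNat) {a : ℕ}
    (ha : a = (c x).toNat) : ∀ y < x + 1, Function.update f x a y = (c y).toNat := by
  intro y hy
  obtain hyx | rfl : y < x ∨ y = x := by omega
  · rw [Function.update_of_ne hyx.ne, hf y hyx]
  · rw [Function.update_self, ha]

theorem one_sub_toNat (b : Bool) : 1 - b.toNat = (!b).toNat := by
  cases b <;> rfl

/-- Copies one bit of the input to the output. -/
def copyBit : List Instr :=
  [.load 10 0 5, .store 1 6 10, .add 5 5 1, .add 6 6 1, .sub 8 8 1]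

/-- Copies the colours of the vertices of the input graph to the output. -/
def copyCut : Program :=
  .seq (block [.const 6 0, .add 8 2 19]) (.loop 8 (block copyBit))

/-- The state of `copyCut` after copying `x` bits. -/
structure Copying (G : SimpleGraph (Fin n)) (c : ℕ → Bool) (inp : ℕ → ℕ) (x : ℕ) (σ : RamState) :
    Prop where
  coloured : Coloured G c x σ
  input : σ.arr 0 = inp
  pos : σ.reg 5 = n + 1 + n * n + x
  left : σ.reg 8 = n - x

theorem Copying.execAll_copyBit {inp : ℕ → ℕ} {x : ℕ}
    (hx : inp (n + 1 + n * n + x) = (c x).toNat) (hσ : Copying G c inp x σ) :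
    Copying G c inp (x + 1) (execAll copyBit σ) := by
  obtain ⟨⟨hone, hzero, hsize, hlength, hedges, hsrc, hnext, hcolour⟩, hin, hpos, hleft⟩ := hσ
  refine ⟨⟨?_, ?_, ?_, ?_, ?_, hsrc, ?_, ?colour⟩, ?_, ?_, ?_⟩
  case colour => simpa [copyBit, hone, hin, hnext, hpos] using update_colour hcolour hx
  all_goals simp [copyBit, *, Nat.sub_sub, add_assoc]

theorem haltsWithin_copyCut {inp : ℕ → ℕ} (hc : ∀ x < n, inp (n + 1 + n * n + x) = (c x).toNat)
    (hσ : Attached n inp (edgeList G) (leaves G) σ) :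
    HaltsWithin copyCut σ (n * 7 + 4) (Coloured G c n) := by
  have hstart : Copying G c inp 0 (execAll [.const 6 0, .add 8 2 19] σ) := by
    obtain ⟨⟨⟨⟨hone, hzero, hsize, hin⟩, -⟩, hlength, hlists⟩, hedges, -, hpos⟩ := hσ
    refine ⟨⟨?_, ?_, ?_, hlength, ?_, fun t ht => (hlists t ht).1, ?_, ?_⟩, ?_, ?_, ?_⟩ <;>
      simp [*]
  refine ((haltsWithin_block hstart).seq fun τ hτ =>
    haltsWithin_loop_block (Copying G c inp) (fun x τ hτ => hτ.left)
      (fun x hx τ hτ => hτ.execAll_copyBit (hc x hx)) hτ).mono ?_ fun τ hτ => hτ.coloured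
  simp only [copyBit, List.length_cons, List.length_nil]
  omega

/-- Gives a leaf the colour that its neighbour does not have. -/
def colourLeaf : List Instr :=
  [.load 10 2 7, .load 11 1 10, .sub 11 1 11, .store 1 6 11, .add 6 6 1, .add 7 7 1, .sub 8 8 1]

/-- Colours the leaves of the odd graph. -/
def colourLeaves : Program :=
  .seq (block [.add 7 13 19, .sub 8 3 13]) (.loop 8 (block colourLeaf))

/-- The state of `colourLeaves` after `s` leaves. -/
structure LeafColouring (G : SimpleGraph (Fin n)) (c : ℕ → Bool) (s : ℕ) (σ : RamState) :
    Prop where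
  coloured : Coloured G c (n + s) σ
  index : σ.reg 7 = (edgeList G).length + s
  left : σ.reg 8 = (leaves G).length - s

theorem IsAlternating.apply_leaf (hc : IsAlternating G c) {s : ℕ} (hs : s < (leaves G).length) :
    c (n + s) = !c (listSrc (oddList G) ((edgeList G).length + s)) := by
  rw [listSrc_oddList_leaf hs]
  exact hc.leaf ((leaves G)[s], n + s)
    (List.mk_add_mem_zipIdx_iff_getElem?.mpr (List.getElem?_eq_getElem hs))

theorem LeafColouring.execAll_colourLeaf (hc : IsAlternating G c) {s : ℕ}
    (hs : s < (leaves G).length) (hσ : LeafColouring G c s σ) :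
    LeafColouring G c (s + 1) (execAll colourLeaf σ) := by
  obtain ⟨⟨hone, hzero, hsize, hlength, hedges, hsrc, hnext, hcolour⟩, hindex, hleft⟩ := hσ
  have hs' : (edgeList G).length + s < (oddList G).length := by
    rw [length_oddList_eq_add]
    omega
  have hneighbour := hsrc _ hs'
  have hbit := hcolour _ ((listSrc_oddList_leaf_lt hs).trans_le (Nat.le_add_right n s))
  have hleaf := hc.apply_leaf hs
  refine ⟨⟨?_, ?_, ?_, ?_, ?_, hsrc, ?_, ?colour⟩, ?_, ?_⟩
  case colour =>
    rw [← add_assoc]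
    simpa [colourLeaf, hone, hindex, hneighbour, hbit, hnext] using
      update_colour hcolour ((one_sub_toNat _).trans (congrArg Bool.toNat hleaf.symm))
  all_goals simp [colourLeaf, *, Nat.sub_sub, add_assoc]

theorem haltsWithin_colourLeaves (hc : IsAlternating G c) (hσ : Coloured G c n σ) :
    HaltsWithin colourLeaves σ ((leaves G).length * 9 + 4)
      (Coloured G c (n + (leaves G).length)) := by
  have hstart : LeafColouring G c 0 (execAll [.add 7 13 19, .sub 8 3 13] σ) := by
    obtain ⟨hone, hzero, hsize, hlength, hedges, hsrc, hnext, hcolour⟩ := hσ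
    refine ⟨⟨?_, ?_, ?_, ?_, ?_, hsrc, ?_, hcolour⟩, ?_, ?_⟩ <;>
      simp [*, length_oddList_eq_add]
  refine ((haltsWithin_block hstart).seq fun τ hτ =>
    haltsWithin_loop_block (LeafColouring G c) (fun s τ hτ => hτ.left)
      (fun s hs τ hτ => hτ.execAll_colourLeaf hc hs) hτ).mono ?_ fun τ hτ => hτ.coloured
  simp only [colourLeaf, List.length_cons, List.length_nil]
  omega

/-- Colours the next inner vertex of a path. -/
def colourStep : List Instr :=
  [.sub 11 1 11, .store 1 6 11, .add 6 6 1, .sub 9 9 1]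

/-- Colours the inner vertices of the path that replaces the edge number `reg 7`. -/
def colourPath : Program :=
  .seq (block [.load 10 2 7, .load 11 1 10, .add 9 15 19])
    (.seq (.loop 9 (block colourStep)) (block [.add 7 7 1, .add 15 15 1, .add 15 15 1, .sub 8 8 1]))

/-- Colours the inner vertices of the subdivided edges. -/
def colourPaths : Program :=
  .seq (block [.const 7 0, .const 15 2, .add 8 3 19]) (.loop 8 colourPath)

/-- The state of `colourPaths` after `i` inner vertices of the path number `t`, without the counter
for `i`. -/
structure PathColouring (G : SimpleGraph (Fin n)) (c : ℕ → Bool) (t i : ℕ) (σ : RamState) :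
    Prop where
  coloured : Coloured G c (n + (leaves G).length + t * (t + 1) + i) σ
  index : σ.reg 7 = t
  inner : σ.reg 15 = 2 * t + 2
  pathsLeft : σ.reg 8 = (oddList G).length - t

/-- The state of `colourPaths` after `i` inner vertices of the path number `t`. -/
structure StepColouring (G : SimpleGraph (Fin n)) (c : ℕ → Bool) (t i : ℕ) (σ : RamState) :
    Prop where
  pathColouring : PathColouring G c t i σ
  here : σ.reg 11 =
    (c (pathPos (n + (leaves G).length) (listSrc (oddList G)) (listTgt (oddList G)) t i)).toNat
  stepsLeft : σ.reg 9 = 2 * t + 2 - i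

theorem StepColouring.execAll_colourStep (hc : IsAlternating G c) {t : ℕ}
    (ht : t < (oddList G).length) {i : ℕ} (hi : i < 2 * t + 2) (hσ : StepColouring G c t i σ) :
    StepColouring G c t (i + 1) (execAll colourStep σ) := by
  obtain ⟨⟨⟨hone, hzero, hsize, hlength, hedges, hsrc, hnext, hcolour⟩, hindex, hinner, hpaths⟩,
    hhere, hsteps⟩ := hσ
  have hflip : 1 - σ.reg 11 = (c (pathPos (n + (leaves G).length) (listSrc (oddList G))
      (listTgt (oddList G)) t (i + 1))).toNat := by
    rw [hhere, one_sub_toNat, hc.path t ht i hi]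
  have hnew : 1 - σ.reg 11 = (c (n + (leaves G).length + t * (t + 1) + i)).toNat := by
    rw [hflip, pathPos, if_pos hi]
  refine ⟨⟨⟨?_, ?_, ?_, ?_, ?_, hsrc, ?_, ?colour⟩, ?_, ?_, ?_⟩, ?here, ?_⟩
  case colour => simpa [colourStep, hone, hnext, add_assoc] using update_colour hcolour hnew
  case here => simpa [colourStep, hone] using hflip
  all_goals simp [colourStep, *, Nat.sub_sub, add_assoc]

theorem haltsWithin_colourPath (hc : IsAlternating G c) {t : ℕ} (ht : t < (oddList G).length)
    (hσ : PathColouring G c t 0 σ) :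
    HaltsWithin colourPath σ (12 * (oddList G).length + 10) (PathColouring G c (t + 1) 0) := by
  refine ((haltsWithin_block (Q := StepColouring G c t 0) ?_).seq fun τ hτ =>
    (haltsWithin_loop_block (StepColouring G c t) (fun i τ hτ => hτ.stepsLeft)
      (fun i hi τ hτ => hτ.execAll_colourStep hc ht hi) hτ).seq fun τ hτ =>
    haltsWithin_block ?_).mono_time ?_
  · obtain ⟨⟨hone, hzero, hsize, hlength, hedges, hsrc, hnext, hcolour⟩, hindex, hinner, hpaths⟩ :=
      hσ
    have hbit := hcolour _
      (((isEdgeListing_oddList G).src_lt t ht).trans_le (by rw [add_assoc]; exact le_self_add))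
    refine ⟨⟨⟨?_, ?_, ?_, ?_, ?_, hsrc, ?_, hcolour⟩, ?_, ?_, ?_⟩, ?_, ?_⟩ <;>
      simp [*, pathPos]
  · obtain ⟨⟨⟨hone, hzero, hsize, hlength, hedges, hsrc, hnext, hcolour⟩, hindex, hinner, hpaths⟩,
      -, -⟩ := hτ
    have hend : n + (leaves G).length + t * (t + 1) + (2 * t + 2) =
      n + (leaves G).length + (t + 1) * (t + 1 + 1) + 0 := by ring
    rw [hend] at hnext hcolour
    refine ⟨⟨?_, ?_, ?_, ?_, ?_, hsrc, hnext, hcolour⟩, ?_, ?_, ?_⟩ <;>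
      simp [*, Nat.sub_sub, mul_add]
  · simp only [colourStep, List.length_cons, List.length_nil]
    omega

theorem haltsWithin_colourPaths (hc : IsAlternating G c)
    (hσ : Coloured G c (n + (leaves G).length) σ) :
    HaltsWithin colourPaths σ ((oddList G).length * (12 * (oddList G).length + 11) + 5)
      (Coloured G c (reducedSize G)) := by
  have hstart : PathColouring G c 0 0
      (execAll [.const 7 0, .const 15 2, .add 8 3 19] σ) := by
    obtain ⟨hone, hzero, hsize, hlength, hedges, hsrc, hnext, hcolour⟩ := hσ
    refine ⟨⟨?_, ?_, ?_, ?_, ?_, hsrc, ?_, hcolour⟩, ?_, ?_, ?_⟩ <;> simp [*]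
  refine ((haltsWithin_block hstart).seq fun τ hτ =>
    haltsWithin_countdown (fun t => PathColouring G c t 0) (fun t τ hτ => hτ.pathsLeft)
      (fun t ht τ hτ => haltsWithin_colourPath hc ht hτ) hτ).mono ?_ fun τ hτ => hτ.coloured
  simp only [List.length_cons, List.length_nil]
  linarith

/-- The program that extends a cut of the input graph to the reduced graph. -/
def forward : Program :=
  .seq listOddGraph (.seq copyCut (.seq colourLeaves (.seq colourPaths (block [.add 0 6 19]))))

/-- The program that restricts a cut of the reduced graph to the input graph. -/
def backward : Program :=
  .seq listOddGraph (.seq copyCut (block [.add 0 2 19]))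

theorem arr_inputState_append (r : List Bool) (k : ℕ) :
    (inputState (encodeGraph G ++ r)).arr 0 (n + 1 + n * n + k) = (r.getD k false).toNat := by
  rw [arr_inputState_zero, getD_encodeGraph_append]

variable (G) in
theorem thousand_mul_sq_le (r : List Bool) :
    1000 * (encodeGraph G).length ^ 2 ≤ 1000 * (encodeGraph G ++ r).length ^ 2 := by
  gcongr
  exact (List.sublist_append_left _ r).length_le

theorem outputsWithin_forward (hc : IsAlternating G c) :
    OutputsWithin forward (encodeGraph G ++ encodeCut fun x : Fin n => c x)
      (encodeCut fun x : Fin (reducedSize G) => c x)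
      (1000 * (encodeGraph G ++ encodeCut fun x : Fin n => c x).length ^ 2) := by
  have hin := isInput_inputState G (encodeCut fun x : Fin n => c x)
  have hcut : ∀ x < n, (inputState (encodeGraph G ++ encodeCut fun x : Fin n => c x)).arr 0
      (n + 1 + n * n + x) = (c x).toNat := fun x hx => by
    rw [arr_inputState_append, getD_encodeCut hx]
  obtain ⟨τ, s, hs, hrun, hsize, hτ⟩ :=
    (haltsWithin_listOddGraph hin rfl (arr_inputState_one _)).seq
    fun τ hτ => (haltsWithin_copyCut hcut hτ).seq fun τ hτ => (haltsWithin_colourLeaves hc hτ).seq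
    fun τ hτ => (haltsWithin_colourPaths hc hτ).seq fun τ hτ => haltsWithin_block
      (Q := fun τ => τ.reg 0 = reducedSize G ∧ ∀ y < reducedSize G, τ.arr 1 y = (c y).toNat)
      (l := [.add 0 6 19]) ⟨by simp [hτ.zero, hτ.next], hτ.colour⟩
  refine ⟨τ, s, hs.trans (le_trans ?_ (thousand_mul_sq_le G _)), hrun,
    showsOutput_encodeCut hsize hτ⟩
  have hK := length_oddList_le_length_encodeGraph G
  have hl := add_length_leaves_le_length_encodeGraph G
  have hpos : 1 ≤ (encodeGraph G).length := by rw [length_encodeGraph]; omega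
  have hn : n * n + n + 1 = (encodeGraph G).length := by rw [length_encodeGraph]; ring
  rw [List.length_singleton]
  nlinarith [Nat.mul_le_mul hK hK]

theorem outputsWithin_backward (C : Fin (reducedSize G) → Bool) :
    OutputsWithin backward (encodeGraph G ++ encodeCut C) (encodeCut (restrictCut G C))
      (1000 * (encodeGraph G ++ encodeCut C).length ^ 2) := by
  have hin := isInput_inputState G (encodeCut C)
  obtain ⟨τ, s, hs, hrun, hsize, hτ⟩ :=
    (haltsWithin_listOddGraph hin rfl (arr_inputState_one _)).seq fun τ hτ =>
    (haltsWithin_copyCut (fun x _ => arr_inputState_append (encodeCut C) x) hτ).seq fun τ hτ =>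
    haltsWithin_block (Q := fun τ => τ.reg 0 = n ∧
      ∀ y < n, τ.arr 1 y = ((encodeCut C).getD y false).toNat)
      (l := [.add 0 2 19]) ⟨by simp [hτ.zero, hτ.size], hτ.colour⟩
  refine ⟨τ, s, hs.trans (le_trans ?_ (thousand_mul_sq_le G _)), hrun,
    showsOutput_encodeCut hsize fun y hy => ?_⟩
  · rw [length_encodeGraph, List.length_singleton]
    nlinarith
  · rw [hτ y hy, getD_encodeCut (hy.trans_le (le_reducedSize G)), restrictCut]
    rfl

end Colouring

end DLAMaxCut

theorem mainTheorem5 :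
    ∃ (reduction forward backward : DLAMaxCut.Program) (T : Polynomial ℕ) (c : ℕ),
      ∀ (n : ℕ) (G : SimpleGraph (Fin n)), G.Connected →
        ∃ (m : ℕ) (G' : SimpleGraph (Fin m)),
          -- the graph `G'` is computed from `G` in polynomial time
          DLAMaxCut.OutputsWithin reduction (DLAMaxCut.encodeGraph G) (DLAMaxCut.encodeGraph G')
            (T.eval (DLAMaxCut.encodeGraph G).length) ∧
          DLAMaxCut.IsAsymmetricallySubdividedOddGraph G' ∧
          m ≤ c * max 1 (G.edgeSet.ncard ^ 2) ∧
          G'.edgeSet.ncard ≤ c * max 1 (G.edgeSet.ncard ^ 2) ∧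
          (DLAMaxCut.maxCut G' : ℤ) - (DLAMaxCut.maxCut G : ℤ) = (m : ℤ) - (n : ℤ) ∧
          -- optimal cuts of `G` are transformed into optimal cuts of `G'` in polynomial time
          (∀ C : Fin n → Bool, DLAMaxCut.IsOptimalCut G C →
            ∃ C' : Fin m → Bool, DLAMaxCut.IsOptimalCut G' C' ∧
              DLAMaxCut.OutputsWithin forward
                (DLAMaxCut.encodeGraph G ++ DLAMaxCut.encodeCut C) (DLAMaxCut.encodeCut C')
                (T.eval (DLAMaxCut.encodeGraph G ++ DLAMaxCut.encodeCut C).length)) ∧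
          -- and conversely
          (∀ C' : Fin m → Bool, DLAMaxCut.IsOptimalCut G' C' →
            ∃ C : Fin n → Bool, DLAMaxCut.IsOptimalCut G C ∧
              DLAMaxCut.OutputsWithin backward
                (DLAMaxCut.encodeGraph G ++ DLAMaxCut.encodeCut C') (DLAMaxCut.encodeCut C)
                (T.eval (DLAMaxCut.encodeGraph G ++ DLAMaxCut.encodeCut C').length)) ∧
          DLAMaxCut.IsFreeDLA G' := by
  open DLAMaxCut in
  refine ⟨reduction, forward, backward, 1000 * Polynomial.X ^ 2, 100, fun n G hG => ?_⟩
  have heval (k : ℕ) : (1000 * Polynomial.X ^ 2 : Polynomial ℕ).eval k = 1000 * k ^ 2 := by simp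
  simp only [heval]
  refine ⟨reducedSize G, reducedGraph G, outputsWithin_reduction G,
    isAsymmetricallySubdividedOddGraph_reducedGraph hG, reducedSize_le hG,
    ncard_edgeSet_reducedGraph_le hG, ?_, fun C hC => ?_,
    fun C' hC' => ⟨restrictCut G C', hC'.restrictCut, outputsWithin_backward C'⟩,
    isFreeDLA_reducedGraph G⟩
  · rw [maxCut_reducedGraph, reducedSize]
    push_cast
    ring
  · obtain ⟨c, hc, rfl⟩ := exists_extension G C
    exact ⟨_, hc.isOptimalCut hC, outputsWithin_forward hc⟩
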